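/- Notation. For $z,w\in\mathbb{C}^d$ write $z\cdot w=\sum_j z_jw_j$, $|z|^2=\sum_j|z_j|^2$, and let $dw$ be Lebesgue measure on $\mathbb{C}^d\cong\mathbb{R}^{2d}$. Let $\varphi_0(t)=2^{d/4}e^{-\pi|t|^2}$ on $\mathbb{R}^d$. For a tempered distribution $f\in\mathscr{S}'(\mathbb{R}^d)$ let $V_{\varphi_0}f(x,\omega)=\langle f,M_\omega T_x\varphi_0\rangle$, where $T_x g(t)=g(t-x)$, $M_\omega g(t)=e^{2\pi i\omega\cdot t}g(t)$ and the bracket is anti-linear in the second argument. For $1\le p\le\infty$ the modulation space is $$M^p(\mathbb{R}^d)=\{f\in\mathscr{S}'(\mathbb{R}^d): V_{\varphi_0}f\in L^p(\mathbb{R}^{2d})\},\qquad \|f\|_{M^p}=\|V_{\varphi_0}f\|_{L^p}.$$ Let $M_c(M^p)$ be the set of all $u\in\mathscr{S}'(\mathbb{R}^d)$ for which there is a bounded linear operator $A$ on $M^p(\mathbb{R}^d)$, commuting with all translations $T_y$, $y\in\mathbb{R}^d$, such that $Af=u*f$ for every Schwartz function $f$. The Sobolev–Fock space $\mathcal{F}^p(\mathbb{C}^d)$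 consists of the entire functions $F$ on $\mathbb{C}^d$ with $F(z)e^{-\pi|z|^2/2}\in L^p(\mathbb{C}^d)$, normed by the $L^p$ norm of $F(z)e^{-\pi|z|^2/2}$. For $y\in\mathbb{R}^d$ let $\beta_yF(w)=e^{-\pi|y|^2/2}e^{\pi y\cdot w}F(w-y)$; a bounded operator on $\mathcal{F}^p(\mathbb{C}^d)$ is called translation invariant if it commutes with $\beta_y$ for every $y\in\mathbb{R}^d$. For $u\in\mathscr{S}'(\mathbb{R}^d)$ let $$\phi_u(z)=\int_{\mathbb{R}^d}u(y)e^{-\pi|y|^2/2-\pi y\cdot z}\,dy,\qquad z\in\mathbb{C}^d,$$ that is, $u$ applied to the Schwartz function $y\mapsto e^{-\pi|y|^2/2-\pi y\cdot z}$. Theorem. Let $1\le p<\infty$. (1) Let $u\in M_c(M^p)$. Then for every $F\in\mathcal{F}^1(\mathbb{C}^d)$ the integral $$S_uF(z)=\int_{\mathbb{C}^d}F(w)\,e^{\pi\overline{w}\cdot z}\,\phi_u(\overline{w}-z)\,e^{-\pi|w|^2}\,dw$$ converges absolutely for every $z\in\mathbb{C}^d$, and $S_uF\in\mathcal{F}^\infty(\mathbb{C}^d)$.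 Moreover $\mathcal{F}^1(\mathbb{C}^d)\subset\mathcal{F}^p(\mathbb{C}^d)$, there is exactly one bounded linear operator $S$ on $\mathcal{F}^p(\mathbb{C}^d)$ with $SF=S_uF$ for all $F\in\mathcal{F}^1(\mathbb{C}^d)$, and this $S$ is translation invariant. (2) Conversely, if $S$ is a bounded, translation invariant operator on $\mathcal{F}^p(\mathbb{C}^d)$, then there is $u\in M_c(M^p)$ such that $SF=S_uF$ for all $F\in\mathcal{F}^1(\mathbb{C}^d)$. -/

import Mathlib

open MeasureTheory SchwartzMap
open scoped ENNReal ComplexConjugate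

noncomputable section

namespace SobolevFock

/-- Real space `ℝ^d` with its Euclidean norm. -/
abbrev RSpace (d : ℕ) : Type := EuclideanSpace ℝ (Fin d)

/-- Complex space `ℂ^d`; its `volume` is `2d`-dimensional Lebesgue measure. The Euclidean length
is `normSq` below (the sup norm of the function space is only used for its topology). -/
abbrev CSpace (d : ℕ) : Type := Fin d → ℂ

/-- The bilinear product `z · w = ∑ z_j w_j`. -/
def cdot {d : ℕ} (z w : CSpace d) : ℂ := ∑ j, z j * w j

/-- The squared Euclidean length `|z|^2 = ∑ |z_j|^2`. -/
def normSq {d : ℕ} (z : CSpace d) : ℝ := ∑ j, ‖z j‖ ^ 2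

/-- The inclusion `ℝ^d ⊆ ℂ^d`. -/
def toC {d : ℕ} (y : RSpace d) : CSpace d := fun j => (y j : ℂ)

/-! ### Gaussians as Schwartz functions -/

theorem norm_iteratedFDeriv_cexp_le (n : ℕ) (z : ℂ) :
    ‖iteratedFDeriv ℝ n Complex.exp z‖ ≤ ‖Complex.exp z‖ := by
  induction n with
  | zero => simp
  | succ n ih =>
    rw [← norm_iteratedFDeriv_fderiv]
    have h : fderiv ℝ Complex.exp = (ContinuousLinearMap.mul ℝ ℂ) ∘ Complex.exp := by
      funext w
      have h1 : HasFDerivAt Complex.exp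
          ((ContinuousLinearMap.toSpanSingleton ℂ (Complex.exp w)).restrictScalars ℝ) w :=
        (Complex.hasDerivAt_exp w).hasFDerivAt.restrictScalars ℝ
      rw [h1.fderiv]
      ext
      simp [mul_comm]
    rw [h]
    have hc : ContDiffAt ℝ n Complex.exp z := Complex.contDiff_exp.contDiffAt
    refine ((ContinuousLinearMap.mul ℝ ℂ).norm_iteratedFDeriv_comp_left hc le_rfl).trans ?_
    calc ‖ContinuousLinearMap.mul ℝ ℂ‖ * ‖iteratedFDeriv ℝ n Complex.exp z‖
        ≤ 1 * ‖iteratedFDeriv ℝ n Complex.exp z‖ := by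
          gcongr
          exact ContinuousLinearMap.opNorm_mul_le ℝ ℂ
      _ ≤ _ := by simpa using ih

/-- The exponent `-a|t|^2 + b · t`. -/
def gaussExponent {d : ℕ} (a : ℝ) (b : CSpace d) (t : RSpace d) : ℂ :=
  -((a * ‖t‖ ^ 2 : ℝ) : ℂ) + cdot b (toC t)

theorem gaussExponent_hasTemperateGrowth {d : ℕ} (a : ℝ) (b : CSpace d) :
    (gaussExponent a b).HasTemperateGrowth := by
  have h1 : (fun t : RSpace d => (a * ‖t‖ ^ 2 : ℝ)).HasTemperateGrowth :=
    (Function.HasTemperateGrowth.const a).mul (Function.hasTemperateGrowth_norm_sq _)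
  have h0 : Complex.ofReal.HasTemperateGrowth :=
    Function.Complex.hasTemperateGrowth_ofReal
  have h2 := (h0.comp h1).neg
  have h3 : ∀ j : Fin d, (fun t : RSpace d => b j * (t j : ℂ)).HasTemperateGrowth := by
    intro j
    refine (Function.HasTemperateGrowth.const (b j)).mul ?_
    exact h0.comp
      (EuclideanSpace.proj (𝕜 := ℝ) j).hasTemperateGrowth
  have h4 : (fun t : RSpace d => ∑ j, b j * (t j : ℂ)).HasTemperateGrowth :=
    Function.HasTemperateGrowth.sum (fun j _ => h3 j)
  exact h2.add h4

theorem gaussExponent_re_le {d : ℕ} (a : ℝ) (b : CSpace d) (t : RSpace d) :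
    (gaussExponent a b t).re ≤ -a * ‖t‖ ^ 2 + (∑ j, ‖b j‖) * ‖t‖ := by
  have h : (cdot b (toC t)).re ≤ (∑ j, ‖b j‖) * ‖t‖ := by
    refine (Complex.re_le_norm _).trans ((norm_sum_le _ _).trans ?_)
    rw [Finset.sum_mul]
    gcongr with j
    rw [norm_mul]
    gcongr
    simpa [toC] using PiLp.norm_apply_le t j
  simp only [gaussExponent, Complex.add_re, Complex.neg_re, Complex.ofReal_re]
  linarith

/-- `(1+r)^m e^{-ar²+Br}` is bounded on `[0,∞)`. -/
theorem exists_gauss_bound (a B : ℝ) (ha : 0 < a) (m : ℕ) :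
    ∃ C : ℝ, 0 ≤ C ∧ ∀ r : ℝ, 0 ≤ r → (1 + r) ^ m * Real.exp (-a * r ^ 2 + B * r) ≤ C := by
  refine ⟨m.factorial * Real.exp (1 + (B + 1) ^ 2 / (4 * a)), by positivity, fun r hr => ?_⟩
  have h1 : (1 + r) ^ m ≤ m.factorial * Real.exp (1 + r) := by
    have := Real.pow_div_factorial_le_exp (1 + r) (by positivity) m
    rw [div_le_iff₀ (by positivity)] at this
    linarith
  have h2 : (1 + r) + (-a * r ^ 2 + B * r) ≤ 1 + (B + 1) ^ 2 / (4 * a) := by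
    have : (B + 1) ^ 2 / (4 * a) - ((B + 1) * r - a * r ^ 2)
        = (B + 1 - 2 * a * r) ^ 2 / (4 * a) := by
      field_simp
      ring
    have h3 : 0 ≤ (B + 1 - 2 * a * r) ^ 2 / (4 * a) := by positivity
    linarith
  calc (1 + r) ^ m * Real.exp (-a * r ^ 2 + B * r)
      ≤ m.factorial * Real.exp (1 + r) * Real.exp (-a * r ^ 2 + B * r) := by gcongr
    _ = m.factorial * Real.exp ((1 + r) + (-a * r ^ 2 + B * r)) := by
        rw [mul_assoc, ← Real.exp_add]
    _ ≤ _ := by gcongr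

/-- The Schwartz function `t ↦ e^{-a|t|^2 + b·t}`, for `a > 0` and `b ∈ ℂ^d`. -/
def gaussSchwartz {d : ℕ} (a : ℝ) (ha : 0 < a) (b : CSpace d) : 𝓢(RSpace d, ℂ) where
  toFun t := Complex.exp (gaussExponent a b t)
  smooth' := Complex.contDiff_exp.comp (gaussExponent_hasTemperateGrowth a b).1
  decay' := by
    intro k n
    obtain ⟨l, C, hC, hb⟩ :=
      (gaussExponent_hasTemperateGrowth a b).norm_iteratedFDeriv_le_uniform n
    obtain ⟨K, hK, hKb⟩ := exists_gauss_bound a (∑ j, ‖b j‖) ha (k + l * n)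
    refine ⟨n.factorial * (C + 1) ^ n * K, fun t => ?_⟩
    have hone : (1 : ℝ) ≤ (1 + ‖t‖) ^ l := one_le_pow₀ (by linarith [norm_nonneg t])
    have hD1 : 1 ≤ (C + 1) * (1 + ‖t‖) ^ l := by nlinarith
    have hD : ∀ i, 1 ≤ i → i ≤ n →
        ‖iteratedFDeriv ℝ i (gaussExponent a b) t‖ ≤ ((C + 1) * (1 + ‖t‖) ^ l) ^ i := by
      intro i hi hin
      refine (hb i hin t).trans (le_trans ?_ (le_self_pow₀ hD1 (by omega)))
      gcongr
      linarith
    have hmain := norm_iteratedFDeriv_comp_le (𝕜 := ℝ) (n := n) (N := n)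
      (Complex.contDiff_exp)
      ((gaussExponent_hasTemperateGrowth a b).1.of_le (by exact_mod_cast le_top)) le_rfl t
      (fun i _ => norm_iteratedFDeriv_cexp_le i (gaussExponent a b t)) hD
    have hexp : ‖Complex.exp (gaussExponent a b t)‖
        ≤ Real.exp (-a * ‖t‖ ^ 2 + (∑ j, ‖b j‖) * ‖t‖) := by
      rw [Complex.norm_exp]
      exact Real.exp_le_exp.2 (gaussExponent_re_le a b t)
    calc ‖t‖ ^ k * ‖iteratedFDeriv ℝ n (Complex.exp ∘ gaussExponent a b) t‖
        ≤ (1 + ‖t‖) ^ k * (n.factorial *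
            Real.exp (-a * ‖t‖ ^ 2 + (∑ j, ‖b j‖) * ‖t‖) * ((C + 1) * (1 + ‖t‖) ^ l) ^ n) := by
          gcongr
          · linarith
          · exact hmain.trans (by gcongr)
      _ = n.factorial * (C + 1) ^ n * ((1 + ‖t‖) ^ (k + l * n) *
            Real.exp (-a * ‖t‖ ^ 2 + (∑ j, ‖b j‖) * ‖t‖)) := by
          rw [mul_pow, pow_add, ← pow_mul]
          ring
      _ ≤ n.factorial * (C + 1) ^ n * K := by
          gcongr
          exact hKb _ (norm_nonneg t)

theorem gaussSchwartz_apply {d : ℕ} (a : ℝ) (ha : 0 < a) (b : CSpace d) (t : RSpace d) :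
    gaussSchwartz a ha b t = Complex.exp (-((a * ‖t‖ ^ 2 : ℝ) : ℂ) + ∑ j, b j * (t j : ℂ)) := rfl

/-! ### Short-time Fourier transform and modulation spaces -/

/-- The normalised Gaussian window `φ₀(t) = 2^{d/4} e^{-π|t|^2}`. -/
def window {d : ℕ} (t : RSpace d) : ℂ :=
  (2 : ℂ) ^ ((d : ℂ) / 4) * Complex.exp (-(Real.pi * ‖t‖ ^ 2 : ℝ))

/-- The complex conjugate of the time-frequency shift `π(x,ω)φ₀ = M_ω T_x φ₀` of the window,
as a Schwartz function; see `stftAtom_apply`. -/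
def stftAtom {d : ℕ} (x ω : RSpace d) : 𝓢(RSpace d, ℂ) :=
  ((2 : ℂ) ^ ((d : ℂ) / 4) * Complex.exp (-(Real.pi * ‖x‖ ^ 2 : ℝ))) •
    gaussSchwartz Real.pi Real.pi_pos
      (fun j => 2 * Real.pi * ((x j : ℂ) - Complex.I * (ω j : ℂ)))

theorem stftAtom_apply {d : ℕ} (x ω t : RSpace d) :
    stftAtom x ω t =
      conj (Complex.exp (2 * Real.pi * Complex.I * (inner ℝ ω t : ℝ)) * window (t - x)) := by
  have h2 : conj ((2 : ℂ) ^ ((d : ℂ) / 4)) = (2 : ℂ) ^ ((d : ℂ) / 4) := by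
    have : ((2 : ℝ) ^ ((d : ℝ) / 4) : ℝ) = (2 : ℂ) ^ ((d : ℂ) / 4) := by
      rw [Complex.ofReal_cpow (by norm_num)]
      push_cast
      rfl
    rw [← this, Complex.conj_ofReal]
  have hin : (inner ℝ ω t : ℝ) = ∑ j, ω j * t j := by
    simp [PiLp.inner_apply, mul_comm]
  have hin' : (inner ℝ t x : ℝ) = ∑ j, x j * t j := by
    simp [PiLp.inner_apply]
  rw [stftAtom, smul_apply, gaussSchwartz_apply, window, map_mul, map_mul, h2,
    ← Complex.exp_conj, ← Complex.exp_conj, smul_eq_mul, mul_left_comm, mul_assoc,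
    ← Complex.exp_add, ← Complex.exp_add, norm_sub_sq_real, hin, hin']
  congr 2
  simp only [map_mul, map_neg, Complex.conj_ofReal, Complex.conj_I, map_ofNat]
  have hs : ∑ j, 2 * (Real.pi : ℂ) * ((x j : ℂ) - Complex.I * (ω j : ℂ)) * (t j : ℂ)
      = 2 * Real.pi * ∑ j, (x j : ℂ) * (t j : ℂ)
        - 2 * Real.pi * Complex.I * ∑ j, (ω j : ℂ) * (t j : ℂ) := by
    rw [Finset.mul_sum, Finset.mul_sum, ← Finset.sum_sub_distrib]
    refine Finset.sum_congr rfl fun j _ => ?_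
    ring
  rw [hs]
  push_cast
  ring

/-- The short-time Fourier transform with Gaussian window,
`V f (x,ω) = ⟨f, M_ω T_x φ₀⟩`, with the duality bracket anti-linear in the second argument. -/
def stft {d : ℕ} (f : 𝓢'(RSpace d, ℂ)) (z : RSpace d × RSpace d) : ℂ :=
  f (stftAtom z.1 z.2)

/-- The modulation space `M^p(ℝ^d)`: tempered distributions with STFT in `L^p(ℝ^{2d})`. -/
def Modulation (d : ℕ) (p : ℝ≥0∞) : Submodule ℂ 𝓢'(RSpace d, ℂ) where
  carrier := {f | MemLp (stft f) p volume}
  add_mem' hf hg := MemLp.add hf hg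
  zero_mem' := MemLp.zero
  smul_mem' c _ hf := MemLp.const_smul hf c

/-- The norm of `M^p(ℝ^d)`. -/
def modNorm {d : ℕ} {p : ℝ≥0∞} (f : Modulation d p) : ℝ :=
  (eLpNorm (stft (f : 𝓢'(RSpace d, ℂ))) p volume).toReal

/-! ### Translations and convolution -/

/-- Translation `T_y f = f(· - y)` of a tempered distribution: `⟨T_y f, g⟩ = ⟨f, g(· + y)⟩`. -/
def translate {d : ℕ} (y : RSpace d) (f : 𝓢'(RSpace d, ℂ)) : 𝓢'(RSpace d, ℂ) :=
  PointwiseConvergenceCLM.precomp ℂ (SchwartzMap.compSubConstCLM ℂ (-y)) f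

theorem stft_translate {d : ℕ} (y : RSpace d) (f : 𝓢'(RSpace d, ℂ)) (z : RSpace d × RSpace d) :
    stft (translate y f) z =
      Complex.exp (-(2 * Real.pi * Complex.I * (inner ℝ z.2 y : ℝ))) * stft f (z.1 - y, z.2) := by
  have h : SchwartzMap.compSubConstCLM ℂ (-y) (stftAtom z.1 z.2) =
      Complex.exp (-(2 * Real.pi * Complex.I * (inner ℝ z.2 y : ℝ))) • stftAtom (z.1 - y) z.2 := by
    ext t
    rw [SchwartzMap.compSubConstCLM_apply, smul_apply, stftAtom_apply,
      stftAtom_apply, sub_neg_eq_add, inner_add_right]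
    have : t + y - z.1 = t - (z.1 - y) := by abel
    rw [this, smul_eq_mul, map_mul, map_mul, ← mul_assoc, ← Complex.exp_conj,
      ← Complex.exp_conj, ← Complex.exp_add]
    congr 2
    simp only [map_mul, Complex.conj_ofReal, Complex.conj_I, map_ofNat]
    push_cast
    ring
  change f (SchwartzMap.compSubConstCLM ℂ (-y) (stftAtom z.1 z.2)) = _
  rw [h, map_smul]
  rfl

theorem translate_mem {d : ℕ} {p : ℝ≥0∞} (y : RSpace d) {f : 𝓢'(RSpace d, ℂ)}
    (hf : f ∈ Modulation d p) : translate y f ∈ Modulation d p := by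
  have h1 : MemLp (fun z : RSpace d × RSpace d => stft f (z - (y, 0))) p volume :=
    MemLp.comp_measurePreserving (g := stft f) hf
      (measurePreserving_sub_right (volume.prod volume) (y, (0 : RSpace d)))
  have h2 : MemLp (fun z : RSpace d × RSpace d => stft f (z.1 - y, z.2)) p volume := by
    refine (memLp_congr_ae (Filter.Eventually.of_forall fun z => ?_)).1 h1
    obtain ⟨a, b⟩ := z
    simp
  have hcont : Continuous fun z : RSpace d × RSpace d =>
      Complex.exp (-(2 * Real.pi * Complex.I * (inner ℝ z.2 y : ℝ))) := by fun_prop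
  have h3 : MemLp (stft (translate y f)) p volume := by
    have heq : stft (translate y f) = fun z : RSpace d × RSpace d =>
        Complex.exp (-(2 * Real.pi * Complex.I * (inner ℝ z.2 y : ℝ)))
          * stft f (z.1 - y, z.2) := funext (stft_translate y f)
    rw [heq]
    refine h2.of_le (hcont.aestronglyMeasurable.mul h2.1)
      (Filter.Eventually.of_forall fun z => ?_)
    rw [norm_mul, Complex.norm_exp]
    simp
  exact h3

/-- Translation as a map of `M^p(ℝ^d)` into itself. -/
def modTranslate {d : ℕ} {p : ℝ≥0∞} (y : RSpace d) (f : Modulation d p) : Modulation d p :=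
  ⟨translate y f, translate_mem y f.2⟩

/-- The reflection `f(-·)` of a Schwartz function. -/
def reflect {d : ℕ} (f : 𝓢(RSpace d, ℂ)) : 𝓢(RSpace d, ℂ) :=
  SchwartzMap.compCLMOfContinuousLinearEquiv ℂ (ContinuousLinearEquiv.neg ℝ) f

/-- Convolution of a tempered distribution with a Schwartz function:
`⟨u * f, g⟩ = ⟨u, f(-·) * g⟩`. -/
def conv {d : ℕ} (u : 𝓢'(RSpace d, ℂ)) (f : 𝓢(RSpace d, ℂ)) : 𝓢'(RSpace d, ℂ) :=
  PointwiseConvergenceCLM.precomp ℂ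
    (SchwartzMap.convolution (ContinuousLinearMap.mul ℂ ℂ) (reflect f)) u

/-- `M_c(M^p)`: the tempered distributions `u` for which there is a bounded, translation-invariant
operator `A` on `M^p(ℝ^d)` with `A f = u * f` on Schwartz functions. -/
def convolutors (d : ℕ) (p : ℝ≥0∞) : Set 𝓢'(RSpace d, ℂ) :=
  {u | ∃ A : Modulation d p →ₗ[ℂ] Modulation d p,
    (∃ C : ℝ, ∀ f, modNorm (A f) ≤ C * modNorm f) ∧
    (∀ (y : RSpace d) (f : Modulation d p), A (modTranslate y f) = modTranslate y (A f)) ∧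
    ∀ f : 𝓢(RSpace d, ℂ),
      ∃ hf : SchwartzMap.toTemperedDistributionCLM (RSpace d) ℂ volume f ∈ Modulation d p,
        (A ⟨_, hf⟩ : 𝓢'(RSpace d, ℂ)) = conv u f}

/-! ### Sobolev–Fock spaces -/

/-- The weighted function `F(z) e^{-π|z|^2/2}`. -/
def weighted {d : ℕ} (F : CSpace d → ℂ) (z : CSpace d) : ℂ :=
  F z * Complex.exp (-(Real.pi * normSq z / 2 : ℝ))

/-- Entire functions `F` on `ℂ^d` with `F(z) e^{-π|z|^2/2}` in `L^p`. -/
def fockSubmodule (d : ℕ) (p : ℝ≥0∞) : Submodule ℂ (CSpace d → ℂ) where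
  carrier := {F | Differentiable ℂ F ∧ MemLp (weighted F) p volume}
  add_mem' := by
    rintro F G ⟨hF, hF'⟩ ⟨hG, hG'⟩
    refine ⟨hF.add hG, ?_⟩
    have : weighted (F + G) = weighted F + weighted G := by
      funext z
      simp [weighted, add_mul]
    rw [this]
    exact hF'.add hG'
  zero_mem' := by
    refine ⟨differentiable_const 0, ?_⟩
    have : weighted (0 : CSpace d → ℂ) = 0 := by
      funext z
      simp [weighted]
    rw [this]
    exact MemLp.zero
  smul_mem' := by
    rintro c F ⟨hF, hF'⟩
    refine ⟨hF.const_smul c, ?_⟩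
    have : weighted (c • F) = c • weighted F := by
      funext z
      simp [weighted, mul_assoc]
    rw [this]
    exact hF'.const_smul c

/-- The Sobolev–Fock space `F^p(ℂ^d)`. It is a type of its own, so that it carries only the norm
topology below, not the topology of pointwise convergence. -/
def FockSpace (d : ℕ) (p : ℝ≥0∞) : Type := fockSubmodule d p

namespace FockSpace

variable {d : ℕ} {p : ℝ≥0∞}

instance : AddCommGroup (FockSpace d p) := inferInstanceAs (AddCommGroup (fockSubmodule d p))

instance : Module ℂ (FockSpace d p) := inferInstanceAs (Module ℂ (fockSubmodule d p))

instance : CoeFun (FockSpace d p) (fun _ => CSpace d → ℂ) := ⟨fun F => F.1⟩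

/-- An element of `F^p(ℂ^d)` from a function and a proof of membership. -/
def mk (F : CSpace d → ℂ) (hF : F ∈ fockSubmodule d p) : FockSpace d p := ⟨F, hF⟩

/-- The linear map `F ↦ F e^{-π|·|^2/2}` from `F^p(ℂ^d)` to `L^p(ℂ^d)`. -/
def toLp : FockSpace d p →ₗ[ℂ] Lp ℂ p (volume : Measure (CSpace d)) where
  toFun F := MemLp.toLp (weighted F) F.2.2
  map_add' F G := by
    rw [← MemLp.toLp_add]
    congr 1
    funext z
    exact add_mul (F z) (G z) _
  map_smul' c F := by
    rw [RingHom.id_apply, ← MemLp.toLp_const_smul]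
    congr 1
    funext z
    exact mul_assoc c (F z) _

theorem toLp_injective : Function.Injective (toLp : FockSpace d p → _) := by
  intro F G h
  have h1 : weighted F =ᵐ[volume] weighted G := (MemLp.toLp_eq_toLp_iff F.2.2 G.2.2).1 h
  have hcont : ∀ H : FockSpace d p, Continuous (weighted H) := by
    intro H
    have hH : Continuous (H : CSpace d → ℂ) := H.2.1.continuous
    have hn : Continuous (normSq : CSpace d → ℝ) := by
      unfold normSq
      fun_prop
    unfold weighted
    fun_prop
  have h2 : weighted F = weighted G := Continuous.ae_eq_iff_eq volume (hcont F) (hcont G) |>.1 h1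
  apply Subtype.ext
  funext z
  exact mul_right_cancel₀ (Complex.exp_ne_zero _) (congrFun h2 z)

/-- The norm `‖F‖ = ‖F e^{-π|·|^2/2}‖_{L^p}`. -/
instance [Fact (1 ≤ p)] : NormedAddCommGroup (FockSpace d p) :=
  NormedAddCommGroup.induced (FockSpace d p) (Lp ℂ p (volume : Measure (CSpace d))) toLp
    toLp_injective

instance [Fact (1 ≤ p)] : NormedSpace ℂ (FockSpace d p) :=
  NormedSpace.induced ℂ (FockSpace d p) (Lp ℂ p (volume : Measure (CSpace d))) toLp

theorem norm_def [Fact (1 ≤ p)] (F : FockSpace d p) :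
    ‖F‖ = (eLpNorm (weighted F) p volume).toReal :=
  Lp.norm_toLp (weighted F) F.2.2

end FockSpace

/-- The real shift `β_y F(w) = e^{-π|y|^2/2} e^{π y·w} F(w - y)`, `y ∈ ℝ^d`, on functions. -/
def shiftFun {d : ℕ} (y : RSpace d) (F : CSpace d → ℂ) (w : CSpace d) : ℂ :=
  Complex.exp (-(Real.pi * ‖y‖ ^ 2 / 2 : ℝ)) * Complex.exp (Real.pi * cdot (toC y) w)
    * F (w - toC y)

theorem norm_weighted_shiftFun {d : ℕ} (y : RSpace d) (F : CSpace d → ℂ) (w : CSpace d) :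
    ‖weighted (shiftFun y F) w‖ = ‖weighted F (w - toC y)‖ := by
  have hy : ‖y‖ ^ 2 = ∑ j, (y j) ^ 2 := by
    rw [EuclideanSpace.norm_sq_eq]
    simp
  have hsq : normSq (w - toC y) = normSq w - 2 * ∑ j, y j * (w j).re + ‖y‖ ^ 2 := by
    rw [hy, normSq, normSq, Finset.mul_sum, ← Finset.sum_sub_distrib, ← Finset.sum_add_distrib]
    refine Finset.sum_congr rfl fun j _ => ?_
    simp only [Pi.sub_apply, toC, ← Complex.normSq_eq_norm_sq, Complex.normSq_apply,
      Complex.sub_re, Complex.sub_im, Complex.ofReal_re, Complex.ofReal_im]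
    ring
  have hre : (Real.pi * cdot (toC y) w : ℂ).re = Real.pi * ∑ j, y j * (w j).re := by
    rw [Complex.re_ofReal_mul, cdot, Complex.re_sum]
    simp [toC]
  simp only [weighted, shiftFun, norm_mul, Complex.norm_exp, hre, hsq]
  rw [Complex.neg_re, Complex.neg_re, Complex.neg_re, Complex.ofReal_re, Complex.ofReal_re,
    Complex.ofReal_re]
  rw [← Real.exp_add, mul_right_comm, ← Real.exp_add, mul_comm]
  congr 2
  ring

theorem shiftFun_mem {d : ℕ} {p : ℝ≥0∞} (y : RSpace d) {F : CSpace d → ℂ}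
    (hF : F ∈ fockSubmodule d p) : shiftFun y F ∈ fockSubmodule d p := by
  obtain ⟨hd, hm⟩ := hF
  have hdiff : Differentiable ℂ (shiftFun y F) := by
    have h1 : Differentiable ℂ fun w : CSpace d => F (w - toC y) :=
      hd.comp (differentiable_id.sub_const _)
    have h2 : Differentiable ℂ fun w : CSpace d => cdot (toC y) w := by
      unfold cdot
      fun_prop
    unfold shiftFun
    fun_prop
  refine ⟨hdiff, ?_⟩
  have h1 : MemLp (fun w : CSpace d => weighted F (w - toC y)) p volume :=
    MemLp.comp_measurePreserving hm (measurePreserving_sub_right volume _)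
  have hn : Continuous (normSq : CSpace d → ℝ) := by
    unfold normSq
    fun_prop
  have hcont : Continuous (weighted (shiftFun y F)) := by
    have := hdiff.continuous
    unfold weighted
    fun_prop
  exact h1.of_le hcont.aestronglyMeasurable
    (Filter.Eventually.of_forall fun w => (norm_weighted_shiftFun y F w).le)

/-- The shift `β_y` on `F^p(ℂ^d)`. -/
def fockShift {d : ℕ} {p : ℝ≥0∞} (y : RSpace d) (F : FockSpace d p) : FockSpace d p :=
  FockSpace.mk (shiftFun y F) (shiftFun_mem y F.2)

/-- A bounded operator on `F^p(ℂ^d)` is translation invariant if it commutes with every `β_y`,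
`y ∈ ℝ^d`. -/
def TranslationInvariant {d : ℕ} {p : ℝ≥0∞} [Fact (1 ≤ p)]
    (S : FockSpace d p →L[ℂ] FockSpace d p) : Prop :=
  ∀ (y : RSpace d) (F : FockSpace d p), S (fockShift y F) = fockShift y (S F)

/-! ### The integral operators -/

/-- `φ(z) = ∫ u(y) e^{-π|y|^2/2 - π y·z} dy`, that is, `u` applied to the Schwartz function
`y ↦ e^{-π|y|^2/2 - π y·z}`. -/
def symbol {d : ℕ} (u : 𝓢'(RSpace d, ℂ)) (z : CSpace d) : ℂ :=
  u (gaussSchwartz (Real.pi / 2) Real.pi_div_two_pos (fun j => -Real.pi * z j))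

/-- The integrand `F(w) e^{π w̄·z} φ(w̄ - z) e^{-π|w|^2}`. -/
def fockIntegrand {d : ℕ} (φ F : CSpace d → ℂ) (z w : CSpace d) : ℂ :=
  F w * Complex.exp (Real.pi * cdot (star w) z) * φ (star w - z)
    * Complex.exp (-(Real.pi * normSq w : ℝ))

/-- `S F(z) = ∫ F(w) e^{π w̄·z} φ(w̄ - z) e^{-π|w|^2} dw`. -/
def fockIntegral {d : ℕ} (φ F : CSpace d → ℂ) (z : CSpace d) : ℂ :=
  ∫ w, fockIntegrand φ F z w

/-- The bounded operator `S` on `F^p(ℂ^d)` extends the integral operator with symbol `φ`, which is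
defined on `F^1(ℂ^d)`: each `F` in `F^1` lies in `F^p`, and `S F` is given by the integral. -/
def Extends {d : ℕ} {p : ℝ≥0∞} [Fact (1 ≤ p)]
    (S : FockSpace d p →L[ℂ] FockSpace d p) (φ : CSpace d → ℂ) : Prop :=
  ∀ F ∈ fockSubmodule d 1, ∃ hF : F ∈ fockSubmodule d p,
    ∀ z, S (FockSpace.mk F hF) z = fockIntegral φ F z

end SobolevFock

end

open MeasureTheory SchwartzMap
open scoped ENNReal ComplexConjugate

noncomputable section

namespace SobolevFock

variable {d : ℕ}

open Filter Topology

/-! ### Algebra of the bilinear product and the Euclidean length -/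

/-! The theorem is a transport of structure by the Bargmann transform $Bf(z)=\langle
f,\mathrm{atom}_z\rangle$, where $\mathrm{atom}_z(t)=2^{d/4}e^{-\pi z\cdot z/2+2\pi z\cdot
t-\pi|t|^2}$. Up to a unimodular factor, $V_{\varphi_0}f(x,\omega)$ is the weighted value of $Bf$ at
$x-i\omega$ (`stft_eq`), so $B$ maps $M^p$ isometrically into $\mathcal F^p$. It carries $T_y$ to
$\beta_y$ (`bargmann_translate`), and it has the right inverse `invBargmann` because of the
reproducing formula (`bargmann_invBargmann`). Translation-invariant operators on the two sides
therefore correspond by conjugation.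

Everything is then read off on the kernels $K_a(w)=e^{\pi a\cdot w}=B(\mathrm{atom}_a)(w)$.
Convolving two atoms gives $B(u*\mathrm{atom}_a)(z)=K_a(z)\phi_u(a-z)$ (`bargmann_conv_atom`), so
the operator on $\mathcal F^p$ coming from $u$ satisfies $SK_a(z)=K_a(z)\phi_u(a-z)$. Every
$F\in\mathcal F^1$ is the Bochner integral in $\mathcal F^p$ of $F(w)e^{-\pi|w|^2}K_{\bar w}$
(`FockSpace.integral_smul_kernel`); applying $F\mapsto SF(z)$ under the integral sign yields the
formula for $S_uF(z)$ and its absolute convergence. Uniqueness is the density of $\mathcal F^1$ in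
$\mathcal F^p$ for $p<\infty$ (`dense_fockSubmodule_one`), obtained from the dilations $F(rz)$,
$r<1$.

For the converse put $\Phi=SK_0$. Since $\beta_yK_0$ is a multiple of $K_y$, invariance gives
$SK_a(z)=K_a(z)\Phi(z-a)$ for real $a$. Both sides are entire in $a$, because $a\mapsto K_a$ is
holomorphic into $\mathcal F^p$, so the identity holds for complex $a$. Taking $a=-z=-v/2$ yields
$|\Phi(v)|\le Ce^{\frac{\pi}{4}(|v|^2+\mathrm{Re}\,v\cdot v)}$. This is exactly the bound that
places $2^{d/4}e^{-\pi z\cdot z/2}\Phi(\sqrt2z)$ in $\mathcal F^\infty$; its inverse Bargmann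
transform, rescaled by $\sqrt2$, is a distribution $u$ with $\phi_u(z)=\Phi(-z)$.

It remains to see that $B^{-1}SB$ is convolution with $u$ on all Schwartz functions, not only on
atoms. A Schwartz function is a superposition of atoms with density in $\mathcal F^1$
(`synthesis_bargmann`), and $u$ may be taken inside the convolution integral
(`ConvolvesByIntegral`). Thus $\langle u*f,g\rangle$ expands over pairs of atoms in the same way as
$\langle B^{-1}SBf,g\rangle$. -/

theorem cdot_comm (z w : CSpace d) : cdot z w = cdot w z := by
  simp [cdot, mul_comm]

theorem cdot_add (z w v : CSpace d) : cdot z (w + v) = cdot z w + cdot z v := by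
  simp [cdot, mul_add, Finset.sum_add_distrib]

theorem cdot_sub (z w v : CSpace d) : cdot z (w - v) = cdot z w - cdot z v := by
  simp [cdot, mul_sub, Finset.sum_sub_distrib]

theorem cdot_neg (z w : CSpace d) : cdot z (-w) = -cdot z w := by
  simp [cdot]

theorem cdot_smul (c : ℂ) (z w : CSpace d) : cdot z (c • w) = c * cdot z w := by
  simp only [cdot, Finset.mul_sum, Pi.smul_apply, smul_eq_mul]
  exact Finset.sum_congr rfl fun j _ => by ring

theorem add_cdot (z w v : CSpace d) : cdot (z + w) v = cdot z v + cdot w v := by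
  rw [cdot_comm, cdot_add, cdot_comm v, cdot_comm v]

theorem sub_cdot (z w v : CSpace d) : cdot (z - w) v = cdot z v - cdot w v := by
  rw [cdot_comm, cdot_sub, cdot_comm v, cdot_comm v]

theorem neg_cdot (z w : CSpace d) : cdot (-z) w = -cdot z w := by
  rw [cdot_comm, cdot_neg, cdot_comm w]

theorem smul_cdot (c : ℂ) (z w : CSpace d) : cdot (c • z) w = c * cdot z w := by
  rw [cdot_comm, cdot_smul, cdot_comm w]

@[simp] theorem cdot_zero (z : CSpace d) : cdot z 0 = 0 := by simp [cdot]

@[simp] theorem zero_cdot (z : CSpace d) : cdot 0 z = 0 := by simp [cdot]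

@[fun_prop]
theorem continuous_cdot {X : Type*} [TopologicalSpace X] {f g : X → CSpace d}
    (hf : Continuous f) (hg : Continuous g) : Continuous fun x => cdot (f x) (g x) := by
  unfold cdot
  fun_prop

@[fun_prop]
theorem differentiable_cdot {E : Type*} [NormedAddCommGroup E] [NormedSpace ℂ E]
    {f g : E → CSpace d} (hf : Differentiable ℂ f) (hg : Differentiable ℂ g) :
    Differentiable ℂ fun x => cdot (f x) (g x) := by
  unfold cdot
  fun_prop

@[fun_prop]
theorem continuous_normSq {X : Type*} [TopologicalSpace X] {f : X → CSpace d}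
    (hf : Continuous f) : Continuous fun x => normSq (f x) := by
  unfold normSq
  fun_prop

theorem normSq_nonneg (z : CSpace d) : 0 ≤ normSq z := by
  unfold normSq
  positivity

@[simp] theorem normSq_zero : normSq (0 : CSpace d) = 0 := by simp [normSq]

@[simp] theorem normSq_star (z : CSpace d) : normSq (star z) = normSq z := by
  simp [normSq]

@[simp] theorem normSq_neg (z : CSpace d) : normSq (-z) = normSq z := by
  simp [normSq]

theorem normSq_smul (c : ℂ) (z : CSpace d) : normSq (c • z) = ‖c‖ ^ 2 * normSq z := by
  simp [normSq, Finset.mul_sum, mul_pow]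

theorem normSq_sub (z w : CSpace d) :
    normSq (z - w) = normSq z - 2 * (cdot (star z) w).re + normSq w := by
  simp only [normSq, cdot, Complex.re_sum, Finset.mul_sum, ← Finset.sum_sub_distrib,
    ← Finset.sum_add_distrib]
  refine Finset.sum_congr rfl fun j _ => ?_
  simp only [Pi.sub_apply, ← Complex.normSq_eq_norm_sq, Complex.normSq_apply, Complex.sub_re,
    Complex.sub_im, Pi.star_apply, RCLike.star_def, Complex.mul_re, Complex.conj_re,
    Complex.conj_im]
  ring

theorem normSq_add (z w : CSpace d) :
    normSq (z + w) = normSq z + 2 * (cdot (star z) w).re + normSq w := by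
  have := normSq_sub z (-w)
  rw [sub_neg_eq_add, normSq_neg, cdot_neg, Complex.neg_re] at this
  rw [this]
  ring

theorem re_cdot_star (z w : CSpace d) : (cdot (star z) w).re = (cdot z (star w)).re := by
  simp [cdot, Complex.re_sum]

theorem normSq_sub_star (z w : CSpace d) :
    normSq (z - star w) = normSq z - 2 * (cdot w z).re + normSq w := by
  rw [normSq_sub, re_cdot_star, star_star, cdot_comm, normSq_star]

theorem norm_sq_le_normSq (z : CSpace d) : ‖z‖ ^ 2 ≤ normSq z := by
  have h : ‖z‖ ≤ Real.sqrt (normSq z) := by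
    refine (pi_norm_le_iff_of_nonneg (Real.sqrt_nonneg _)).2 fun j => ?_
    refine Real.le_sqrt_of_sq_le ?_
    exact Finset.single_le_sum (f := fun j => ‖z j‖ ^ 2) (fun i _ => by positivity)
      (Finset.mem_univ j)
  calc ‖z‖ ^ 2 ≤ Real.sqrt (normSq z) ^ 2 := by gcongr
    _ = normSq z := Real.sq_sqrt (normSq_nonneg z)

theorem norm_cdot_le (z w : CSpace d) : ‖cdot z w‖ ≤ (∑ j, ‖z j‖) * ‖w‖ := by
  refine (norm_sum_le _ _).trans ?_
  rw [Finset.sum_mul]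
  gcongr with j
  rw [norm_mul]
  gcongr
  exact norm_le_pi_norm w j

/-- Complex conjugation preserves Lebesgue measure on `ℂ^d`. -/
theorem measurePreserving_star :
    MeasurePreserving (star : CSpace d → CSpace d) volume volume :=
  volume_preserving_pi fun _ => Complex.conjLIE.measurePreserving

/-- Multiplication by a unimodular number preserves Lebesgue measure on `ℂ^d`. -/
theorem measurePreserving_circle_smul (a : Circle) :
    MeasurePreserving (fun z : CSpace d => (a : ℂ) • z) volume volume :=
  volume_preserving_pi fun _ => (rotation a).measurePreserving

/-! ### Gaussian integrals on `ℂ^d` -/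

theorem exp_neg_mul_normSq (c : ℝ) (w : CSpace d) :
    Real.exp (-c * normSq w) = ∏ j, Real.exp (-c * ‖w j‖ ^ 2) := by
  rw [← Real.exp_sum, normSq, Finset.mul_sum]

theorem integrable_gauss {c : ℝ} (hc : 0 < c) :
    Integrable fun w : CSpace d => Real.exp (-c * normSq w) := by
  simp_rw [exp_neg_mul_normSq]
  refine Integrable.fintype_prod (μ := fun _ : Fin d => (volume : Measure ℂ))
    (f := fun _ : Fin d => fun z : ℂ => Real.exp (-c * ‖z‖ ^ 2)) fun _ => ?_
  have h := (GaussianFourier.integrable_cexp_neg_mul_sq_norm_add (V := ℂ) (b := (c : ℂ))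
    (by simpa using hc) 0 0).norm
  refine h.congr (Filter.Eventually.of_forall fun z => ?_)
  simp only [Complex.norm_exp]
  congr 1
  rw [zero_mul, add_zero, ← Complex.ofReal_neg, ← Complex.ofReal_pow, ← Complex.ofReal_mul,
    Complex.ofReal_re]

theorem integral_gauss_pi : ∫ w : CSpace d, Real.exp (-Real.pi * normSq w) = 1 := by
  simp_rw [exp_neg_mul_normSq]
  refine (integral_fintype_prod_volume_eq_prod
    (fun _ : Fin d => fun z : ℂ => Real.exp (-Real.pi * ‖z‖ ^ 2))).trans ?_
  refine Finset.prod_eq_one fun _ _ => ?_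
  rw [GaussianFourier.integral_rexp_neg_mul_sq_norm Real.pi_pos, div_self Real.pi_ne_zero,
    Real.one_rpow]

/-- A continuous integrable and bounded function lies in every `L^p`, `1 ≤ p`. -/
theorem memLp_of_memLp_one_of_bounded {α E : Type*} [MeasurableSpace α] {μ : Measure α}
    [NormedAddCommGroup E] {f : α → E} (h1 : MemLp f 1 μ) {M : ℝ} (hM : ∀ x, ‖f x‖ ≤ M)
    {p : ℝ≥0∞} (hp : 1 ≤ p) : MemLp f p μ := by
  rcases eq_or_ne p ∞ with rfl | hp'
  · exact memLp_top_of_bound h1.1 M (Filter.Eventually.of_forall hM)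
  have hp0 : p ≠ 0 := (zero_lt_one.trans_le hp).ne'
  have hpr : 1 ≤ p.toReal := by
    simpa using (ENNReal.toReal_le_toReal ENNReal.one_ne_top hp').2 hp
  rw [← integrable_norm_rpow_iff h1.1 hp0 hp']
  refine Integrable.mono' ((memLp_one_iff_integrable.1 h1).norm.const_mul (M ^ (p.toReal - 1)))
    (h1.1.norm.aemeasurable.pow_const _).aestronglyMeasurable
    (Filter.Eventually.of_forall fun x => ?_)
  have hx := norm_nonneg (f x)
  rw [Real.norm_of_nonneg (by positivity)]
  calc ‖f x‖ ^ p.toReal = ‖f x‖ ^ (p.toReal - 1 + 1) := by ring_nf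
    _ = ‖f x‖ ^ (p.toReal - 1) * ‖f x‖ := by
      rw [Real.rpow_add_of_nonneg hx (by linarith) zero_le_one, Real.rpow_one]
    _ ≤ M ^ (p.toReal - 1) * ‖f x‖ := by
      gcongr
      exact hM x

theorem memLp_gauss {c : ℝ} (hc : 0 < c) {p : ℝ≥0∞} (hp : 1 ≤ p) :
    MemLp (fun w : CSpace d => Real.exp (-c * normSq w)) p volume := by
  refine memLp_of_memLp_one_of_bounded (memLp_one_iff_integrable.2 (integrable_gauss hc))
    (M := 1) (fun w => ?_) hp
  rw [Real.norm_of_nonneg (Real.exp_nonneg _)]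
  exact Real.exp_le_one_iff.2 (by nlinarith [normSq_nonneg w])

/-- `(1+‖w‖)^m e^{B‖w‖ - c|w|^2}` is dominated by a Gaussian. -/
theorem exists_gauss_dominated {c : ℝ} (hc : 0 < c) (B : ℝ) (m : ℕ) : ∃ C : ℝ, 0 ≤ C ∧
    ∀ w : CSpace d, (1 + ‖w‖) ^ m * Real.exp (B * ‖w‖ - c * normSq w)
      ≤ C * Real.exp (-(c / 2) * normSq w) := by
  obtain ⟨C, hC, h⟩ := exists_gauss_bound (c / 2) B (by positivity) m
  refine ⟨C, hC, fun w => ?_⟩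
  -- Half of the Gaussian is spent on the polynomial and on $e^{B\|w\|}$, using that the sup norm
  -- satisfies $\|w\|^2\le|w|^2$; the other half survives.
  have h1 : Real.exp (B * ‖w‖ - c * normSq w)
      ≤ Real.exp (-(c / 2) * ‖w‖ ^ 2 + B * ‖w‖) * Real.exp (-(c / 2) * normSq w) := by
    rw [← Real.exp_add]
    refine Real.exp_le_exp.2 ?_
    nlinarith [norm_sq_le_normSq w]
  calc (1 + ‖w‖) ^ m * Real.exp (B * ‖w‖ - c * normSq w)
      ≤ (1 + ‖w‖) ^ m * (Real.exp (-(c / 2) * ‖w‖ ^ 2 + B * ‖w‖)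
        * Real.exp (-(c / 2) * normSq w)) := by gcongr
    _ ≤ C * Real.exp (-(c / 2) * normSq w) := by
      rw [← mul_assoc]
      gcongr
      exact h _ (norm_nonneg w)

/-! ### Weighted functions -/

theorem norm_weighted (F : CSpace d → ℂ) (z : CSpace d) :
    ‖weighted F z‖ = ‖F z‖ * Real.exp (-(Real.pi / 2) * normSq z) := by
  rw [weighted, norm_mul, Complex.norm_exp, Complex.neg_re, Complex.ofReal_re]
  congr 2
  ring

theorem continuous_weighted {F : CSpace d → ℂ} (hF : Continuous F) : Continuous (weighted F) := by
  unfold weighted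
  fun_prop

theorem weighted_sub (F G : CSpace d → ℂ) (z : CSpace d) :
    weighted (F - G) z = weighted F z - weighted G z := by
  simp [weighted, sub_mul]

theorem norm_le_of_weighted_le {F : CSpace d → ℂ} {z : CSpace d} {M : ℝ}
    (h : ‖weighted F z‖ ≤ M) : ‖F z‖ ≤ M * Real.exp (Real.pi / 2 * normSq z) := by
  rw [norm_weighted] at h
  calc ‖F z‖ = ‖F z‖ * Real.exp (-(Real.pi / 2) * normSq z) * Real.exp (Real.pi / 2 * normSq z) := by
        rw [mul_assoc, ← Real.exp_add]; simp
    _ ≤ _ := by gcongr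

/-! ### The reproducing formula -/

/-- The Gaussian weight `e^{-π|w|^2}`. -/
def gaussWeight (w : CSpace d) : ℂ := Complex.exp (-(Real.pi * normSq w : ℝ))

theorem norm_gaussWeight (w : CSpace d) :
    ‖gaussWeight w‖ = Real.exp (-Real.pi * normSq w) := by
  rw [gaussWeight, Complex.norm_exp, Complex.neg_re, Complex.ofReal_re, neg_mul]

@[fun_prop]
theorem continuous_gaussWeight : Continuous (gaussWeight : CSpace d → ℂ) := by
  unfold gaussWeight
  fun_prop

@[simp] theorem gaussWeight_star (w : CSpace d) : gaussWeight (star w) = gaussWeight w := by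
  simp [gaussWeight]

theorem integral_gaussWeight : ∫ w : CSpace d, gaussWeight w = 1 := by
  have h : ∀ w : CSpace d, gaussWeight w = ((Real.exp (-Real.pi * normSq w) : ℝ) : ℂ) := by
    intro w
    rw [gaussWeight, Complex.ofReal_exp, neg_mul, Complex.ofReal_neg]
  simp_rw [h]
  rw [integral_complex_ofReal, integral_gauss_pi, Complex.ofReal_one]

theorem circleAverage_smul_eq {F : CSpace d → ℂ} (hF : Differentiable ℂ F) (w : CSpace d) :
    ∫ θ in (0 : ℝ)..2 * Real.pi, F (circleMap 0 1 θ • w) = 2 * Real.pi * F 0 := by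
  have hd : Differentiable ℂ fun s : ℂ => F (s • w) :=
    hF.comp (differentiable_id.smul_const w)
  have h := circleAverage_of_differentiable_on_off_countable (c := 0) (R := 1)
    Set.countable_empty hd.continuous.continuousOn fun z _ => hd z
  rw [Real.circleAverage_def, zero_smul] at h
  rw [← h, Complex.real_smul]
  push_cast
  field_simp

/-- The mean value property of entire functions with respect to the Gaussian measure. -/
theorem integral_mul_gaussWeight {F : CSpace d → ℂ} (hF : Differentiable ℂ F)
    (hi : Integrable fun w => F w * gaussWeight w) :
    ∫ w, F w * gaussWeight w = F 0 := by
  -- The rotation $w\mapsto e^{i\theta}w$ preserves both the Gaussian and Lebesgue measure, so the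
  -- integral equals its average over $\theta$. Fubini then reduces it to the one-variable mean
  -- value property on the complex line through $w$.
  have hg : ∀ (θ : ℝ) (w : CSpace d), gaussWeight (circleMap 0 1 θ • w) = gaussWeight w := by
    intro θ w
    rw [gaussWeight, gaussWeight, normSq_smul]
    simp
  have hcircle : ∀ θ : ℝ, circleMap 0 1 θ = (Circle.exp θ : ℂ) := by
    intro θ
    simp [circleMap]
  have hmp : ∀ θ : ℝ, MeasurePreserving (fun w : CSpace d => circleMap 0 1 θ • w) volume volume := by
    intro θ
    rw [hcircle]
    exact measurePreserving_circle_smul _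
  have hemb : ∀ θ : ℝ, MeasurableEmbedding (fun w : CSpace d => circleMap 0 1 θ • w) := fun θ =>
    (Homeomorph.smulOfNeZero (circleMap 0 1 θ) (by simp [hcircle])).measurableEmbedding
  have hc : Continuous fun q : ℝ × CSpace d => F (circleMap 0 1 q.1 • q.2) * gaussWeight q.2 := by
    have := hF.continuous
    fun_prop
  have hrot : ∀ θ : ℝ, (fun w => F (circleMap 0 1 θ • w) * gaussWeight w) =
      (fun w => F w * gaussWeight w) ∘ fun w => circleMap 0 1 θ • w := by
    intro θ
    funext w
    simp [hg]
  have hprod : Integrable (fun q : ℝ × CSpace d => F (circleMap 0 1 q.1 • q.2) * gaussWeight q.2)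
      ((volume.restrict (Set.Ioc 0 (2 * Real.pi))).prod volume) := by
    rw [integrable_prod_iff hc.aestronglyMeasurable]
    refine ⟨Filter.Eventually.of_forall fun θ => ?_, ?_⟩
    · change Integrable (fun w => F (circleMap 0 1 θ • w) * gaussWeight w) volume
      rw [hrot]
      exact (hmp θ).integrable_comp_of_integrable hi
    · have : (fun θ : ℝ => ∫ w, ‖F (circleMap 0 1 θ • w) * gaussWeight w‖) =
          fun _ => ∫ w, ‖F w * gaussWeight w‖ := by
        funext θ
        have := (hmp θ).integral_comp (hemb θ) fun w => ‖F w * gaussWeight w‖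
        simpa only [hg] using this
      simp only [this]
      exact integrable_const _
  have h1 := integral_integral_swap (f := fun (θ : ℝ) (w : CSpace d) =>
    F (circleMap 0 1 θ • w) * gaussWeight w) hprod
  have h2 : ∀ θ : ℝ, ∫ w, F (circleMap 0 1 θ • w) * gaussWeight w = ∫ w, F w * gaussWeight w := by
    intro θ
    have := (hmp θ).integral_comp (hemb θ) fun w => F w * gaussWeight w
    simpa only [hg] using this
  have h3 : ∀ w : CSpace d, ∫ θ in Set.Ioc 0 (2 * Real.pi),
      F (circleMap 0 1 θ • w) * gaussWeight w = 2 * Real.pi * F 0 * gaussWeight w := by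
    intro w
    rw [integral_mul_const, ← intervalIntegral.integral_of_le Real.two_pi_pos.le,
      circleAverage_smul_eq hF]
  simp only [h2, h3] at h1
  rw [integral_const_mul, integral_gaussWeight, setIntegral_const, Complex.real_smul] at h1
  have hpi : (2 * Real.pi : ℂ) ≠ 0 := by
    simp [Real.pi_ne_zero]
  refine mul_left_cancel₀ hpi ?_
  rw [mul_one] at h1
  rw [← h1]
  congr 1
  simp [Real.pi_pos.le]

/-- The reproducing kernel `w ↦ e^{π a·w}`. -/
def kernel (a w : CSpace d) : ℂ := Complex.exp (Real.pi * cdot a w)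

theorem kernel_comm (a w : CSpace d) : kernel a w = kernel w a := by
  rw [kernel, kernel, cdot_comm]

@[fun_prop]
theorem continuous_kernel {X : Type*} [TopologicalSpace X] {f g : X → CSpace d}
    (hf : Continuous f) (hg : Continuous g) : Continuous fun x => kernel (f x) (g x) := by
  unfold kernel
  fun_prop

@[fun_prop]
theorem differentiable_kernel {E : Type*} [NormedAddCommGroup E] [NormedSpace ℂ E]
    {f g : E → CSpace d} (hf : Differentiable ℂ f) (hg : Differentiable ℂ g) :
    Differentiable ℂ fun x => kernel (f x) (g x) := by
  unfold kernel
  fun_prop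

theorem norm_kernel (a w : CSpace d) :
    ‖kernel a w‖ = Real.exp (Real.pi * (cdot a w).re) := by
  rw [kernel, Complex.norm_exp, Complex.re_ofReal_mul]

/-- Completing the square: the weighted kernel is a Gaussian centred at $\bar a$, of height
$e^{\pi|a|^2/2}$. Membership of $K_a$ in every $\mathcal F^p$ and the growth of its norm both
follow. -/
theorem norm_weighted_kernel (a w : CSpace d) :
    ‖weighted (kernel a) w‖ =
      Real.exp (Real.pi / 2 * normSq a) * Real.exp (-(Real.pi / 2) * normSq (w - star a)) := by
  rw [norm_weighted, norm_kernel, ← Real.exp_add, ← Real.exp_add, normSq_sub_star]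
  congr 1
  ring

/-- The size of the integrand of the reproducing formula. -/
theorem norm_reproducing_integrand (F : CSpace d → ℂ) (z w : CSpace d) :
    ‖F w * kernel (star w) z * gaussWeight w‖ = Real.exp (Real.pi / 2 * normSq z) *
      (‖weighted F w‖ * Real.exp (-(Real.pi / 2) * normSq (w - z))) := by
  rw [norm_mul, norm_mul, norm_weighted, norm_gaussWeight, norm_kernel, normSq_sub, mul_assoc,
    mul_assoc, mul_left_comm (Real.exp (Real.pi / 2 * normSq z)),
    ← Real.exp_add,
    ← Real.exp_add, ← Real.exp_add]
  congr 2
  ring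

theorem memLp_gauss_sub {c : ℝ} (hc : 0 < c) (z : CSpace d) {p : ℝ≥0∞} (hp : 1 ≤ p) :
    MemLp (fun w : CSpace d => Real.exp (-c * normSq (w - z))) p volume :=
  (memLp_gauss hc hp).comp_measurePreserving (measurePreserving_sub_right volume z)

/-- Hölder's inequality: in absolute value the integrand is the weighted $F\in L^p$ times a Gaussian
centred at $z$, which lies in the dual exponent. -/
theorem integrable_reproducing {p : ℝ≥0∞} (hp : 1 ≤ p) {F : CSpace d → ℂ} (hF : Continuous F)
    (hm : MemLp (weighted F) p volume) (z : CSpace d) :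
    Integrable fun w => F w * kernel (star w) z * gaussWeight w := by
  have := ENNReal.HolderConjugate.conjExponent hp
  have h := (hm.norm.integrable_mul (q := p.conjExponent)
    (memLp_gauss_sub Real.pi_div_two_pos z
      (ENNReal.HolderConjugate.one_le _ p))).const_mul (Real.exp (Real.pi / 2 * normSq z))
  refine h.mono' (Continuous.aestronglyMeasurable (by fun_prop))
    (Filter.Eventually.of_forall fun w => ?_)
  rw [norm_reproducing_integrand]
  rfl

/-- The reproducing formula `F(z) = ∫ F(w) e^{π w̄·z} e^{-π|w|^2} dw`. -/
theorem reproducing {F : CSpace d → ℂ} (hF : Differentiable ℂ F) {z : CSpace d}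
    (hi : Integrable fun w => F w * kernel (star w) z * gaussWeight w) :
    ∫ w, F w * kernel (star w) z * gaussWeight w = F z := by
  -- Recentring at $z$ moves the formula to the mean value property at $0$ of $w\mapsto
  -- F(w+z)e^{-\pi\bar z\cdot w}$, whose value at $0$ is $F(z)$.
  have hH : Differentiable ℂ fun w : CSpace d => F (w + z) * kernel (-star z) w := by
    have : Differentiable ℂ fun w : CSpace d => F (w + z) := hF.comp (differentiable_id.add_const z)
    fun_prop
  have hs : ∀ w : CSpace d, F w * kernel (star w) z * gaussWeight w =
      F (w - z + z) * kernel (-star z) (w - z) * gaussWeight (w - z) := by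
    intro w
    have h1 : ((normSq (w - z) : ℝ) : ℂ) =
        normSq w - (cdot (star w) z + cdot (star z) w) + cdot (star z) z := by
      have hn : ((normSq z : ℝ) : ℂ) = cdot (star z) z := by
        simp [normSq, cdot, ← Complex.conj_mul']
      have hr : (2 * (cdot (star w) z).re : ℂ) = cdot (star w) z + cdot (star z) w := by
        have : cdot (star z) w = conj (cdot (star w) z) := by
          simp [cdot, mul_comm]
        rw [this, Complex.add_conj]
        push_cast
        ring
      rw [normSq_sub, Complex.ofReal_add, hn, Complex.ofReal_sub, Complex.ofReal_mul,
        Complex.ofReal_ofNat, hr]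
    rw [sub_add_cancel, kernel, kernel, gaussWeight, gaussWeight, mul_assoc, mul_assoc,
      ← Complex.exp_add, ← Complex.exp_add, Complex.ofReal_mul, Complex.ofReal_mul, h1,
      neg_cdot, cdot_sub]
    congr 2
    ring
  have hi' : Integrable fun w => F (w + z) * kernel (-star z) w * gaussWeight w := by
    rw [funext hs] at hi
    have := hi.comp_add_right z
    simpa only [add_sub_cancel_right] using this
  have h := integral_mul_gaussWeight hH hi'
  rw [zero_add, kernel, cdot_zero, mul_zero, Complex.exp_zero, mul_one] at h
  rw [← h, funext hs]
  exact integral_sub_right_eq_self (fun w => F (w + z) * kernel (-star z) w * gaussWeight w) z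

/-- Hölder's inequality for integrals of norms. -/
theorem integral_norm_mul_norm_le {α E G : Type*} [MeasurableSpace α] {μ : Measure α}
    [NormedAddCommGroup E] [NormedAddCommGroup G] {p q : ℝ≥0∞} [ENNReal.HolderConjugate p q]
    {f : α → E} {g : α → G} (hf : MemLp f p μ) (hg : MemLp g q μ) :
    ∫ w, ‖f w‖ * ‖g w‖ ∂μ ≤ (eLpNorm f p μ).toReal * (eLpNorm g q μ).toReal := by
  have h1 : MemLp (fun w => ‖f w‖ * ‖g w‖) 1 μ :=
    memLp_one_iff_integrable.2 (hf.norm.integrable_mul hg.norm)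
  have h2 := eLpNorm_le_eLpNorm_mul_eLpNorm'_of_norm (p := p) (q := q) (r := 1) hf.norm.1 hg.norm.1
    (fun a b => a * b) 1 (Filter.Eventually.of_forall fun w => by simp)
  rw [eLpNorm_norm, eLpNorm_norm] at h2
  have h3 := ENNReal.toReal_mono
    (ENNReal.mul_ne_top (ENNReal.mul_ne_top (by simp) hf.2.ne) hg.2.ne) h2
  rw [ENNReal.toReal_mul, ENNReal.toReal_mul, toReal_eLpNorm h1.1] at h3
  simp only [ENNReal.coe_one, ENNReal.toReal_one, one_mul] at h3
  refine le_trans (le_of_eq ?_) h3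
  rw [lpNorm_one_eq_integral_norm h1.1]
  refine integral_congr_ae (Filter.Eventually.of_forall fun w => ?_)
  simp only [norm_mul, norm_norm]

/-- Point evaluations are bounded on the Fock spaces. -/
theorem exists_norm_weighted_le (d : ℕ) {p : ℝ≥0∞} (hp : 1 ≤ p) : ∃ C : ℝ, 0 ≤ C ∧
    ∀ F ∈ fockSubmodule d p, ∀ z, ‖weighted F z‖ ≤ C * (eLpNorm (weighted F) p volume).toReal := by
  have := ENNReal.HolderConjugate.conjExponent hp
  have hq : 1 ≤ p.conjExponent := ENNReal.HolderConjugate.one_le _ p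
  set g : CSpace d → ℝ := fun w => Real.exp (-(Real.pi / 2) * normSq w)
  -- The constant is the norm of the Gaussian in the dual exponent; it does not depend on $z$
  -- because Lebesgue measure is translation invariant.
  refine ⟨(eLpNorm g p.conjExponent volume).toReal, ENNReal.toReal_nonneg, fun F hF z => ?_⟩
  have hi := integrable_reproducing hp hF.1.continuous hF.2 z
  have hgz : MemLp (fun w => g (w - z)) p.conjExponent volume :=
    memLp_gauss_sub Real.pi_div_two_pos z hq
  have hgn : eLpNorm (fun w => g (w - z)) p.conjExponent volume = eLpNorm g p.conjExponent volume :=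
    eLpNorm_comp_measurePreserving (memLp_gauss Real.pi_div_two_pos hq).1
      (measurePreserving_sub_right volume z)
  have hhol : ∫ w, ‖weighted F w‖ * g (w - z) ≤
      (eLpNorm (weighted F) p volume).toReal * (eLpNorm g p.conjExponent volume).toReal := by
    have h := integral_norm_mul_norm_le hF.2 hgz
    rw [hgn] at h
    refine le_trans (le_of_eq ?_) h
    refine integral_congr_ae (Filter.Eventually.of_forall fun w => ?_)
    simp only [g, Real.norm_of_nonneg (Real.exp_nonneg _)]
  have hz : ‖F z‖ ≤ Real.exp (Real.pi / 2 * normSq z) * ∫ w, ‖weighted F w‖ * g (w - z) := by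
    rw [← reproducing hF.1 hi, ← integral_const_mul]
    refine (norm_integral_le_integral_norm _).trans (le_of_eq ?_)
    exact integral_congr_ae
      (Filter.Eventually.of_forall fun w => norm_reproducing_integrand F z w)
  calc ‖weighted F z‖ = ‖F z‖ * Real.exp (-(Real.pi / 2) * normSq z) := norm_weighted F z
    _ ≤ (Real.exp (Real.pi / 2 * normSq z) * ∫ w, ‖weighted F w‖ * g (w - z)) *
        Real.exp (-(Real.pi / 2) * normSq z) := by gcongr
    _ = ∫ w, ‖weighted F w‖ * g (w - z) := by
      rw [mul_right_comm, ← Real.exp_add]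
      simp
    _ ≤ _ := by
      rw [mul_comm]
      exact hhol

theorem exists_weighted_bound {p : ℝ≥0∞} (hp : 1 ≤ p) {F : CSpace d → ℂ}
    (hF : F ∈ fockSubmodule d p) : ∃ M : ℝ, 0 ≤ M ∧ ∀ z, ‖weighted F z‖ ≤ M := by
  obtain ⟨C, hC, h⟩ := exists_norm_weighted_le d hp
  exact ⟨_, mul_nonneg hC ENNReal.toReal_nonneg, h F hF⟩

theorem fockSubmodule_le_top {p : ℝ≥0∞} (hp : 1 ≤ p) {F : CSpace d → ℂ}
    (hF : F ∈ fockSubmodule d p) : F ∈ fockSubmodule d ∞ := by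
  obtain ⟨M, -, hM⟩ := exists_weighted_bound hp hF
  exact ⟨hF.1, memLp_top_of_bound hF.2.1 M (Filter.Eventually.of_forall hM)⟩

/-- `F^1 ⊆ F^p`. -/
theorem fockSubmodule_one_le {p : ℝ≥0∞} (hp : 1 ≤ p) {F : CSpace d → ℂ}
    (hF : F ∈ fockSubmodule d 1) : F ∈ fockSubmodule d p := by
  obtain ⟨M, -, hM⟩ := exists_weighted_bound le_rfl hF
  exact ⟨hF.1, memLp_of_memLp_one_of_bounded hF.2 hM hp⟩

theorem kernel_mem {p : ℝ≥0∞} (hp : 1 ≤ p) (a : CSpace d) : kernel a ∈ fockSubmodule d p := by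
  have hd : Differentiable ℂ (kernel a) := by
    have : Differentiable ℂ fun w : CSpace d => kernel a w := by fun_prop
    exact this
  refine ⟨hd, ?_⟩
  refine ((memLp_gauss_sub Real.pi_div_two_pos (star a) hp).const_mul
    (Real.exp (Real.pi / 2 * normSq a))).of_le
    (continuous_weighted hd.continuous).aestronglyMeasurable
    (Filter.Eventually.of_forall fun w => ?_)
  rw [norm_weighted_kernel, norm_mul, Real.norm_of_nonneg (Real.exp_nonneg _),
    Real.norm_of_nonneg (Real.exp_nonneg _)]

/-! ### Entire functions given by integrals -/

/-- The linear form `w ↦ a · w`. -/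
def cdotCLM (a : CSpace d) : CSpace d →L[ℂ] ℂ :=
  ∑ j, a j • ContinuousLinearMap.proj (R := ℂ) (φ := fun _ : Fin d => ℂ) j

@[simp] theorem cdotCLM_apply (a w : CSpace d) : cdotCLM a w = cdot a w := by
  simp [cdotCLM, cdot]

theorem norm_cdot_le_card (a w : CSpace d) : ‖cdot a w‖ ≤ d * ‖a‖ * ‖w‖ := by
  refine (norm_cdot_le a w).trans ?_
  gcongr
  calc ∑ j, ‖a j‖ ≤ ∑ _j : Fin d, ‖a‖ := Finset.sum_le_sum fun j _ => norm_le_pi_norm a j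
    _ = d * ‖a‖ := by simp

theorem norm_cdotCLM_le (a : CSpace d) : ‖cdotCLM a‖ ≤ d * ‖a‖ :=
  ContinuousLinearMap.opNorm_le_bound _ (by positivity) fun w => by
    rw [cdotCLM_apply]
    exact norm_cdot_le_card a w

theorem hasFDerivAt_kernel (a z : CSpace d) :
    HasFDerivAt (kernel a) ((Real.pi * kernel a z) • cdotCLM a) z := by
  have h : HasFDerivAt (fun w => (Real.pi : ℂ) * cdot a w) ((Real.pi : ℂ) • cdotCLM a) z := by
    have := ((cdotCLM a).hasFDerivAt (x := z)).const_mul (Real.pi : ℂ)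
    simpa using this
  have h2 := h.cexp
  rw [smul_smul, mul_comm] at h2
  exact h2

/-- Laplace-type integrals of functions of super-exponential decay are entire. -/
theorem differentiable_integral_kernel {h : CSpace d → ℂ} (hm : AEStronglyMeasurable h volume)
    (hi : ∀ B : ℝ, Integrable fun w => ‖h w‖ * Real.exp (B * ‖w‖)) :
    Differentiable ℂ fun z => ∫ w, h w * kernel (star w) z := by
  intro z
  have hK : ∀ z' ∈ Metric.ball z 1, ∀ w : CSpace d,
      ‖kernel (star w) z'‖ ≤ Real.exp (Real.pi * d * (‖z‖ + 1) * ‖w‖) := by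
    intro z' hz' w
    have hz1 : ‖z'‖ ≤ ‖z‖ + 1 := by
      have := norm_le_norm_add_norm_sub' z' z
      have h2 : ‖z' - z‖ < 1 := by simpa [dist_eq_norm] using hz'
      linarith
    rw [norm_kernel]
    refine Real.exp_le_exp.2 ?_
    have h1 := (Complex.re_le_norm _).trans (norm_cdot_le_card (star w) z')
    rw [norm_star] at h1
    have h2 : (d : ℝ) * ‖w‖ * ‖z'‖ ≤ d * ‖w‖ * (‖z‖ + 1) := by gcongr
    nlinarith [Real.pi_pos]
  have hmeas : ∀ z', AEStronglyMeasurable (fun w => h w * kernel (star w) z') volume := fun z' =>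
    hm.mul (Continuous.aestronglyMeasurable (by fun_prop))
  refine (hasFDerivAt_integral_of_dominated_of_fderiv_le (𝕜 := ℂ)
    (F := fun z w => h w * kernel (star w) z)
    (F' := fun z w => (h w * (Real.pi * kernel (star w) z)) • cdotCLM (star w))
    -- On the unit ball about $z$, differentiating brings down a factor of size $\pi d\|w\|$; the
    -- summand $+1$ in the exponent absorbs $\|w\|\le e^{\|w\|}$.
    (bound := fun w => Real.pi * d *
      (‖h w‖ * Real.exp ((Real.pi * d * (‖z‖ + 1) + 1) * ‖w‖)))
    (Metric.ball_mem_nhds z one_pos) (Eventually.of_forall hmeas) ?_ ?_ ?_ ?_ ?_).differentiableAt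
  · refine (hi (Real.pi * d * (‖z‖ + 1))).mono' (hmeas z) (Eventually.of_forall fun w => ?_)
    rw [norm_mul]
    gcongr
    exact hK z (Metric.mem_ball_self one_pos) w
  · refine AEStronglyMeasurable.smul (hm.mul (Continuous.aestronglyMeasurable (by fun_prop))) ?_
    refine Continuous.aestronglyMeasurable ?_
    unfold cdotCLM
    fun_prop
  · refine Eventually.of_forall fun w z' hz' => ?_
    rw [norm_smul, norm_mul, norm_mul, Complex.norm_real, Real.norm_of_nonneg Real.pi_pos.le]
    have h1 := norm_cdotCLM_le (star w)
    rw [norm_star] at h1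
    have h2 : ‖w‖ ≤ Real.exp ‖w‖ := by linarith [Real.add_one_le_exp ‖w‖]
    calc ‖h w‖ * (Real.pi * ‖kernel (star w) z'‖) * ‖cdotCLM (star w)‖
        ≤ ‖h w‖ * (Real.pi * Real.exp (Real.pi * d * (‖z‖ + 1) * ‖w‖)) * (d * Real.exp ‖w‖) := by
          gcongr
          · exact hK z' hz' w
          · exact h1.trans (by gcongr)
      _ = _ := by
          rw [add_mul (Real.pi * d * (‖z‖ + 1)), Real.exp_add, one_mul]
          ring
  · exact (hi _).const_mul _
  · refine Eventually.of_forall fun w z' _ => ?_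
    have := (hasFDerivAt_kernel (star w) z').const_mul (h w)
    rwa [smul_smul] at this

/-! ### The Fock space as a Banach space -/

section Banach

variable {p : ℝ≥0∞}

namespace FockSpace

theorem ext {F G : FockSpace d p} (h : ∀ z, F z = G z) : F = G := Subtype.ext (funext h)

@[simp] theorem add_apply (F G : FockSpace d p) (z : CSpace d) : (F + G) z = F z + G z := rfl

@[simp] theorem sub_apply (F G : FockSpace d p) (z : CSpace d) : (F - G) z = F z - G z := rfl

@[simp] theorem smul_apply (c : ℂ) (F : FockSpace d p) (z : CSpace d) : (c • F) z = c * F z := rfl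

@[simp] theorem mk_apply (F : CSpace d → ℂ) (hF : F ∈ fockSubmodule d p) (z : CSpace d) :
    mk F hF z = F z := rfl

variable [hp : Fact (1 ≤ p)]

theorem norm_toLp (F : FockSpace d p) : ‖toLp F‖ = ‖F‖ := rfl

theorem norm_le_of_weighted_le {F : FockSpace d p} {g : CSpace d → ℝ} (hg : MemLp g p volume)
    (h : ∀ w, ‖weighted F w‖ ≤ g w) : ‖F‖ ≤ (eLpNorm g p volume).toReal := by
  rw [norm_def]
  exact ENNReal.toReal_mono hg.2.ne (eLpNorm_mono_real h)

/-- Point evaluation on the Fock space. -/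
def eval (z : CSpace d) : FockSpace d p →L[ℂ] ℂ :=
  LinearMap.mkContinuousOfExistsBound
    { toFun := fun F => F z, map_add' := fun _ _ => rfl, map_smul' := fun _ _ => rfl } (by
      obtain ⟨C, hC, h⟩ := exists_norm_weighted_le d hp.out
      refine ⟨C * Real.exp (Real.pi / 2 * normSq z), fun F => ?_⟩
      have := SobolevFock.norm_le_of_weighted_le (h F F.2 z)
      rw [← norm_def] at this
      exact this.trans (le_of_eq (by ring)))

@[simp] theorem eval_apply (z : CSpace d) (F : FockSpace d p) : eval z F = F z := rfl

/-- The reproducing kernel as an element of the Fock space. -/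
def kernel (a : CSpace d) : FockSpace d p := mk (SobolevFock.kernel a) (kernel_mem hp.out a)

@[simp] theorem kernel_apply (a z : CSpace d) :
    (kernel a : FockSpace d p) z = SobolevFock.kernel a z := rfl

/-- The constant is the $L^p$ norm of one fixed Gaussian, since the weighted kernels are rescaled
translates of it. -/
theorem exists_norm_kernel_le (d : ℕ) (p : ℝ≥0∞) [hp : Fact (1 ≤ p)] : ∃ C : ℝ, 0 ≤ C ∧
    ∀ a : CSpace d, ‖(kernel a : FockSpace d p)‖ ≤ C * Real.exp (Real.pi / 2 * normSq a) := by
  set g : CSpace d → ℝ := fun w => Real.exp (-(Real.pi / 2) * normSq w)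
  have hg : MemLp g p volume := memLp_gauss Real.pi_div_two_pos hp.out
  refine ⟨(eLpNorm g p volume).toReal, ENNReal.toReal_nonneg, fun a => ?_⟩
  have hga : MemLp (fun w => g (w - star a)) p volume :=
    memLp_gauss_sub Real.pi_div_two_pos (star a) hp.out
  have hgn : eLpNorm (fun w => g (w - star a)) p volume = eLpNorm g p volume :=
    eLpNorm_comp_measurePreserving hg.1 (measurePreserving_sub_right volume (star a))
  refine (norm_le_of_weighted_le (hga.const_mul (Real.exp (Real.pi / 2 * normSq a)))
    fun w => (norm_weighted_kernel a w).le).trans (le_of_eq ?_)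
  have := eLpNorm_const_smul (Real.exp (Real.pi / 2 * normSq a)) (fun w => g (w - star a)) p
    (volume : Measure (CSpace d))
  change (eLpNorm (Real.exp (Real.pi / 2 * normSq a) • fun w => g (w - star a)) p volume).toReal = _
  rw [this, ENNReal.toReal_mul, hgn, mul_comm]
  simp

/-- Convergence in `L^p` of weighted entire functions preserves the reproducing formula. -/
theorem isClosed_range_toLp : IsClosed (Set.range (toLp : FockSpace d p → _)) := by
  refine isClosed_of_closure_subset fun h hh => ?_
  obtain ⟨u, hu, hlim⟩ := mem_closure_iff_seq_limit.1 hh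
  choose F hF using hu
  have := ENNReal.HolderConjugate.conjExponent hp.out
  have hq : 1 ≤ p.conjExponent := ENNReal.HolderConjugate.one_le _ p
  -- One half of $e^{-\pi|w|^2}$ belongs to `weighted`, the other half to `ψ z`, which lies in the
  -- dual exponent. Hence $F(z)=\int \mathrm{weighted}\,F\cdot\psi_z$, an expression that makes
  -- sense on all of $L^p$.
  set ψ : CSpace d → CSpace d → ℂ := fun z w =>
    Complex.exp (-(Real.pi / 2 * normSq w : ℝ)) * SobolevFock.kernel (star w) z with hψ
  have hψn : ∀ z w, ‖ψ z w‖ = Real.exp (-(Real.pi / 2) * normSq w) *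
      Real.exp (Real.pi * (cdot (star w) z).re) := by
    intro z w
    rw [hψ, norm_mul, norm_kernel, Complex.norm_exp, ← Complex.ofReal_neg, Complex.ofReal_re,
      neg_mul]
  have hψc : ∀ z, Continuous (ψ z) := fun z => by fun_prop
  have hψm : ∀ z, MemLp (ψ z) p.conjExponent volume := by
    intro z
    refine ((memLp_gauss_sub Real.pi_div_two_pos z hq).const_mul
      (Real.exp (Real.pi / 2 * normSq z))).of_le (hψc z).aestronglyMeasurable
      (Eventually.of_forall fun w => ?_)
    rw [hψn, ← Real.exp_add, norm_mul, Real.norm_of_nonneg (Real.exp_nonneg _),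
      Real.norm_of_nonneg (Real.exp_nonneg _), ← Real.exp_add, normSq_sub]
    refine Real.exp_le_exp.2 (le_of_eq ?_)
    ring
  have hFz : ∀ n z, F n z = ∫ w, weighted (F n) w * ψ z w := by
    intro n z
    rw [← reproducing (F n).2.1 (integrable_reproducing hp.out (F n).2.1.continuous (F n).2.2 z)]
    refine integral_congr_ae (Eventually.of_forall fun w => ?_)
    have : gaussWeight w = Complex.exp (-(Real.pi * normSq w / 2 : ℝ)) *
        Complex.exp (-(Real.pi / 2 * normSq w : ℝ)) := by
      rw [gaussWeight, ← Complex.exp_add]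
      congr 1
      push_cast
      ring
    simp only [hψ, weighted, this]
    ring
  -- The reproducing integral of the $L^p$ limit `h` is the candidate entire function: it is the
  -- pointwise limit of the `F n`, and along a subsequence their weighted versions converge almost
  -- everywhere to `h`.
  set G : CSpace d → ℂ := fun z => ∫ w, h w * ψ z w with hG
  have hint : ∀ z (f : CSpace d → ℂ), MemLp f p volume → Integrable fun w => f w * ψ z w :=
    fun z f hf => hf.integrable_mul (hψm z)
  have hFG : ∀ z, Tendsto (fun n => F n z) atTop (𝓝 (G z)) := by
    intro z
    rw [tendsto_iff_norm_sub_tendsto_zero]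
    have hb : ∀ n, ‖F n z - G z‖ ≤
        ‖toLp (F n) - h‖ * (eLpNorm (ψ z) p.conjExponent volume).toReal := by
      intro n
      have hsub : MemLp (weighted (F n) - (h : CSpace d → ℂ)) p volume := (F n).2.2.sub (Lp.memLp h)
      have h1 : F n z - G z = ∫ w, (weighted (F n) - (h : CSpace d → ℂ)) w * ψ z w := by
        rw [hFz, hG, ← integral_sub (hint z _ (F n).2.2) (hint z _ (Lp.memLp h))]
        simp only [Pi.sub_apply, sub_mul]
      rw [h1]
      refine (norm_integral_le_integral_norm _).trans ?_
      simp only [norm_mul]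
      refine (integral_norm_mul_norm_le hsub (hψm z)).trans (le_of_eq ?_)
      congr 1
      rw [Lp.norm_def]
      congr 1
      refine eLpNorm_congr_ae ?_
      filter_upwards [Lp.coeFn_sub (toLp (F n)) h, MemLp.coeFn_toLp (F n).2.2] with w hw1 hw2
      rw [hw1, Pi.sub_apply, Pi.sub_apply]
      congr 1
      exact hw2.symm
    refine squeeze_zero (fun n => norm_nonneg _) hb ?_
    have h0 : Tendsto (fun n => ‖toLp (F n) - h‖) atTop (𝓝 0) := by
      rw [← tendsto_iff_norm_sub_tendsto_zero]
      simpa only [hF] using hlim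
    simpa using h0.mul_const (eLpNorm (ψ z) p.conjExponent volume).toReal
  have hGd : Differentiable ℂ G := by
    have := differentiable_integral_kernel
      (h := fun w : CSpace d => h w * Complex.exp (-(Real.pi / 2 * normSq w : ℝ)))
      ((Lp.aestronglyMeasurable h).mul (Continuous.aestronglyMeasurable (by fun_prop))) ?_
    · simpa only [hG, hψ, mul_assoc] using this
    intro B
    obtain ⟨C, hC, hCb⟩ := exists_gauss_dominated (d := d) Real.pi_div_two_pos B 0
    have hm : MemLp (fun w : CSpace d => C * Real.exp (-(Real.pi / 2 / 2) * normSq w))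
        p.conjExponent volume := (memLp_gauss (by positivity) hq).const_mul C
    refine ((Lp.memLp h).norm.integrable_mul hm).mono' (by fun_prop)
      (Eventually.of_forall fun w => ?_)
    rw [norm_mul, norm_norm, norm_mul, Real.norm_of_nonneg (Real.exp_nonneg _),
      Complex.norm_exp, ← Complex.ofReal_neg, Complex.ofReal_re, mul_assoc, ← Real.exp_add]
    refine mul_le_mul_of_nonneg_left ?_ (norm_nonneg _)
    have := hCb w
    rw [pow_zero, one_mul] at this
    refine le_trans (le_of_eq ?_) this
    ring_nf
  have hae : weighted G =ᵐ[volume] h := by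
    have hmeas : TendstoInMeasure volume (fun n => (toLp (F n) : CSpace d → ℂ)) atTop h :=
      tendstoInMeasure_of_tendsto_Lp (by simpa only [hF] using hlim)
    obtain ⟨ns, hns, hns'⟩ := hmeas.exists_seq_tendsto_ae
    have hw : ∀ᵐ w ∂volume, ∀ n, (toLp (F n) : CSpace d → ℂ) w = weighted (F n) w :=
      ae_all_iff.2 fun n => MemLp.coeFn_toLp (F n).2.2
    filter_upwards [hns', hw] with w h1 h2
    simp only [h2] at h1
    refine tendsto_nhds_unique ?_ h1
    exact ((hFG w).comp hns.tendsto_atTop).mul_const _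
  have hGm : G ∈ fockSubmodule d p := ⟨hGd, (memLp_congr_ae hae).2 (Lp.memLp h)⟩
  refine ⟨mk G hGm, ?_⟩
  refine Lp.ext ?_
  exact (MemLp.coeFn_toLp hGm.2).trans hae

/-- Completeness gives content to the $\mathcal F^p$-valued Bochner integral in
`integral_smul_kernel`. -/
instance : CompleteSpace (FockSpace d p) := by
  have hiso : Isometry (toLp : FockSpace d p → Lp ℂ p (volume : Measure (CSpace d))) :=
    AddMonoidHomClass.isometry_of_norm _ norm_toLp
  rw [completeSpace_iff_isComplete_range hiso.isUniformInducing]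
  exact isClosed_range_toLp.isComplete

end FockSpace

end Banach

/-- A first-order expansion with quadratic remainder gives the derivative. -/
theorem hasFDerivAt_of_quadratic_remainder {E G : Type*} [NormedAddCommGroup E] [NormedSpace ℂ E]
    [NormedAddCommGroup G] [NormedSpace ℂ G] {f : E → G} {f' : E →L[ℂ] G} {a : E} {K : ℝ}
    (h : ∀ v : E, ‖v‖ ≤ 1 → ‖f (a + v) - f a - f' v‖ ≤ K * ‖v‖ ^ 2) : HasFDerivAt f f' a := by
  rw [hasFDerivAt_iff_isLittleO_nhds_zero]
  refine Asymptotics.IsBigO.trans_isLittleO (g := fun v : E => ‖v‖ ^ 2) ?_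
    (Asymptotics.isLittleO_norm_pow_id one_lt_two)
  refine Asymptotics.IsBigO.of_bound K ?_
  filter_upwards [Metric.ball_mem_nhds (0 : E) one_pos] with v hv
  rw [Real.norm_of_nonneg (by positivity)]
  exact h v (by simpa using (mem_ball_zero_iff.1 hv).le)

theorem norm_exp_sub_one_sub_id_le (x : ℂ) :
    ‖Complex.exp x - 1 - x‖ ≤ ‖x‖ ^ 2 * Real.exp ‖x‖ := by
  have h := Complex.norm_exp_sub_sum_le_norm_mul_exp x 2
  simpa [Finset.sum_range_succ, sub_sub] using h

theorem norm_weighted_kernel_le (a w : CSpace d) :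
    ‖weighted (kernel a) w‖ ≤
      Real.exp (Real.pi * d * ‖a‖ * ‖w‖ - Real.pi / 2 * normSq w) := by
  rw [norm_weighted, norm_kernel, ← Real.exp_add]
  refine Real.exp_le_exp.2 ?_
  have h := mul_le_mul_of_nonneg_left ((Complex.re_le_norm _).trans (norm_cdot_le_card a w))
    Real.pi_pos.le
  linarith

theorem mem_fockSubmodule_of_gauss {p : ℝ≥0∞} (hp : 1 ≤ p) {F : CSpace d → ℂ}
    (hF : Differentiable ℂ F) {C c : ℝ} (hc : 0 < c)
    (h : ∀ w, ‖weighted F w‖ ≤ C * Real.exp (-c * normSq w)) : F ∈ fockSubmodule d p :=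
  ⟨hF, ((memLp_gauss hc hp).const_mul C).of_le
    (continuous_weighted hF.continuous).aestronglyMeasurable
    (Eventually.of_forall fun w => (h w).trans (le_abs_self _))⟩

/-! ### Holomorphy of the kernel map into the Fock space -/

section Banach

variable {p : ℝ≥0∞} [hp : Fact (1 ≤ p)]

namespace FockSpace

theorem norm_le_of_gauss {F : FockSpace d p} {C c : ℝ} (hC : 0 ≤ C) (hc : 0 < c)
    (h : ∀ w, ‖weighted F w‖ ≤ C * Real.exp (-c * normSq w)) :
    ‖F‖ ≤ C * (eLpNorm (fun w : CSpace d => Real.exp (-c * normSq w)) p volume).toReal := by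
  refine (norm_le_of_weighted_le ((memLp_gauss hc hp.out).const_mul C) h).trans (le_of_eq ?_)
  have := eLpNorm_const_smul C (fun w : CSpace d => Real.exp (-c * normSq w)) p volume
  change (eLpNorm (C • fun w : CSpace d => Real.exp (-c * normSq w)) p volume).toReal = _
  rw [this, ENNReal.toReal_mul]
  simp [hC]

theorem weighted_cdot_mul_kernel_le (a : CSpace d) : ∃ C : ℝ, 0 ≤ C ∧ ∀ h w : CSpace d,
    ‖weighted (fun w => Real.pi * cdot h w * SobolevFock.kernel a w) w‖ ≤
      C * ‖h‖ * Real.exp (-(Real.pi / 2 / 2) * normSq w) := by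
  obtain ⟨C, hC, hb⟩ := exists_gauss_dominated (d := d) Real.pi_div_two_pos (Real.pi * d * ‖a‖) 1
  refine ⟨Real.pi * d * C, by positivity, fun h w => ?_⟩
  have h1 : ‖weighted (fun w => Real.pi * cdot h w * SobolevFock.kernel a w) w‖ =
      Real.pi * ‖cdot h w‖ * ‖weighted (SobolevFock.kernel a) w‖ := by
    rw [norm_weighted, norm_weighted, norm_mul, norm_mul, Complex.norm_real,
      Real.norm_of_nonneg Real.pi_pos.le, mul_assoc]
  rw [h1]
  calc Real.pi * ‖cdot h w‖ * ‖weighted (SobolevFock.kernel a) w‖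
      ≤ Real.pi * (d * ‖h‖ * (1 + ‖w‖)) *
        Real.exp (Real.pi * d * ‖a‖ * ‖w‖ - Real.pi / 2 * normSq w) := by
        gcongr
        · refine (norm_cdot_le_card h w).trans ?_
          gcongr
          linarith
        · exact norm_weighted_kernel_le a w
    _ = Real.pi * d * ‖h‖ * ((1 + ‖w‖) ^ 1 *
        Real.exp (Real.pi * d * ‖a‖ * ‖w‖ - Real.pi / 2 * normSq w)) := by ring
    _ ≤ Real.pi * d * ‖h‖ * (C * Real.exp (-(Real.pi / 2 / 2) * normSq w)) := by
        exact mul_le_mul_of_nonneg_left (hb w) (by positivity)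
    _ = _ := by ring

/-- The derivative of the reproducing kernel with respect to its parameter. -/
def kernelDeriv (a : CSpace d) : CSpace d →L[ℂ] FockSpace d p :=
  LinearMap.toContinuousLinearMap
    { toFun := fun h => mk (fun w => Real.pi * cdot h w * SobolevFock.kernel a w) (by
        obtain ⟨C, hC, hb⟩ := weighted_cdot_mul_kernel_le a
        exact mem_fockSubmodule_of_gauss hp.out (by fun_prop) (c := Real.pi / 2 / 2)
          (by positivity) (hb h))
      map_add' := fun h k => ext fun z => by
        simp only [mk_apply, add_apply, add_cdot]
        ring
      map_smul' := fun c h => ext fun z => by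
        simp only [mk_apply, smul_apply, smul_cdot, RingHom.id_apply]
        ring }

@[simp] theorem kernelDeriv_apply (a h z : CSpace d) :
    (kernelDeriv a h : FockSpace d p) z = Real.pi * cdot h z * SobolevFock.kernel a z := rfl

/-- The remainder is $(e^x-1-x)K_a$ with $x=\pi v\cdot w$, and $|e^x-1-x|\le|x|^2e^{|x|}$; the
Gaussian weight absorbs the growth in $w$, leaving a norm $O(\|v\|^2)$. Norm differentiability,
rather than pointwise, is what survives an arbitrary bounded operator $S$. -/
theorem hasFDerivAt_kernel (a : CSpace d) :
    HasFDerivAt (kernel : CSpace d → FockSpace d p) (kernelDeriv a) a := by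
  -- The power $2$ comes from $|x|^2$, and the $+1$ beside $\|a\|$ from $e^{|x|}$ with $\|v\|\le1$.
  obtain ⟨C, hC, hb⟩ := exists_gauss_dominated (d := d) Real.pi_div_two_pos
    (Real.pi * d * (‖a‖ + 1)) 2
  refine hasFDerivAt_of_quadratic_remainder (K := (Real.pi * d) ^ 2 * C *
    (eLpNorm (fun w : CSpace d => Real.exp (-(Real.pi / 2 / 2) * normSq w)) p volume).toReal)
    fun v hv => ?_
  have hrem : ∀ w, (kernel (a + v) - kernel a - kernelDeriv a v : FockSpace d p) w =
      (Complex.exp (Real.pi * cdot v w) - 1 - Real.pi * cdot v w) * SobolevFock.kernel a w := by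
    intro w
    simp only [sub_apply, kernel_apply, kernelDeriv_apply]
    have : SobolevFock.kernel (a + v) w =
        Complex.exp (Real.pi * cdot v w) * SobolevFock.kernel a w := by
      rw [SobolevFock.kernel, SobolevFock.kernel, ← Complex.exp_add, add_cdot]
      congr 1
      ring
    rw [this]
    ring
  refine (norm_le_of_gauss (C := (Real.pi * d) ^ 2 * C * ‖v‖ ^ 2) (c := Real.pi / 2 / 2)
    (by positivity) (by positivity) fun w => ?_).trans (le_of_eq (by ring))
  have hx : ‖(Real.pi : ℂ) * cdot v w‖ ≤ Real.pi * d * ‖v‖ * ‖w‖ := by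
    rw [norm_mul, Complex.norm_real, Real.norm_of_nonneg Real.pi_pos.le]
    have := mul_le_mul_of_nonneg_left (norm_cdot_le_card v w) Real.pi_pos.le
    linarith
  have hx1 : Real.pi * d * ‖v‖ * ‖w‖ ≤ Real.pi * d * 1 * ‖w‖ := by gcongr
  have hw : ‖weighted (kernel (a + v) - kernel a - kernelDeriv a v : FockSpace d p) w‖ =
      ‖Complex.exp (Real.pi * cdot v w) - 1 - Real.pi * cdot v w‖ *
        ‖weighted (SobolevFock.kernel a) w‖ := by
    rw [norm_weighted, hrem, norm_mul, norm_weighted, mul_assoc]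
  rw [hw]
  calc ‖Complex.exp (Real.pi * cdot v w) - 1 - Real.pi * cdot v w‖ *
        ‖weighted (SobolevFock.kernel a) w‖
      ≤ ((Real.pi * d * ‖v‖ * (1 + ‖w‖)) ^ 2 * Real.exp (Real.pi * d * 1 * ‖w‖)) *
        Real.exp (Real.pi * d * ‖a‖ * ‖w‖ - Real.pi / 2 * normSq w) := by
        gcongr
        · refine (norm_exp_sub_one_sub_id_le _).trans ?_
          gcongr
          · refine hx.trans ?_
            gcongr
            linarith
          · exact hx.trans hx1
        · exact norm_weighted_kernel_le a w
    _ = (Real.pi * d) ^ 2 * ‖v‖ ^ 2 * ((1 + ‖w‖) ^ 2 *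
        Real.exp (Real.pi * d * (‖a‖ + 1) * ‖w‖ - Real.pi / 2 * normSq w)) := by
        rw [mul_assoc, ← Real.exp_add]
        ring_nf
    _ ≤ (Real.pi * d) ^ 2 * ‖v‖ ^ 2 * (C * Real.exp (-(Real.pi / 2 / 2) * normSq w)) := by
        exact mul_le_mul_of_nonneg_left (hb w) (by positivity)
    _ = _ := by ring

theorem differentiable_kernel : Differentiable ℂ (kernel : CSpace d → FockSpace d p) :=
  fun a => (hasFDerivAt_kernel a).differentiableAt

/-! ### Superposition of kernels -/

/-- As $\|K_{\bar w}\|\le Ce^{\pi|w|^2/2}$, the norm of the integrand is at most $C$ times the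
weighted $|F(w)|$: integrability is precisely the condition $F\in\mathcal F^1$, whatever $p$. -/
theorem integrable_smul_kernel {F : CSpace d → ℂ} (hF : F ∈ fockSubmodule d 1) :
    Integrable fun w => (F w * gaussWeight w) • (kernel (star w) : FockSpace d p) := by
  obtain ⟨C, hC, hb⟩ := exists_norm_kernel_le d p
  have hFc := hF.1.continuous
  have hkc : Continuous fun w : CSpace d => (kernel (star w) : FockSpace d p) :=
    differentiable_kernel.continuous.comp continuous_star
  refine ((memLp_one_iff_integrable.1 hF.2).norm.mul_const C).mono'
    (Continuous.aestronglyMeasurable (by fun_prop)) (Eventually.of_forall fun w => ?_)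
  rw [norm_smul, norm_mul, norm_gaussWeight, norm_weighted]
  have h := hb (star w)
  rw [normSq_star] at h
  calc ‖F w‖ * Real.exp (-Real.pi * normSq w) * ‖(kernel (star w) : FockSpace d p)‖
      ≤ ‖F w‖ * Real.exp (-Real.pi * normSq w) * (C * Real.exp (Real.pi / 2 * normSq w)) := by
        gcongr
    _ = ‖F w‖ * (Real.exp (-Real.pi * normSq w) * Real.exp (Real.pi / 2 * normSq w)) * C := by ring
    _ = _ := by
        rw [← Real.exp_add]
        ring_nf

/-- Point evaluations are continuous and separate elements of $\mathcal F^p$, so the reproducing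
formula at each $z$ lifts to an identity of vectors. -/
theorem integral_smul_kernel {F : CSpace d → ℂ} (hF : F ∈ fockSubmodule d 1) :
    ∫ w, (F w * gaussWeight w) • (kernel (star w) : FockSpace d p) =
      mk F (fockSubmodule_one_le hp.out hF) := by
  refine ext fun z => ?_
  have h := (eval z).integral_comp_comm (integrable_smul_kernel (p := p) hF)
  rw [eval_apply] at h
  rw [← h, mk_apply, ← reproducing hF.1
    (integrable_reproducing le_rfl hF.1.continuous hF.2 z)]
  refine integral_congr_ae (Eventually.of_forall fun w => ?_)
  simp only [map_smul, eval_apply, kernel_apply, smul_eq_mul]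
  ring

/-- A bounded functional on `F^p` acts on `F^1` through its values on the kernels. -/
theorem apply_eq_integral (ℓ : FockSpace d p →L[ℂ] ℂ) {F : CSpace d → ℂ}
    (hF : F ∈ fockSubmodule d 1) :
    Integrable (fun w => F w * gaussWeight w * ℓ (kernel (star w))) ∧
      ∫ w, F w * gaussWeight w * ℓ (kernel (star w)) = ℓ (mk F (fockSubmodule_one_le hp.out hF)) := by
  have hi := integrable_smul_kernel (p := p) hF
  have h := ℓ.integral_comp_comm hi
  have h2 := ℓ.integrable_comp hi
  simp only [map_smul, smul_eq_mul] at h h2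
  exact ⟨h2, by rw [h, integral_smul_kernel hF]⟩

end FockSpace

end Banach

/-! ### Density of `F^1` in `F^p` -/

theorem tendsto_eLpNorm_zero_of_dominated {α E : Type*} [MeasurableSpace α] {μ : Measure α}
    [NormedAddCommGroup E] {p : ℝ≥0∞} (hp0 : p ≠ 0) (hp : p ≠ ∞) {f : ℕ → α → E} {g : α → ℝ}
    (hf : ∀ n, AEStronglyMeasurable (f n) μ) (hg : MemLp g p μ) (hb : ∀ n x, ‖f n x‖ ≤ g x)
    (hlim : ∀ x, Tendsto (fun n => f n x) atTop (𝓝 0)) :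
    Tendsto (fun n => eLpNorm (f n) p μ) atTop (𝓝 0) := by
  have hpr : 0 < p.toReal := ENNReal.toReal_pos hp0 hp
  have h1 : Tendsto (fun n => ∫⁻ x, ‖f n x‖ₑ ^ p.toReal ∂μ) atTop (𝓝 (∫⁻ _, 0 ∂μ)) := by
    refine tendsto_lintegral_of_dominated_convergence' (fun x => ‖g x‖ₑ ^ p.toReal)
      (fun n => (hf n).enorm.pow_const _) (fun n => Eventually.of_forall fun x => ?_) ?_
      (Eventually.of_forall fun x => ?_)
    · refine ENNReal.rpow_le_rpow ?_ hpr.le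
      exact enorm_le_iff_norm_le.2 ((hb n x).trans (le_abs_self _))
    · exact (lintegral_rpow_enorm_lt_top_of_eLpNorm_lt_top hp0 hp hg.2).ne
    · have := ((hlim x).enorm).ennrpow_const p.toReal
      simpa [hpr] using this
  have h2 := h1.ennrpow_const (1 / p.toReal)
  simp only [lintegral_zero] at h2
  rw [ENNReal.zero_rpow_of_pos (by positivity)] at h2
  refine h2.congr fun n => ?_
  rw [eLpNorm_eq_lintegral_rpow_enorm_toReal hp0 hp]

/-- The change of variables costs $r^{-n/p}$, with $n$ the real dimension, which is at most $2^n$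
since $r\ge\frac12$ and $p\ge1$. Only uniformity in $r$ matters. -/
theorem eLpNorm_comp_smul_le {p : ℝ≥0∞} (hp1 : 1 ≤ p) (hp : p ≠ ∞) {f : CSpace d → ℂ}
    (hf : Continuous f) {r : ℝ} (hr : 1 / 2 ≤ r) :
    eLpNorm (fun z => f (r • z)) p volume ≤
      ENNReal.ofReal (2 ^ Module.finrank ℝ (CSpace d)) * eLpNorm f p volume := by
  have hr0 : 0 < r := by linarith
  have h1 : eLpNorm (fun z => f (r • z)) p volume =
      eLpNorm f p (Measure.map (fun z : CSpace d => r • z) volume) :=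
    (eLpNorm_map_measure hf.aestronglyMeasurable (by fun_prop)).symm
  rw [h1, Measure.map_addHaar_smul volume hr0.ne', eLpNorm_smul_measure_of_ne_top hp, smul_eq_mul]
  gcongr
  set n := Module.finrank ℝ (CSpace d)
  have h2 : ENNReal.ofReal |(r ^ n)⁻¹| ≤ ENNReal.ofReal (2 ^ n) := by
    refine ENNReal.ofReal_le_ofReal ?_
    rw [abs_of_pos (by positivity), ← inv_pow]
    gcongr
    rw [inv_le_comm₀ hr0 (by norm_num)]
    simpa using hr
  have hpr : 1 ≤ p.toReal := by
    simpa using (ENNReal.toReal_le_toReal ENNReal.one_ne_top hp).2 hp1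
  calc ENNReal.ofReal |(r ^ n)⁻¹| ^ (1 / p).toReal
      ≤ ENNReal.ofReal (2 ^ n) ^ (1 / p).toReal := by gcongr
    _ ≤ ENNReal.ofReal (2 ^ n) ^ (1 : ℝ) := by
        refine ENNReal.rpow_le_rpow_of_exponent_le ?_ ?_
        · rw [← ENNReal.ofReal_one]
          exact ENNReal.ofReal_le_ofReal (one_le_pow₀ (by norm_num))
        · rw [ENNReal.toReal_div, ENNReal.toReal_one, div_le_one (by linarith)]
          exact hpr
    _ = _ := ENNReal.rpow_one _

/-- Weighted dilations `f(rz) e^{-π(1-r²)|z|²/2}`. -/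
def dilate (r : ℝ) (f : CSpace d → ℂ) (z : CSpace d) : ℂ :=
  f (r • z) * (Real.exp (-(Real.pi / 2 * (1 - r ^ 2)) * normSq z) : ℝ)

theorem normSq_real_smul (r : ℝ) (z : CSpace d) : normSq (r • z) = r ^ 2 * normSq z := by
  simp [normSq, Finset.mul_sum, mul_pow]

/-- For $|r|<1$ the dilated entire function has a genuine Gaussian factor to spare, which puts it in
$\mathcal F^1$ as soon as the weighted $F$ is bounded. -/
theorem weighted_comp_smul (r : ℝ) (F : CSpace d → ℂ) :
    weighted (fun z => F (r • z)) = dilate r (weighted F) := by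
  funext z
  rw [dilate, weighted, weighted, mul_assoc, Complex.ofReal_exp, ← Complex.exp_add,
    normSq_real_smul]
  congr 2
  push_cast
  ring

theorem norm_dilate_le {r : ℝ} (hr0 : 0 ≤ r) (hr : r ≤ 1) (f : CSpace d → ℂ) (z : CSpace d) :
    ‖dilate r f z‖ ≤ ‖f (r • z)‖ := by
  rw [dilate, norm_mul, Complex.norm_real, Real.norm_of_nonneg (Real.exp_nonneg _)]
  refine mul_le_of_le_one_right (norm_nonneg _) (Real.exp_le_one_iff.2 ?_)
  have h1 : 0 ≤ 1 - r ^ 2 := by nlinarith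
  have := normSq_nonneg z
  have := Real.pi_pos
  have h2 : 0 ≤ Real.pi / 2 * (1 - r ^ 2) * normSq z := by positivity
  linarith

/-- Dominated convergence: with all ratios at least $\frac12$, the dilates of a function supported
in a ball of radius $R$ stay supported in the ball of radius $2|R|$ and keep the same bound. -/
theorem tendsto_eLpNorm_dilate_sub {p : ℝ≥0∞} (hp1 : 1 ≤ p) (hp : p ≠ ∞) {c : CSpace d → ℂ}
    (hc : Continuous c) (hs : HasCompactSupport c) {r : ℕ → ℝ} (hr : ∀ n, 1 / 2 ≤ r n ∧ r n < 1)
    (hlim : Tendsto r atTop (𝓝 1)) :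
    Tendsto (fun n => eLpNorm (dilate (r n) c - c) p volume) atTop (𝓝 0) := by
  obtain ⟨R, hR⟩ := hs.isCompact.isBounded.subset_closedBall 0
  obtain ⟨M, hM⟩ := hc.bounded_above_of_compact_support hs
  have hM0 : 0 ≤ M := (norm_nonneg _).trans (hM 0)
  have hzero : ∀ z, R < ‖z‖ → c z = 0 := by
    intro z hz
    by_contra h
    have := hR (subset_tsupport c (Function.mem_support.2 h))
    rw [mem_closedBall_zero_iff] at this
    linarith
  have hd : ∀ n, Continuous (dilate (r n) c) := by
    intro n
    unfold dilate
    fun_prop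
  have hR0 : ∀ z : CSpace d, 2 * |R| < ‖z‖ → ∀ n, R < ‖r n • z‖ ∧ R < ‖z‖ := by
    intro z hz n
    have h1 := (hr n).1
    have h2 := le_abs_self R
    have h3 := abs_nonneg R
    constructor
    · rw [norm_smul, Real.norm_of_nonneg (by linarith)]
      nlinarith
    · linarith
  refine tendsto_eLpNorm_zero_of_dominated (zero_lt_one.trans_le hp1).ne' hp
    (g := (Metric.closedBall 0 (2 * |R|)).indicator fun _ => 2 * M)
    (fun n => ((hd n).sub hc).aestronglyMeasurable) ?_ ?_ ?_
  · exact memLp_indicator_const p Metric.isClosed_closedBall.measurableSet _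
      (Or.inr measure_closedBall_lt_top.ne)
  · intro n z
    by_cases hz : z ∈ Metric.closedBall (0 : CSpace d) (2 * |R|)
    · rw [Set.indicator_of_mem hz, Pi.sub_apply]
      refine (norm_sub_le _ _).trans ?_
      have := (norm_dilate_le (by linarith [(hr n).1]) (hr n).2.le c z).trans (hM _)
      linarith [hM z]
    · rw [Set.indicator_of_notMem hz]
      rw [mem_closedBall_zero_iff, not_le] at hz
      obtain ⟨h1, h2⟩ := hR0 z hz n
      simp [dilate, hzero _ h1, hzero _ h2]
  · intro z
    have hcont : Continuous fun s : ℝ => dilate s c z - c z := by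
      unfold dilate
      fun_prop
    have := (hcont.tendsto 1).comp hlim
    simpa [dilate, Function.comp_def] using this

/-- The approximants are $F(sz)$ with $s<1$ close to $1$. Their convergence is checked on a
compactly supported continuous $L^p$ approximation of the weighted $F$, which exists because
$p<\infty$, and transferred by the uniform bound on dilations. -/
theorem dense_fockSubmodule_one {p : ℝ≥0∞} [hp1 : Fact (1 ≤ p)] (hp : p ≠ ∞) :
    Dense {F : FockSpace d p | (F : CSpace d → ℂ) ∈ fockSubmodule d 1} := by
  intro F
  rw [Metric.mem_closure_iff]
  intro ε hε
  set K : ℝ := 2 ^ Module.finrank ℝ (CSpace d)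
  have hK : 1 ≤ K := one_le_pow₀ (by norm_num)
  -- The three errors are at most $K\delta$, $\delta$ and $\delta$, in total $\varepsilon/2$.
  set δ : ℝ := ε / (2 * (K + 2))
  have hδ : 0 < δ := by positivity
  have hwc : Continuous (weighted F) := continuous_weighted F.2.1.continuous
  obtain ⟨c, hcs, hcF, hcc, hcm⟩ := F.2.2.exists_hasCompactSupport_eLpNorm_sub_le hp
    (ε := ENNReal.ofReal δ) (by simpa using hδ)
  set r : ℕ → ℝ := fun n => 1 - 1 / ((n : ℝ) + 2)
  have hr : ∀ n, 1 / 2 ≤ r n ∧ r n < 1 := by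
    intro n
    have h2 : (1 : ℝ) / ((n : ℝ) + 2) ≤ 1 / 2 := by
      gcongr
      linarith [(Nat.cast_nonneg n : (0 : ℝ) ≤ n)]
    have h3 : 0 < (1 : ℝ) / ((n : ℝ) + 2) := by positivity
    constructor <;> simp only [r] <;> linarith
  have hrlim : Tendsto r atTop (𝓝 1) := by
    have h1 : Tendsto (fun n : ℕ => (n : ℝ) + 2) atTop atTop :=
      tendsto_atTop_add_const_right _ _ tendsto_natCast_atTop_atTop
    have := (tendsto_const_nhds (x := (1 : ℝ))).sub (h1.const_div_atTop 1)
    simpa [r] using this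
  have hev := (tendsto_eLpNorm_dilate_sub hp1.out hp hcc hcs hr hrlim).eventually_lt_const
    (show (0 : ℝ≥0∞) < ENNReal.ofReal δ by simpa using hδ)
  obtain ⟨n, hn⟩ := hev.exists
  obtain ⟨hn1, hn2⟩ := hr n
  set s := r n
  have hs0 : 0 < s := by linarith
  obtain ⟨M, hM0, hM⟩ := exists_weighted_bound hp1.out F.2
  have hFs : Differentiable ℂ fun z => F (s • z) :=
    F.2.1.comp (differentiable_id.const_smul s)
  have hFb : ∀ w, ‖weighted (fun z => F (s • z)) w‖ ≤
      M * Real.exp (-(Real.pi / 2 * (1 - s ^ 2)) * normSq w) := by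
    intro w
    rw [weighted_comp_smul, dilate, norm_mul, Complex.norm_real,
      Real.norm_of_nonneg (Real.exp_nonneg _)]
    gcongr
    exact hM _
  have hpos : 0 < Real.pi / 2 * (1 - s ^ 2) := by
    have : 0 < 1 - s ^ 2 := by nlinarith
    positivity
  refine ⟨FockSpace.mk _ (mem_fockSubmodule_of_gauss hp1.out hFs hpos hFb),
    mem_fockSubmodule_of_gauss le_rfl hFs hpos hFb, ?_⟩
  rw [dist_comm, dist_eq_norm, FockSpace.norm_def]
  have hd : ∀ f : CSpace d → ℂ, Continuous f → Continuous (dilate s f) := by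
    intro f hf
    unfold dilate
    fun_prop
  have hsplit : weighted (FockSpace.mk (fun z => F (s • z))
      (mem_fockSubmodule_of_gauss hp1.out hFs hpos hFb) - F : FockSpace d p) =
      dilate s (weighted F - c) + (dilate s c - c) - (weighted F - c) := by
    have h1 : weighted (FockSpace.mk (fun z => F (s • z))
        (mem_fockSubmodule_of_gauss hp1.out hFs hpos hFb) - F : FockSpace d p) =
        dilate s (weighted F) - weighted F := by
      rw [← weighted_comp_smul]
      funext z
      exact weighted_sub (fun z => F (s • z)) F z
    rw [h1]
    funext z
    simp only [dilate, Pi.sub_apply, Pi.add_apply]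
    ring
  have hbound : eLpNorm (weighted (FockSpace.mk (fun z => F (s • z))
      (mem_fockSubmodule_of_gauss hp1.out hFs hpos hFb) - F : FockSpace d p)) p volume ≤
      ENNReal.ofReal (K * δ + δ + δ) := by
    rw [hsplit]
    have hc1 : Continuous (weighted F - c) := hwc.sub hcc
    refine (eLpNorm_sub_le ((hd _ hc1).add ((hd _ hcc).sub hcc)).aestronglyMeasurable
      hc1.aestronglyMeasurable hp1.out).trans ?_
    rw [ENNReal.ofReal_add (by positivity) hδ.le, ENNReal.ofReal_add (by positivity) hδ.le]
    refine add_le_add ((eLpNorm_add_le (hd _ hc1).aestronglyMeasurable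
      ((hd _ hcc).sub hcc).aestronglyMeasurable hp1.out).trans (add_le_add ?_ hn.le)) hcF
    refine (eLpNorm_mono fun z => norm_dilate_le hs0.le hn2.le _ z).trans ?_
    refine (eLpNorm_comp_smul_le hp1.out hp hc1 hn1).trans ?_
    rw [ENNReal.ofReal_mul (by positivity)]
    gcongr
  have := ENNReal.toReal_mono ENNReal.ofReal_ne_top hbound
  rw [ENNReal.toReal_ofReal (by positivity)] at this
  refine this.trans_lt ?_
  have h2 : K * δ + δ + δ = ε / 2 := by
    simp only [δ]
    field_simp
    ring
  linarith

/-! ### Holomorphic dependence of Gaussians on their parameter -/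

/-- The Gaussian factor is kept explicit, so that it can later absorb the exponential growth of
$e^{v\cdot t}-1-v\cdot t$ and its derivatives. -/
theorem exists_norm_iteratedFDeriv_gaussSchwartz_le (a : ℝ) (ha : 0 < a) (b : CSpace d) (n : ℕ) :
    ∃ (C : ℝ) (m : ℕ), 0 ≤ C ∧ ∀ t, ‖iteratedFDeriv ℝ n (gaussSchwartz a ha b) t‖ ≤
      C * ((1 + ‖t‖) ^ m * Real.exp (-a * ‖t‖ ^ 2 + (∑ j, ‖b j‖) * ‖t‖)) := by
  obtain ⟨l, C, hC, hb⟩ :=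
    (gaussExponent_hasTemperateGrowth a b).norm_iteratedFDeriv_le_uniform n
  refine ⟨n.factorial * (C + 1) ^ n, l * n, by positivity, fun t => ?_⟩
  have hone : (1 : ℝ) ≤ (1 + ‖t‖) ^ l := one_le_pow₀ (by linarith [norm_nonneg t])
  -- The base must be at least $1$ for a bound on the $i$-th derivative to be dominated by its
  -- $i$-th power, as the estimate for compositions requires; hence $C+1$.
  have hD1 : 1 ≤ (C + 1) * (1 + ‖t‖) ^ l := by nlinarith
  have hD : ∀ i, 1 ≤ i → i ≤ n →
      ‖iteratedFDeriv ℝ i (gaussExponent a b) t‖ ≤ ((C + 1) * (1 + ‖t‖) ^ l) ^ i := by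
    intro i hi hin
    refine (hb i hin t).trans (le_trans ?_ (le_self_pow₀ hD1 (by omega)))
    gcongr
    linarith
  have hmain := norm_iteratedFDeriv_comp_le (𝕜 := ℝ) (n := n) (N := n)
    (Complex.contDiff_exp)
    ((gaussExponent_hasTemperateGrowth a b).1.of_le (by exact_mod_cast le_top)) le_rfl t
    (fun i _ => norm_iteratedFDeriv_cexp_le i (gaussExponent a b t)) hD
  have hexp : ‖Complex.exp (gaussExponent a b t)‖
      ≤ Real.exp (-a * ‖t‖ ^ 2 + (∑ j, ‖b j‖) * ‖t‖) := by
    rw [Complex.norm_exp]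
    exact Real.exp_le_exp.2 (gaussExponent_re_le a b t)
  calc ‖iteratedFDeriv ℝ n (Complex.exp ∘ gaussExponent a b) t‖
      ≤ n.factorial * Real.exp (-a * ‖t‖ ^ 2 + (∑ j, ‖b j‖) * ‖t‖) *
        ((C + 1) * (1 + ‖t‖) ^ l) ^ n := hmain.trans (by gcongr)
    _ = _ := by
      rw [mul_pow, ← pow_mul]
      ring

/-- The second-order remainder `e^x - 1 - x` of the exponential. -/
def expRemainder (x : ℂ) : ℂ := Complex.exp x - 1 - x

theorem contDiff_expRemainder {n : WithTop ℕ∞} : ContDiff ℝ n expRemainder :=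
  (Complex.contDiff_exp.sub contDiff_const).sub contDiff_id

theorem norm_iteratedFDeriv_succ_le_of_fderiv_eq {f g : ℂ → ℂ}
    (h : fderiv ℝ f = ContinuousLinearMap.mul ℝ ℂ ∘ g) {n : ℕ} {x : ℂ} (hg : ContDiff ℝ n g) :
    ‖iteratedFDeriv ℝ (n + 1) f x‖ ≤ ‖iteratedFDeriv ℝ n g x‖ := by
  rw [← norm_iteratedFDeriv_fderiv, h]
  refine ((ContinuousLinearMap.mul ℝ ℂ).norm_iteratedFDeriv_comp_left hg.contDiffAt le_rfl).trans ?_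
  calc ‖ContinuousLinearMap.mul ℝ ℂ‖ * ‖iteratedFDeriv ℝ n g x‖
      ≤ 1 * ‖iteratedFDeriv ℝ n g x‖ := by
        gcongr
        exact ContinuousLinearMap.opNorm_mul_le ℝ ℂ
    _ = _ := one_mul _

theorem fderiv_eq_mul_comp {f g : ℂ → ℂ} (h : ∀ x, HasDerivAt f (g x) x) :
    fderiv ℝ f = ContinuousLinearMap.mul ℝ ℂ ∘ g := by
  funext w
  have h1 : HasFDerivAt f ((ContinuousLinearMap.toSpanSingleton ℂ (g w)).restrictScalars ℝ) w :=
    (h w).hasFDerivAt.restrictScalars ℝ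
  rw [h1.fderiv]
  ext
  simp [mul_comm]

/-- The successive derivatives of $e^x-1-x$ are $e^x-1$ and then $e^x$, so the order of vanishing at
$0$ drops from two to one to zero. -/
theorem norm_iteratedFDeriv_expRemainder_le (x : ℂ) :
    ‖iteratedFDeriv ℝ 0 expRemainder x‖ ≤ ‖x‖ ^ 2 * Real.exp ‖x‖ ∧
    ‖iteratedFDeriv ℝ 1 expRemainder x‖ ≤ ‖x‖ * Real.exp ‖x‖ ∧
    ∀ j, ‖iteratedFDeriv ℝ (j + 2) expRemainder x‖ ≤ Real.exp ‖x‖ := by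
  have h1 : fderiv ℝ expRemainder = ContinuousLinearMap.mul ℝ ℂ ∘ fun x => Complex.exp x - 1 :=
    fderiv_eq_mul_comp fun x => ((Complex.hasDerivAt_exp x).sub_const 1).sub (hasDerivAt_id x)
  have h2 : fderiv ℝ (fun x => Complex.exp x - 1) = ContinuousLinearMap.mul ℝ ℂ ∘ Complex.exp :=
    fderiv_eq_mul_comp fun x => (Complex.hasDerivAt_exp x).sub_const 1
  have hc : ∀ n : ℕ, ContDiff ℝ n fun x => Complex.exp x - 1 := fun n =>
    Complex.contDiff_exp.sub contDiff_const
  refine ⟨?_, ?_, fun j => ?_⟩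
  · rw [norm_iteratedFDeriv_zero]
    exact norm_exp_sub_one_sub_id_le x
  · refine (norm_iteratedFDeriv_succ_le_of_fderiv_eq h1 (hc 0)).trans ?_
    rw [norm_iteratedFDeriv_zero]
    simpa using Complex.norm_exp_sub_sum_le_norm_mul_exp x 1
  · refine (norm_iteratedFDeriv_succ_le_of_fderiv_eq h1 (hc (j + 1))).trans ?_
    refine (norm_iteratedFDeriv_succ_le_of_fderiv_eq h2 Complex.contDiff_exp).trans ?_
    exact (norm_iteratedFDeriv_cexp_le j x).trans (Complex.norm_exp_le_exp_norm x)

/-- The real-linear form `t ↦ v · t` on `ℝ^d`. -/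
def realForm (v : CSpace d) : RSpace d →L[ℝ] ℂ :=
  ∑ j, v j • (Complex.ofRealCLM.comp (EuclideanSpace.proj (𝕜 := ℝ) j))

theorem realForm_apply (v : CSpace d) (t : RSpace d) : realForm v t = cdot v (toC t) := by
  simp [realForm, cdot, toC]

theorem norm_realForm_le (v : CSpace d) : ‖realForm v‖ ≤ d * ‖v‖ := by
  refine ContinuousLinearMap.opNorm_le_bound _ (by positivity) fun t => ?_
  rw [realForm_apply]
  refine (norm_cdot_le_card v (toC t)).trans ?_
  gcongr
  refine (pi_norm_le_iff_of_nonneg (norm_nonneg t)).2 fun j => ?_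
  simpa [toC] using PiLp.norm_apply_le t j

/-- Every order of differentiation yields two factors $\|v\|$: both from the remainder at order $0$,
one from the remainder and one from the chain rule at order $1$, both from the chain rule
afterwards. -/
theorem norm_iteratedFDeriv_expRemainder_comp_le {v : CSpace d} (hv : ‖v‖ ≤ 1) (j : ℕ)
    (t : RSpace d) : ‖iteratedFDeriv ℝ j (expRemainder ∘ realForm v) t‖ ≤
      ‖v‖ ^ 2 * (1 + d) ^ (j + 2) * ((1 + ‖t‖) ^ 2 * Real.exp (d * ‖t‖)) := by
  set N : ℝ := d * ‖v‖
  have hN0 : 0 ≤ N := by positivity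
  have hNd : N ≤ 1 + d := by
    have : N ≤ d * 1 := by simp only [N]; gcongr
    linarith
  have hL : ‖realForm v‖ ≤ N := norm_realForm_le v
  have hx : ‖realForm v t‖ ≤ N * ‖t‖ :=
    ((realForm v).le_opNorm t).trans (by gcongr)
  have hxd : ‖realForm v t‖ ≤ d * ‖t‖ := by
    refine hx.trans ?_
    have : N ≤ d * 1 := by simp only [N]; gcongr
    rw [mul_one] at this
    gcongr
  have hN2 : N ^ 2 ≤ ‖v‖ ^ 2 * (1 + d) ^ 2 := by
    simp only [N]
    rw [mul_pow, mul_comm]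
    gcongr
    linarith
  have hcomp : ‖iteratedFDeriv ℝ j (expRemainder ∘ realForm v) t‖ ≤
      ‖iteratedFDeriv ℝ j expRemainder (realForm v t)‖ * N ^ j := by
    rw [(realForm v).iteratedFDeriv_comp_right (n := j) contDiff_expRemainder t le_rfl]
    refine (ContinuousMultilinearMap.norm_compContinuousLinearMap_le _ _).trans ?_
    rw [Finset.prod_const, Finset.card_univ, Fintype.card_fin]
    gcongr
  have hE : Real.exp ‖realForm v t‖ ≤ Real.exp (d * ‖t‖) := Real.exp_le_exp.2 hxd
  have ht1 : ‖t‖ ≤ 1 + ‖t‖ := by linarith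
  have ht2 : 1 ≤ 1 + ‖t‖ := by linarith [norm_nonneg t]
  have hkey : ‖iteratedFDeriv ℝ j expRemainder (realForm v t)‖ * N ^ j ≤
      N ^ 2 * (1 + d) ^ j * ((1 + ‖t‖) ^ 2 * Real.exp (d * ‖t‖)) := by
    obtain ⟨h0, h1, h2⟩ := norm_iteratedFDeriv_expRemainder_le (realForm v t)
    rcases j with _ | _ | j
    · rw [pow_zero, pow_zero, mul_one, mul_one]
      calc ‖iteratedFDeriv ℝ 0 expRemainder (realForm v t)‖
          ≤ (N * ‖t‖) ^ 2 * Real.exp (d * ‖t‖) := h0.trans (by gcongr)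
        _ ≤ (N * (1 + ‖t‖)) ^ 2 * Real.exp (d * ‖t‖) := by gcongr
        _ = _ := by ring
    · rw [zero_add, pow_one, pow_one]
      calc ‖iteratedFDeriv ℝ 1 expRemainder (realForm v t)‖ * N
          ≤ (N * ‖t‖) * Real.exp (d * ‖t‖) * N := by
            gcongr
            exact h1.trans (by gcongr)
        _ = N ^ 2 * 1 * ((‖t‖ * 1) * Real.exp (d * ‖t‖)) := by ring
        _ ≤ N ^ 2 * (1 + d) * (((1 + ‖t‖) * (1 + ‖t‖)) * Real.exp (d * ‖t‖)) := by
            gcongr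
            linarith [(Nat.cast_nonneg d : (0 : ℝ) ≤ d)]
        _ = _ := by ring
    · calc ‖iteratedFDeriv ℝ (j + 2) expRemainder (realForm v t)‖ * N ^ (j + 2)
          ≤ Real.exp (d * ‖t‖) * N ^ (j + 2) := by
            gcongr
            exact (h2 j).trans hE
        _ = N ^ 2 * N ^ j * (1 ^ 2 * Real.exp (d * ‖t‖)) := by ring
        _ ≤ N ^ 2 * (1 + d) ^ (j + 2) * ((1 + ‖t‖) ^ 2 * Real.exp (d * ‖t‖)) := by
            gcongr
            calc N ^ j ≤ (1 + (d : ℝ)) ^ j := by gcongr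
              _ ≤ (1 + (d : ℝ)) ^ (j + 2) :=
                pow_le_pow_right₀ (by linarith [(Nat.cast_nonneg d : (0 : ℝ) ≤ d)]) (by omega)
  refine hcomp.trans (hkey.trans ?_)
  calc N ^ 2 * (1 + d) ^ j * ((1 + ‖t‖) ^ 2 * Real.exp (d * ‖t‖))
      ≤ (‖v‖ ^ 2 * (1 + d) ^ 2) * (1 + d) ^ j * ((1 + ‖t‖) ^ 2 * Real.exp (d * ‖t‖)) := by gcongr
    _ = _ := by ring

/-- Multiplication by the coordinate `t_j` on Schwartz functions. -/
def coordMul (j : Fin d) : 𝓢(RSpace d, ℂ) →L[ℂ] 𝓢(RSpace d, ℂ) :=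
  SchwartzMap.smulLeftCLM ℂ (fun t : RSpace d => (t j : ℂ))

theorem coordMul_apply (j : Fin d) (g : 𝓢(RSpace d, ℂ)) (t : RSpace d) :
    coordMul j g t = (t j : ℂ) * g t := by
  have h : (fun t : RSpace d => (t j : ℂ)).HasTemperateGrowth :=
    Function.Complex.hasTemperateGrowth_ofReal.comp
      (EuclideanSpace.proj (𝕜 := ℝ) j).hasTemperateGrowth
  rw [coordMul, SchwartzMap.smulLeftCLM_apply_apply h, smul_eq_mul]

/-- The difference is the Gaussian times $e^{v\cdot t}-1-v\cdot t$. The Leibniz rule combines the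
bounds on the two factors, giving a first-order expansion in every Schwartz seminorm with quadratic
error. -/
theorem exists_seminorm_gaussSchwartz_remainder_le (a : ℝ) (ha : 0 < a) (b : CSpace d) (k n : ℕ) :
    ∃ K : ℝ, 0 ≤ K ∧ ∀ v : CSpace d, ‖v‖ ≤ 1 →
      SchwartzMap.seminorm ℂ k n (gaussSchwartz a ha (b + v) - gaussSchwartz a ha b -
        ∑ j, v j • coordMul j (gaussSchwartz a ha b)) ≤ K * ‖v‖ ^ 2 := by
  choose C m hC hb using exists_norm_iteratedFDeriv_gaussSchwartz_le a ha b
  generalize (∑ j, ‖b j‖) = S at hb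
  -- The exponent collects `k` from the seminorm, `m i` from the Gaussian's derivatives and `2` from
  -- the remainder, whose factor $e^{d\|t\|}$ adds `d` to `S`.
  choose K hK hKb using fun i =>
    exists_gauss_bound a (S + d) ha (k + m i + 2)
  refine ⟨∑ i ∈ Finset.range (n + 1), n.choose i * C i * (1 + d) ^ (n - i + 2) * K i,
    Finset.sum_nonneg fun i _ => by have := hC i; have := hK i; positivity, fun v hv => ?_⟩
  set R := gaussSchwartz a ha (b + v) - gaussSchwartz a ha b -
        ∑ j, v j • coordMul j (gaussSchwartz a ha b)
  have hR : (R : RSpace d → ℂ) =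
      fun t => gaussSchwartz a ha b t * (expRemainder ∘ realForm v) t := by
    funext t
    have h1 : gaussSchwartz a ha (b + v) t = gaussSchwartz a ha b t *
        Complex.exp (realForm v t) := by
      change Complex.exp (gaussExponent a (b + v) t) = Complex.exp (gaussExponent a b t) * _
      rw [← Complex.exp_add, realForm_apply, gaussExponent, gaussExponent, add_cdot]
      ring_nf
    have h2 : (∑ j, v j • coordMul j (gaussSchwartz a ha b)) t =
        realForm v t * gaussSchwartz a ha b t := by
      rw [sum_apply, realForm_apply, cdot, Finset.sum_mul]
      refine Finset.sum_congr rfl fun j _ => ?_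
      rw [smul_apply, coordMul_apply, smul_eq_mul, toC, mul_assoc]
    change gaussSchwartz a ha (b + v) t - gaussSchwartz a ha b t -
      (∑ j, v j • coordMul j (gaussSchwartz a ha b)) t = _
    rw [h1, h2, Function.comp_apply, expRemainder]
    ring
  refine SchwartzMap.seminorm_le_bound ℂ k n R ?_ fun t => ?_
  · refine mul_nonneg (Finset.sum_nonneg fun i _ => ?_) (by positivity)
    have := hC i
    have := hK i
    positivity
  rw [hR]
  have hleib := norm_iteratedFDeriv_mul_le (𝕜 := ℝ) (n := n) (N := n)
    ((gaussSchwartz a ha b).smooth n)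
    ((contDiff_expRemainder (n := n)).comp (realForm v).contDiff) t le_rfl
  have ht1 : ‖t‖ ≤ 1 + ‖t‖ := by linarith
  calc ‖t‖ ^ k * ‖iteratedFDeriv ℝ n
        (fun t => gaussSchwartz a ha b t * (expRemainder ∘ realForm v) t) t‖
      ≤ (1 + ‖t‖) ^ k * ∑ i ∈ Finset.range (n + 1), (n.choose i : ℝ) *
          ‖iteratedFDeriv ℝ i (gaussSchwartz a ha b) t‖ *
          ‖iteratedFDeriv ℝ (n - i) (expRemainder ∘ realForm v) t‖ := by gcongr
    _ ≤ (1 + ‖t‖) ^ k * ∑ i ∈ Finset.range (n + 1), (n.choose i : ℝ) *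
          (C i * ((1 + ‖t‖) ^ m i * Real.exp (-a * ‖t‖ ^ 2 + S * ‖t‖))) *
          (‖v‖ ^ 2 * (1 + d) ^ (n - i + 2) * ((1 + ‖t‖) ^ 2 * Real.exp (d * ‖t‖))) := by
        gcongr with i
        · have := hC i
          positivity
        · exact hb i t
        · exact norm_iteratedFDeriv_expRemainder_comp_le hv _ t
    _ = (∑ i ∈ Finset.range (n + 1), n.choose i * C i * (1 + d) ^ (n - i + 2) *
          ((1 + ‖t‖) ^ (k + m i + 2) *
            Real.exp (-a * ‖t‖ ^ 2 + (S + d) * ‖t‖))) * ‖v‖ ^ 2 := by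
        rw [Finset.mul_sum, Finset.sum_mul]
        refine Finset.sum_congr rfl fun i _ => ?_
        rw [add_mul S, ← add_assoc, Real.exp_add _ ((d : ℝ) * ‖t‖)]
        ring
    _ ≤ _ := by
        gcongr with i
        · have := hC i
          positivity
        · exact hKb i _ (norm_nonneg t)

theorem exists_bound_of_temperedDistribution (f : 𝓢'(RSpace d, ℂ)) :
    ∃ (s : Finset (ℕ × ℕ)) (C : ℝ), 0 ≤ C ∧ ∀ g, ‖f g‖ ≤
      C * s.sup (schwartzSeminormFamily ℂ (RSpace d) ℂ) g := by
  have hf : Continuous f := map_continuous f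
  obtain ⟨s, C, -, h⟩ := Seminorm.bound_of_continuous (schwartz_withSeminorms ℂ (RSpace d) ℂ)
    ((normSeminorm ℂ ℂ).comp (f : 𝓢(RSpace d, ℂ) →ₗ[ℂ] ℂ)) (continuous_norm.comp hf)
  exact ⟨s, C, C.2, fun g => h g⟩

/-- `b ↦ f(e^{-a|t|^2 + b·t})` is entire for every tempered distribution `f`. -/
theorem differentiable_apply_gaussSchwartz (f : 𝓢'(RSpace d, ℂ)) (a : ℝ) (ha : 0 < a) :
    Differentiable ℂ fun b => f (gaussSchwartz a ha b) := by
  intro b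
  obtain ⟨s, C, hC, hf⟩ := exists_bound_of_temperedDistribution f
  choose K hK hKb using fun q : ℕ × ℕ =>
    exists_seminorm_gaussSchwartz_remainder_le a ha b q.1 q.2
  -- The partial derivative in $b_j$ is `f` applied to $t_j$ times the Gaussian; the error is
  -- controlled because `f` is bounded by finitely many seminorms.
  refine (hasFDerivAt_of_quadratic_remainder (K := C * ∑ q ∈ s, K q)
    (f' := cdotCLM fun j => f (coordMul j (gaussSchwartz a ha b))) fun v hv => ?_).differentiableAt
  have h1 : f (gaussSchwartz a ha (b + v)) - f (gaussSchwartz a ha b) -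
      cdotCLM (fun j => f (coordMul j (gaussSchwartz a ha b))) v =
      f (gaussSchwartz a ha (b + v) - gaussSchwartz a ha b -
        ∑ j, v j • coordMul j (gaussSchwartz a ha b)) := by
    rw [map_sub, map_sub, map_sum, cdotCLM_apply, cdot_comm, cdot]
    congr 1
    exact Finset.sum_congr rfl fun j _ => by rw [map_smul, smul_eq_mul]
  rw [h1, mul_assoc]
  refine (hf _).trans ?_
  gcongr
  have hsum : 0 ≤ ∑ q ∈ s, K q := Finset.sum_nonneg fun q _ => hK q
  refine Seminorm.finset_sup_apply_le (by positivity) fun q hq => (hKb q v hv).trans ?_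
  gcongr
  exact Finset.single_le_sum (f := K) (fun q _ => hK q) hq

/-! ### Gaussian integrals on `ℝ^d` -/

@[fun_prop]
theorem continuous_toC : Continuous (toC : RSpace d → CSpace d) := by
  unfold toC
  fun_prop

@[simp] theorem toC_add (x y : RSpace d) : toC (x + y) = toC x + toC y := by
  funext j
  simp [toC]

@[simp] theorem toC_sub (x y : RSpace d) : toC (x - y) = toC x - toC y := by
  funext j
  simp [toC]

@[simp] theorem toC_neg (x : RSpace d) : toC (-x) = -toC x := by
  funext j
  simp [toC]

@[simp] theorem star_toC (x : RSpace d) : star (toC x) = toC x := by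
  funext j
  simp [toC]

theorem toC_smul (c : ℝ) (x : RSpace d) : toC (c • x) = (c : ℂ) • toC x := by
  funext j
  simp [toC]

theorem cdot_toC_toC (x y : RSpace d) : cdot (toC x) (toC y) = ((inner ℝ x y : ℝ) : ℂ) := by
  simp [cdot, toC, PiLp.inner_apply, mul_comm]

theorem cdot_toC_self (x : RSpace d) : cdot (toC x) (toC x) = (‖x‖ : ℂ) ^ 2 := by
  rw [cdot_toC_toC, real_inner_self_eq_norm_sq, Complex.ofReal_pow]

theorem gaussExponent_eq (a : ℝ) (b : CSpace d) (t : RSpace d) :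
    gaussExponent a b t = -(a * cdot (toC t) (toC t)) + cdot b (toC t) := by
  rw [gaussExponent, cdot_toC_self]
  push_cast
  rfl

theorem integral_gaussSchwartz (b : ℝ) (hb : 0 < b) (c : CSpace d) :
    ∫ t, gaussSchwartz b hb c t =
      ((Real.pi : ℂ) / b) ^ ((d : ℂ) / 2) * Complex.exp (cdot c c / (4 * b)) := by
  rw [← (PiLp.volume_preserving_toLp (Fin d)).integral_comp
    (MeasurableEquiv.toLp 2 _).measurableEmbedding]
  have h := GaussianFourier.integral_cexp_neg_mul_sum_add (ι := Fin d) (b := (b : ℂ))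
    (by simpa using hb) c
  rw [Fintype.card_fin] at h
  have hc : cdot c c = ∑ i, c i ^ 2 := by simp [cdot, sq]
  rw [hc, ← h]
  refine integral_congr_ae (Eventually.of_forall fun v => ?_)
  change Complex.exp (gaussExponent b c _) = _
  rw [gaussExponent_eq]
  congr 1
  simp [cdot, toC, sq]

/-! ### The Bargmann transform of tempered distributions -/

/-- The normalising constant `2^{d/4}`. -/
def windowConst (d : ℕ) : ℂ := (2 : ℂ) ^ ((d : ℂ) / 4)

theorem windowConst_ne_zero (d : ℕ) : windowConst d ≠ 0 := by
  rw [windowConst, Ne, Complex.cpow_eq_zero_iff]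
  simp

/-- This is $\|\varphi_0\|_{L^2}=1$, since $\int e^{-2\pi|t|^2}dt=2^{-d/2}$; it makes the Bargmann
transform of an atom exactly a kernel. -/
theorem windowConst_mul_self (d : ℕ) :
    windowConst d * windowConst d * ((1 : ℂ) / 2) ^ ((d : ℂ) / 2) = 1 := by
  have h2 : (2 : ℂ) ≠ 0 := two_ne_zero
  rw [windowConst, ← Complex.cpow_add _ _ h2, one_div, Complex.inv_cpow]
  · rw [show (d : ℂ) / 4 + d / 4 = d / 2 by ring]
    refine mul_inv_cancel₀ ?_
    rw [Ne, Complex.cpow_eq_zero_iff]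
    simp
  · rw [show (2 : ℂ) = ((2 : ℝ) : ℂ) by simp, Complex.arg_ofReal_of_nonneg (by norm_num)]
    exact Real.pi_pos.ne

/-- The kernel `t ↦ 2^{d/4} e^{-πz²/2 + 2πz·t - π|t|²}` of the Bargmann transform. -/
def atom (z : CSpace d) : 𝓢(RSpace d, ℂ) :=
  (windowConst d * Complex.exp (-(Real.pi / 2 * cdot z z))) •
    gaussSchwartz Real.pi Real.pi_pos ((2 * Real.pi : ℂ) • z)

theorem atom_apply (z : CSpace d) (t : RSpace d) :
    atom z t = windowConst d * Complex.exp (-(Real.pi / 2 * cdot z z) -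
      Real.pi * cdot (toC t) (toC t) + 2 * Real.pi * cdot z (toC t)) := by
  rw [atom, smul_apply, smul_eq_mul, mul_assoc]
  change _ * (_ * Complex.exp (gaussExponent _ _ _)) = _
  rw [← Complex.exp_add, gaussExponent_eq, smul_cdot]
  congr 2
  ring

/-- The real part of a vector in `ℂ^d`. -/
def reC (z : CSpace d) : RSpace d := WithLp.toLp 2 fun j => (z j).re

@[simp] theorem reC_apply (z : CSpace d) (j : Fin d) : reC z j = (z j).re := rfl

theorem re_cdot_self (z : CSpace d) : (cdot z z).re = 2 * ‖reC z‖ ^ 2 - normSq z := by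
  rw [EuclideanSpace.norm_sq_eq, normSq, Finset.mul_sum, ← Finset.sum_sub_distrib, cdot,
    Complex.re_sum]
  refine Finset.sum_congr rfl fun j _ => ?_
  rw [reC_apply, Real.norm_eq_abs, sq_abs, ← Complex.normSq_eq_norm_sq, Complex.normSq_apply,
    Complex.mul_re]
  ring

theorem re_cdot_toC (z : CSpace d) (t : RSpace d) : (cdot z (toC t)).re = inner ℝ t (reC z) := by
  simp [cdot, toC, PiLp.inner_apply, Complex.re_sum]

/-- With $\mathrm{Re}\,z\cdot z=2|\mathrm{Re}\,z|^2-|z|^2$ the exponent becomes a complete square.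
Both the sup norm and the $L^1$ norm of an atom are thus multiples of $e^{\pi|z|^2/2}$. -/
theorem norm_atom_apply (z : CSpace d) (t : RSpace d) :
    ‖atom z t‖ = ‖windowConst d‖ * Real.exp (Real.pi / 2 * normSq z) *
      Real.exp (-Real.pi * ‖t - reC z‖ ^ 2) := by
  have h1 : (-(Real.pi / 2 * cdot z z) - Real.pi * cdot (toC t) (toC t) +
      2 * Real.pi * cdot z (toC t) : ℂ).re = -(Real.pi / 2 * (cdot z z).re) -
      Real.pi * ‖t‖ ^ 2 + 2 * Real.pi * (cdot z (toC t)).re := by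
    rw [cdot_toC_self]
    simp [← Complex.ofReal_pow]
  rw [atom_apply, norm_mul, Complex.norm_exp, mul_assoc ‖windowConst d‖, ← Real.exp_add, h1,
    re_cdot_self,
    re_cdot_toC, norm_sub_sq_real]
  congr 2
  ring

theorem norm_atom_le (z : CSpace d) (t : RSpace d) :
    ‖atom z t‖ ≤ ‖windowConst d‖ * Real.exp (Real.pi / 2 * normSq z) := by
  rw [norm_atom_apply]
  refine mul_le_of_le_one_right (by positivity) (Real.exp_le_one_iff.2 ?_)
  nlinarith [Real.pi_pos, sq_nonneg ‖t - reC z‖]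

/-- The Bargmann transform of a tempered distribution. -/
def bargmann (f : 𝓢'(RSpace d, ℂ)) (z : CSpace d) : ℂ := f (atom z)

theorem bargmann_eq (f : 𝓢'(RSpace d, ℂ)) (z : CSpace d) :
    bargmann f z = windowConst d * Complex.exp (-(Real.pi / 2 * cdot z z)) *
      f (gaussSchwartz Real.pi Real.pi_pos ((2 * Real.pi : ℂ) • z)) := by
  rw [bargmann, atom, map_smul, smul_eq_mul]

theorem differentiable_bargmann (f : 𝓢'(RSpace d, ℂ)) : Differentiable ℂ (bargmann f) := by
  have h := (differentiable_apply_gaussSchwartz f Real.pi Real.pi_pos).comp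
    (differentiable_id.const_smul (2 * Real.pi : ℂ))
  have h2 : Differentiable ℂ fun z : CSpace d =>
      windowConst d * Complex.exp (-(Real.pi / 2 * cdot z z)) := by fun_prop
  rw [funext (bargmann_eq f)]
  exact h2.mul h

theorem bargmann_add (f g : 𝓢'(RSpace d, ℂ)) : bargmann (f + g) = bargmann f + bargmann g := rfl

theorem bargmann_smul (c : ℂ) (f : 𝓢'(RSpace d, ℂ)) : bargmann (c • f) = c • bargmann f := rfl

/-! ### The short-time Fourier transform and the Bargmann transform -/

/-- The identification `(x, ω) ↦ x - iω` of phase space with `ℂ^d`. -/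
def phase (q : RSpace d × RSpace d) : CSpace d := fun j => q.1 j - Complex.I * q.2 j

theorem measurePreserving_phase :
    MeasurePreserving (phase : RSpace d × RSpace d → CSpace d) volume volume := by
  have h1 : MeasurePreserving (Prod.map (@WithLp.ofLp 2 (Fin d → ℝ)) (@WithLp.ofLp 2 (Fin d → ℝ)))
      (volume : Measure (RSpace d × RSpace d)) volume :=
    (PiLp.volume_preserving_ofLp (Fin d)).prod (PiLp.volume_preserving_ofLp (Fin d))
  have h2 := (volume_measurePreserving_arrowProdEquivProdArrow ℝ ℝ (Fin d)).symm
  have h3 : MeasurePreserving (fun (v : Fin d → ℝ × ℝ) (j : Fin d) =>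
      Complex.measurableEquivRealProd.symm (v j)) volume volume :=
    volume_preserving_pi fun _ => Complex.volume_preserving_equiv_real_prod.symm
  have h := measurePreserving_star.comp (h3.comp (h2.comp h1))
  convert h using 1
  funext q j
  refine Complex.ext ?_ ?_
  · simp [phase, MeasurableEquiv.arrowProdEquivProdArrow, Equiv.arrowProdEquivProdArrow]
  · simp [phase, MeasurableEquiv.arrowProdEquivProdArrow, Equiv.arrowProdEquivProdArrow]

theorem continuous_phase : Continuous (phase : RSpace d × RSpace d → CSpace d) := by
  unfold phase
  fun_prop

/-- The conjugated time-frequency shift of the window has linear exponent $2\pi(x-i\omega)\cdot t$,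
like the atom at $z=x-i\omega$. Their prefactors differ by the weight $e^{-\pi|z|^2/2}$ and a phase
coming from $\mathrm{Im}\,z\cdot z=-2x\cdot\omega$. -/
theorem stft_eq (f : 𝓢'(RSpace d, ℂ)) (q : RSpace d × RSpace d) :
    stft f q = Complex.exp (-(Real.pi * Complex.I * (inner ℝ q.1 q.2 : ℝ))) *
      weighted (bargmann f) (phase q) := by
  have h1 : (fun j => 2 * Real.pi * ((q.1 j : ℂ) - Complex.I * (q.2 j : ℂ)) : CSpace d) =
      (2 * Real.pi : ℂ) • phase q := by
    funext j
    simp [phase]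
  have h2 : phase q = toC q.1 - Complex.I • toC q.2 := by
    funext j
    simp [phase, toC]
  have h3 : cdot (phase q) (phase q) = (‖q.1‖ : ℂ) ^ 2 - (‖q.2‖ : ℂ) ^ 2 -
      2 * Complex.I * (inner ℝ q.1 q.2 : ℝ) := by
    rw [h2, sub_cdot, cdot_sub, cdot_sub, cdot_smul, smul_cdot, smul_cdot, cdot_smul,
      cdot_comm (toC q.2) (toC q.1), cdot_toC_self, cdot_toC_self, cdot_toC_toC]
    linear_combination (‖q.2‖ : ℂ) ^ 2 * Complex.I_mul_I
  have h4 : (normSq (phase q) : ℝ) = ‖q.1‖ ^ 2 + ‖q.2‖ ^ 2 := by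
    rw [EuclideanSpace.norm_sq_eq, EuclideanSpace.norm_sq_eq, ← Finset.sum_add_distrib, normSq]
    refine Finset.sum_congr rfl fun j _ => ?_
    rw [← Complex.normSq_eq_norm_sq, Complex.normSq_apply]
    simp [phase]
    ring
  rw [stft, stftAtom, map_smul, weighted, bargmann_eq, h1, h3, h4, smul_eq_mul, windowConst]
  have h5 : Complex.exp (-(Real.pi * ‖q.1‖ ^ 2 : ℝ)) =
      Complex.exp (-(Real.pi * Complex.I * (inner ℝ q.1 q.2 : ℝ))) *
      (Complex.exp (-(Real.pi / 2 * ((‖q.1‖ : ℂ) ^ 2 - (‖q.2‖ : ℂ) ^ 2 -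
        2 * Complex.I * (inner ℝ q.1 q.2 : ℝ)))) *
      Complex.exp (-(Real.pi * (‖q.1‖ ^ 2 + ‖q.2‖ ^ 2) / 2 : ℝ))) := by
    rw [← Complex.exp_add, ← Complex.exp_add]
    congr 1
    push_cast
    ring
  rw [h5]
  ring

theorem norm_stft (f : 𝓢'(RSpace d, ℂ)) (q : RSpace d × RSpace d) :
    ‖stft f q‖ = ‖weighted (bargmann f) (phase q)‖ := by
  rw [stft_eq, norm_mul, Complex.norm_exp]
  simp

theorem continuous_stft (f : 𝓢'(RSpace d, ℂ)) : Continuous (stft f) := by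
  have h := (continuous_weighted (differentiable_bargmann f).continuous).comp continuous_phase
  have h2 : Continuous fun q : RSpace d × RSpace d =>
      Complex.exp (-(Real.pi * Complex.I * (inner ℝ q.1 q.2 : ℝ))) := by fun_prop
  exact (h2.mul h).congr fun q => (stft_eq f q).symm

theorem eLpNorm_stft (f : 𝓢'(RSpace d, ℂ)) (p : ℝ≥0∞) :
    eLpNorm (stft f) p volume = eLpNorm (weighted (bargmann f)) p volume := by
  rw [← eLpNorm_comp_measurePreserving
    (continuous_weighted (differentiable_bargmann f).continuous).aestronglyMeasurable
    measurePreserving_phase]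
  exact eLpNorm_congr_norm_ae (Eventually.of_forall fun q => norm_stft f q)

theorem mem_modulation_iff {f : 𝓢'(RSpace d, ℂ)} {p : ℝ≥0∞} :
    f ∈ Modulation d p ↔ bargmann f ∈ fockSubmodule d p := by
  have h : f ∈ Modulation d p ↔ MemLp (stft f) p volume := Iff.rfl
  have h1 := (continuous_stft f).aestronglyMeasurable (μ := volume)
  have h2 := (continuous_weighted (differentiable_bargmann f).continuous).aestronglyMeasurable
    (μ := volume)
  rw [h, MemLp, eLpNorm_stft]
  exact ⟨fun h => ⟨differentiable_bargmann f, h2, h.2⟩, fun h => ⟨h1, h.2.2⟩⟩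

/-! ### Translations -/

/-- Translating an atom by a real vector gives another atom times the multiplier of $\beta_y$; this
alone makes $B$ intertwine $T_y$ and $\beta_y$. -/
theorem compSubConst_atom (y : RSpace d) (z : CSpace d) :
    SchwartzMap.compSubConstCLM ℂ (-y) (atom z) =
      (Complex.exp (-(Real.pi * ‖y‖ ^ 2 / 2 : ℝ)) * Complex.exp (Real.pi * cdot (toC y) z)) •
        atom (z - toC y) := by
  ext t
  rw [SchwartzMap.compSubConstCLM_apply, smul_apply, atom_apply, atom_apply, sub_neg_eq_add,
    toC_add, smul_eq_mul, mul_left_comm, ← Complex.exp_add, ← Complex.exp_add]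
  congr 2
  simp only [cdot_add, add_cdot, cdot_sub, sub_cdot]
  rw [cdot_comm (toC t) (toC y), cdot_comm z (toC y)]
  push_cast
  rw [← cdot_toC_self y]
  ring

theorem translate_apply (y : RSpace d) (f : 𝓢'(RSpace d, ℂ)) (g : 𝓢(RSpace d, ℂ)) :
    translate y f g = f (SchwartzMap.compSubConstCLM ℂ (-y) g) := rfl

theorem bargmann_translate (y : RSpace d) (f : 𝓢'(RSpace d, ℂ)) :
    bargmann (translate y f) = shiftFun y (bargmann f) := by
  funext z
  rw [bargmann, translate_apply, compSubConst_atom, map_smul, smul_eq_mul, shiftFun, bargmann]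

/-! ### The Bargmann transform of Schwartz functions -/

/-- A Schwartz function as a tempered distribution. -/
abbrev toTD (g : 𝓢(RSpace d, ℂ)) : 𝓢'(RSpace d, ℂ) :=
  SchwartzMap.toTemperedDistributionCLM (RSpace d) ℂ volume g

theorem bargmann_toTD (g : 𝓢(RSpace d, ℂ)) (z : CSpace d) :
    bargmann (toTD g) z = ∫ t, atom z t * g t :=
  SchwartzMap.toTemperedDistributionCLM_apply_apply volume g (atom z)

theorem integrable_atom_mul (g : 𝓢(RSpace d, ℂ)) (z : CSpace d) :
    Integrable fun t => atom z t * g t :=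
  (g.integrable (μ := volume)).bdd_mul (c := ‖windowConst d‖ * Real.exp (Real.pi / 2 * normSq z))
    (atom z).continuous.aestronglyMeasurable (Eventually.of_forall (norm_atom_le z))

theorem norm_weighted_bargmann_toTD_le (g : 𝓢(RSpace d, ℂ)) (z : CSpace d) :
    ‖weighted (bargmann (toTD g)) z‖ ≤ ‖windowConst d‖ * ∫ t, ‖g t‖ := by
  have h : ‖bargmann (toTD g) z‖ ≤
      ‖windowConst d‖ * Real.exp (Real.pi / 2 * normSq z) * ∫ t, ‖g t‖ := by
    rw [bargmann_toTD, ← integral_const_mul]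
    refine norm_integral_le_of_norm_le ((g.integrable (μ := volume)).norm.const_mul _)
      (Eventually.of_forall fun t => ?_)
    rw [norm_mul]
    gcongr
    exact norm_atom_le z t
  rw [norm_weighted]
  calc ‖bargmann (toTD g) z‖ * Real.exp (-(Real.pi / 2) * normSq z)
      ≤ ‖windowConst d‖ * Real.exp (Real.pi / 2 * normSq z) * (∫ t, ‖g t‖) *
        Real.exp (-(Real.pi / 2) * normSq z) := by gcongr
    _ = ‖windowConst d‖ * (∫ t, ‖g t‖) * (Real.exp (Real.pi / 2 * normSq z) *
        Real.exp (-(Real.pi / 2) * normSq z)) := by ring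
    _ = _ := by
      rw [← Real.exp_add]
      simp

/-- The product of two atoms is a Gaussian whose integral contributes
$e^{\frac{\pi}{2}(a+z)\cdot(a+z)}$; the prefactors remove the squares and leave the cross term $\pi
a\cdot z$. -/
theorem bargmann_atom (a z : CSpace d) : bargmann (toTD (atom a)) z = kernel a z := by
  have h : ∀ t, atom z t * atom a t = windowConst d * windowConst d *
      Complex.exp (-(Real.pi / 2 * (cdot a a + cdot z z))) *
      gaussSchwartz (2 * Real.pi) (by positivity) ((2 * Real.pi : ℂ) • (a + z)) t := by
    intro t
    change _ = _ * Complex.exp (gaussExponent _ _ t)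
    rw [gaussExponent_eq, atom_apply, atom_apply, mul_mul_mul_comm, ← Complex.exp_add,
      mul_assoc (windowConst d * windowConst d), ← Complex.exp_add, smul_cdot, add_cdot]
    congr 2
    push_cast
    ring
  rw [bargmann_toTD]
  simp_rw [h]
  rw [integral_const_mul, integral_gaussSchwartz]
  have h1 : ((Real.pi : ℂ) / ((2 * Real.pi : ℝ) : ℂ)) = 1 / 2 := by
    have : (Real.pi : ℂ) ≠ 0 := by simp [Real.pi_ne_zero]
    push_cast
    field_simp
  rw [h1, kernel]
  have h2 : ∀ W E G H : ℂ, W * E * (G * H) = W * G * (E * H) := fun W E G H => by ring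
  rw [h2, windowConst_mul_self, one_mul, ← Complex.exp_add]
  congr 1
  simp only [smul_cdot, cdot_smul, add_cdot, cdot_add, cdot_comm z a]
  have : (Real.pi : ℂ) ≠ 0 := by simp [Real.pi_ne_zero]
  push_cast
  field_simp
  ring

theorem bargmann_compSubConst (y : RSpace d) (g : 𝓢(RSpace d, ℂ)) (z : CSpace d) :
    bargmann (toTD (SchwartzMap.compSubConstCLM ℂ y g)) z =
      shiftFun y (bargmann (toTD g)) z := by
  rw [bargmann_toTD, shiftFun, bargmann_toTD, ← integral_const_mul,
    ← integral_add_right_eq_self _ y]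
  refine integral_congr_ae (Eventually.of_forall fun t => ?_)
  have h := congrArg (fun g : 𝓢(RSpace d, ℂ) => g t) (compSubConst_atom y z)
  simp only [SchwartzMap.compSubConstCLM_apply, smul_apply, sub_neg_eq_add, smul_eq_mul] at h
  simp only [SchwartzMap.compSubConstCLM_apply, add_sub_cancel_right]
  rw [h]
  ring

/-! ### Decay of the Bargmann transform of Schwartz functions -/

/-- The creation operator `t_j - (2π)⁻¹ ∂_j`, which the Bargmann transform turns into
multiplication by `z_j`. -/
def creation (j : Fin d) : 𝓢(RSpace d, ℂ) →L[ℂ] 𝓢(RSpace d, ℂ) :=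
  coordMul j - (2 * Real.pi : ℂ)⁻¹ •
    LineDeriv.lineDerivOpCLM ℂ 𝓢(RSpace d, ℂ) (EuclideanSpace.single j (1 : ℝ))

open scoped LineDeriv in
theorem creation_apply (j : Fin d) (g : 𝓢(RSpace d, ℂ)) (t : RSpace d) :
    creation j g t = t j * g t -
      (2 * Real.pi : ℂ)⁻¹ * ∂_{EuclideanSpace.single j (1 : ℝ)} g t := by
  rw [← coordMul_apply]
  rfl

open scoped LineDeriv in
theorem lineDerivOp_atom (j : Fin d) (z : CSpace d) (t : RSpace d) :
    ∂_{EuclideanSpace.single j (1 : ℝ)} (atom z) t = 2 * Real.pi * (z j - t j) * atom z t := by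
  rw [SchwartzMap.lineDerivOp_apply]
  have h1 : ∀ s : ℝ, atom z (t + s • EuclideanSpace.single j 1) =
      windowConst d * Complex.exp (-(Real.pi / 2 * cdot z z) - Real.pi * cdot (toC t) (toC t) +
        2 * Real.pi * cdot z (toC t) + (s : ℂ) * (2 * Real.pi * (z j - t j)) -
        Real.pi * (s : ℂ) ^ 2) := by
    intro s
    have he : toC (EuclideanSpace.single j (1 : ℝ) : RSpace d) = Pi.single j 1 := by
      funext i
      by_cases h : i = j
      · subst h; simp [toC]
      · simp [toC, h]
    have hc : ∀ v : CSpace d, cdot v (Pi.single j 1) = v j := fun v => by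
      simp [cdot, Pi.single_apply]
    rw [atom_apply, toC_add, toC_smul, he]
    congr 2
    simp only [cdot_add, add_cdot, cdot_smul, smul_cdot, cdot_comm (Pi.single j 1), hc]
    simp [toC]
    ring
  have h2 : HasDerivAt (fun s : ℝ => atom z (t + s • EuclideanSpace.single j 1))
      (2 * Real.pi * (z j - t j) * atom z t) 0 := by
    rw [funext h1, atom_apply]
    have hs : HasDerivAt (fun s : ℝ => (s : ℂ)) 1 0 := Complex.ofRealCLM.hasDerivAt
    have h3 := ((((hs.mul_const (2 * Real.pi * (z j - t j) : ℂ)).const_add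
      (-(Real.pi / 2 * cdot z z) - Real.pi * cdot (toC t) (toC t) +
        2 * Real.pi * cdot z (toC t))).sub ((hs.pow 2).const_mul (Real.pi : ℂ))).cexp).const_mul
      (windowConst d)
    refine h3.congr_deriv ?_
    simp
    ring
  exact h2.deriv

/-- Integration by parts: $\partial_j\mathrm{atom}_z=2\pi(z_j-t_j)\,\mathrm{atom}_z$, so the
derivative part of the creation operator replaces $t_j$ by $z_j$. -/
theorem bargmann_creation (j : Fin d) (g : 𝓢(RSpace d, ℂ)) (z : CSpace d) :
    bargmann (toTD (creation j g)) z = z j * bargmann (toTD g) z := by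
  open scoped LineDeriv in
  have hp := SchwartzMap.integral_mul_lineDerivOp_right_eq_neg_left (μ := volume) (atom z) g
    (EuclideanSpace.single j (1 : ℝ))
  have hpi : (2 * Real.pi : ℂ) ≠ 0 := by simp [Real.pi_ne_zero]
  simp_rw [lineDerivOp_atom] at hp
  have hi1 := integrable_atom_mul (coordMul j g) z
  have hi2 := integrable_atom_mul g z
  have hi3 := integrable_atom_mul
    (LineDeriv.lineDerivOpCLM ℂ 𝓢(RSpace d, ℂ) (EuclideanSpace.single j (1 : ℝ)) g) z
  simp only [coordMul_apply, LineDeriv.lineDerivOpCLM_apply] at hi1 hi3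
  rw [bargmann_toTD, bargmann_toTD]
  have h1 : ∀ t, atom z t * creation j g t = atom z t * (t j * g t) -
      (2 * Real.pi : ℂ)⁻¹ * (atom z t *
        (LineDeriv.lineDerivOp (EuclideanSpace.single j (1 : ℝ)) g : 𝓢(RSpace d, ℂ)) t) := by
    intro t
    rw [creation_apply]
    ring
  have h2 : ∀ t : RSpace d, 2 * Real.pi * (z j - t j) * atom z t * g t =
      2 * Real.pi * z j * (atom z t * g t) - 2 * Real.pi * (atom z t * (t j * g t)) := by
    intro t
    ring
  simp_rw [h1]
  rw [integral_sub hi1 (hi3.const_mul _), integral_const_mul, hp]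
  simp_rw [h2]
  rw [integral_sub (hi2.const_mul _) (hi1.const_mul _), integral_const_mul, integral_const_mul]
  field_simp
  ring

theorem bargmann_creation_iterate (j : Fin d) (n : ℕ) (g : 𝓢(RSpace d, ℂ)) (z : CSpace d) :
    bargmann (toTD ((creation j)^[n] g)) z = z j ^ n * bargmann (toTD g) z := by
  induction n with
  | zero => simp
  | succ n ih =>
    rw [Function.iterate_succ_apply', bargmann_creation, ih]
    ring

/-- The exponent of an integrable power of `(1 + ‖w‖)⁻¹` on `ℂ^d`. -/
def decayOrder (d : ℕ) : ℕ := Module.finrank ℝ (CSpace d) + 1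

/-- A continuous majorant for the decay of the Bargmann transform of a Schwartz function. -/
def decayNorm (g : 𝓢(RSpace d, ℂ)) : ℝ :=
  2 ^ decayOrder d * (‖windowConst d‖ * (‖g.toLp 1 volume‖ +
    ∑ j, ‖((creation j)^[decayOrder d] g).toLp 1 volume‖))

theorem continuous_decayNorm : Continuous (decayNorm : 𝓢(RSpace d, ℂ) → ℝ) := by
  have h : ∀ j : Fin d, Continuous fun g : 𝓢(RSpace d, ℂ) => (creation j)^[decayOrder d] g :=
    fun j => (creation j).continuous.iterate _
  have h2 : ∀ j : Fin d, Continuous fun g : 𝓢(RSpace d, ℂ) =>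
      ((creation j)^[decayOrder d] g).toLp 1 (volume : Measure (RSpace d)) :=
    fun j => continuous_toLp.comp (h j)
  unfold decayNorm
  fun_prop

theorem decayNorm_zero : decayNorm (0 : 𝓢(RSpace d, ℂ)) = 0 := by
  have h : ∀ j : Fin d, (creation j)^[decayOrder d] 0 = 0 := fun j =>
    Function.iterate_fixed (map_zero _) _
  have h0 : ‖(0 : 𝓢(RSpace d, ℂ)).toLp 1 volume‖ = 0 := by
    rw [norm_toLp_one]
    simp
  rw [decayNorm]
  simp only [h, h0]
  simp

/-- An integrable weight on `ℂ^d`. -/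
def decayWeight (w : CSpace d) : ℝ := ((1 + ‖w‖) ^ decayOrder d)⁻¹

theorem integrable_decayWeight : Integrable (decayWeight : CSpace d → ℝ) := by
  have h := integrable_one_add_norm (E := CSpace d) (μ := volume) (r := (decayOrder d : ℝ))
    (by simp only [decayOrder]; push_cast; linarith)
  refine h.congr (Eventually.of_forall fun w => ?_)
  change (1 + ‖w‖) ^ (-(decayOrder d : ℝ)) = decayWeight w
  rw [Real.rpow_neg (by positivity), Real.rpow_natCast, decayWeight]

theorem one_add_norm_pow_le (z : CSpace d) {n : ℕ} (hn : n ≠ 0) :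
    (1 + ‖z‖) ^ n ≤ 2 ^ n * (1 + ∑ j, ‖z j‖ ^ n) := by
  have h1 : ‖z‖ ^ n ≤ ∑ j, ‖z j‖ ^ n := by
    rcases isEmpty_or_nonempty (Fin d) with h | h
    · have : z = 0 := Subsingleton.elim _ _
      simp [this, hn]
    · obtain ⟨j, hj⟩ := Finite.exists_max fun j => ‖z j‖
      have : ‖z‖ ≤ ‖z j‖ := (pi_norm_le_iff_of_nonneg (norm_nonneg _)).2 hj
      calc ‖z‖ ^ n ≤ ‖z j‖ ^ n := by gcongr
        _ ≤ _ := Finset.single_le_sum (f := fun j => ‖z j‖ ^ n) (fun i _ => by positivity)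
          (Finset.mem_univ j)
  have h0 : 0 ≤ ∑ j, ‖z j‖ ^ n := Finset.sum_nonneg fun i _ => by positivity
  rcases le_total ‖z‖ 1 with h | h
  · calc (1 + ‖z‖) ^ n ≤ 2 ^ n := by
          gcongr
          linarith
      _ ≤ _ := le_mul_of_one_le_right (by positivity) (by linarith)
  · calc (1 + ‖z‖) ^ n ≤ (2 * ‖z‖) ^ n := by
          gcongr
          linarith
      _ = 2 ^ n * ‖z‖ ^ n := mul_pow _ _ _
      _ ≤ _ := by
          gcongr
          linarith

/-- The crude $L^1$ bound, applied to iterated creation operators on $g$, bounds $|z_j|^N$ times the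
weighted transform for each $j$. The order $N$ is large enough for integrability, and the constant
depends continuously on $g$, as the continuity of `invBargmann` requires. -/
theorem norm_weighted_bargmann_le (g : 𝓢(RSpace d, ℂ)) (z : CSpace d) :
    ‖weighted (bargmann (toTD g)) z‖ ≤ decayNorm g * decayWeight z := by
  have h1 : ∀ j, ‖z j‖ ^ decayOrder d * ‖weighted (bargmann (toTD g)) z‖ ≤
      ‖windowConst d‖ * ‖((creation j)^[decayOrder d] g).toLp 1 volume‖ := by
    intro j
    have h := norm_weighted_bargmann_toTD_le ((creation j)^[decayOrder d] g) z
    rw [norm_weighted, bargmann_creation_iterate, norm_mul, norm_pow, ← norm_toLp_one,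
      mul_assoc] at h
    rwa [norm_weighted]
  have h0 := norm_weighted_bargmann_toTD_le g z
  rw [← norm_toLp_one] at h0
  rw [decayWeight, ← div_eq_mul_inv, le_div_iff₀ (by positivity)]
  calc ‖weighted (bargmann (toTD g)) z‖ * (1 + ‖z‖) ^ decayOrder d
      ≤ ‖weighted (bargmann (toTD g)) z‖ * (2 ^ decayOrder d * (1 + ∑ j, ‖z j‖ ^ decayOrder d)) := by
        gcongr
        exact one_add_norm_pow_le z (Nat.succ_ne_zero _)
    _ = 2 ^ decayOrder d * (‖weighted (bargmann (toTD g)) z‖ +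
          ∑ j, ‖z j‖ ^ decayOrder d * ‖weighted (bargmann (toTD g)) z‖) := by
        rw [← Finset.sum_mul]
        ring
    _ ≤ 2 ^ decayOrder d * (‖windowConst d‖ * ‖g.toLp 1 volume‖ +
          ∑ j, ‖windowConst d‖ * ‖((creation j)^[decayOrder d] g).toLp 1 volume‖) := by
        exact mul_le_mul_of_nonneg_left (add_le_add h0 (Finset.sum_le_sum fun j _ => h1 j))
          (by positivity)
    _ = _ := by
        rw [decayNorm, ← Finset.mul_sum]
        ring

theorem bargmann_toTD_mem_one (g : 𝓢(RSpace d, ℂ)) :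
    bargmann (toTD g) ∈ fockSubmodule d 1 := by
  refine ⟨differentiable_bargmann _, memLp_one_iff_integrable.2 ?_⟩
  exact (integrable_decayWeight.const_mul (decayNorm g)).mono'
    (continuous_weighted (differentiable_bargmann _).continuous).aestronglyMeasurable
    (Eventually.of_forall (norm_weighted_bargmann_le g))

/-! ### The inverse Bargmann transform -/

section Inverse

variable {p : ℝ≥0∞} [hp : Fact (1 ≤ p)]

theorem measurableEmbedding_star : MeasurableEmbedding (star : CSpace d → CSpace d) :=
  (MeasurableEquiv.ofInvolutive star star_involutive
    continuous_star.measurable).measurableEmbedding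

theorem norm_bargmann_pairing (F G : CSpace d → ℂ) (w : CSpace d) :
    ‖F w * gaussWeight w * G (star w)‖ = ‖weighted F w‖ * ‖weighted G (star w)‖ := by
  rw [norm_mul, norm_mul, norm_weighted, norm_weighted, norm_gaussWeight, normSq_star]
  have : Real.exp (-Real.pi * normSq w) = Real.exp (-(Real.pi / 2) * normSq w) *
      Real.exp (-(Real.pi / 2) * normSq w) := by
    rw [← Real.exp_add]
    ring_nf
  rw [this]
  ring

theorem norm_bargmann_pairing_le {F : CSpace d → ℂ} {M : ℝ} (hM : ∀ w, ‖weighted F w‖ ≤ M)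
    (g : 𝓢(RSpace d, ℂ)) (w : CSpace d) :
    ‖F w * gaussWeight w * bargmann (toTD g) (star w)‖ ≤ M * decayNorm g * decayWeight w := by
  rw [norm_bargmann_pairing]
  have h := norm_weighted_bargmann_le g (star w)
  have h2 : decayWeight (star w) = decayWeight w := by rw [decayWeight, norm_star, decayWeight]
  rw [h2] at h
  have hM0 : 0 ≤ M := (norm_nonneg _).trans (hM w)
  rw [mul_assoc]
  exact mul_le_mul (hM w) h (norm_nonneg _) hM0

theorem integrable_bargmann_pairing (F : FockSpace d p) (g : 𝓢(RSpace d, ℂ)) :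
    Integrable fun w => F w * gaussWeight w * bargmann (toTD g) (star w) := by
  obtain ⟨M, -, hM⟩ := exists_weighted_bound hp.out F.2
  have hF : Continuous (F : CSpace d → ℂ) := F.2.1.continuous
  have hb := (differentiable_bargmann (toTD g)).continuous
  have hc : Continuous fun w : CSpace d => F w * gaussWeight w * bargmann (toTD g) (star w) :=
    (hF.mul continuous_gaussWeight).mul (hb.comp continuous_star)
  exact (integrable_decayWeight.const_mul (M * decayNorm g)).mono' hc.aestronglyMeasurable
    (Eventually.of_forall (norm_bargmann_pairing_le hM g))

/-- The inverse Bargmann transform `⟨B⁻¹F, g⟩ = ∫ F(w) (Bg)(w̄) e^{-π|w|²} dw`. -/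
def invBargmann (F : FockSpace d p) : 𝓢'(RSpace d, ℂ) :=
  ContinuousLinearMap.toPointwiseConvergenceCLM _ _ _ _
    { toFun := fun g => ∫ w, F w * gaussWeight w * bargmann (toTD g) (star w)
      map_add' := fun g h => by
        rw [← integral_add (integrable_bargmann_pairing F g) (integrable_bargmann_pairing F h)]
        refine integral_congr_ae (Eventually.of_forall fun w => ?_)
        simp only [toTD, map_add, bargmann_add, Pi.add_apply]
        ring
      map_smul' := fun c g => by
        rw [RingHom.id_apply, smul_eq_mul, ← integral_const_mul]
        refine integral_congr_ae (Eventually.of_forall fun w => ?_)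
        simp only [toTD, map_smul, bargmann_smul, Pi.smul_apply, smul_eq_mul]
        ring
      cont := by
        obtain ⟨M, hM0, hM⟩ := exists_weighted_bound hp.out F.2
        -- For an additive map continuity at $0$ suffices, and there the bound by `decayNorm` tends
        -- to $0$.
        let L : 𝓢(RSpace d, ℂ) →+ ℂ := AddMonoidHom.mk'
          (fun g => ∫ w, F w * gaussWeight w * bargmann (toTD g) (star w)) fun g h => by
            rw [← integral_add (integrable_bargmann_pairing F g) (integrable_bargmann_pairing F h)]
            refine integral_congr_ae (Eventually.of_forall fun w => ?_)
            simp only [toTD, map_add, bargmann_add, Pi.add_apply]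
            ring
        have hL : ∀ g, ‖L g‖ ≤ M * decayNorm g * ∫ w : CSpace d, decayWeight w := by
          intro g
          rw [← integral_const_mul]
          exact norm_integral_le_of_norm_le
            (integrable_decayWeight.const_mul (M * decayNorm g))
            (Eventually.of_forall (norm_bargmann_pairing_le hM g))
        refine continuous_of_continuousAt_zero L ?_
        rw [ContinuousAt, map_zero]
        refine squeeze_zero_norm hL ?_
        have hc : Continuous fun g : 𝓢(RSpace d, ℂ) =>
            M * decayNorm g * ∫ w : CSpace d, decayWeight w := by
          have := continuous_decayNorm (d := d)
          fun_prop
        have := hc.tendsto 0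
        rwa [decayNorm_zero, mul_zero, zero_mul] at this }

theorem invBargmann_apply (F : FockSpace d p) (g : 𝓢(RSpace d, ℂ)) :
    invBargmann F g = ∫ w, F w * gaussWeight w * bargmann (toTD g) (star w) := rfl

/-- Tested on an atom, the pairing contains $B(\mathrm{atom}_z)(\bar w)=e^{\pi\bar w\cdot z}$, so
the claim is the reproducing formula. -/
theorem bargmann_invBargmann (F : FockSpace d p) : bargmann (invBargmann F) = F := by
  funext z
  rw [bargmann, invBargmann_apply,
    ← reproducing F.2.1 (integrable_reproducing hp.out F.2.1.continuous F.2.2 z)]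
  refine integral_congr_ae (Eventually.of_forall fun w => ?_)
  simp only [bargmann_atom, kernel_comm z]
  ring

theorem invBargmann_mem (F : FockSpace d p) : invBargmann F ∈ Modulation d p := by
  rw [mem_modulation_iff, bargmann_invBargmann]
  exact F.2

theorem invBargmann_add (F G : FockSpace d p) :
    invBargmann (F + G) = invBargmann F + invBargmann G := by
  ext g
  change invBargmann (F + G) g = invBargmann F g + invBargmann G g
  rw [invBargmann_apply, invBargmann_apply, invBargmann_apply,
    ← integral_add (integrable_bargmann_pairing F g) (integrable_bargmann_pairing G g)]
  refine integral_congr_ae (Eventually.of_forall fun w => ?_)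
  simp only [FockSpace.add_apply]
  ring

theorem invBargmann_smul (c : ℂ) (F : FockSpace d p) :
    invBargmann (c • F) = c • invBargmann F := by
  ext g
  change invBargmann (c • F) g = c * invBargmann F g
  rw [invBargmann_apply, invBargmann_apply, ← integral_const_mul]
  refine integral_congr_ae (Eventually.of_forall fun w => ?_)
  simp only [FockSpace.smul_apply]
  ring

/-- The substitution $w\mapsto w+y$ moves the shift from $F$ to $Bg$; the exponents match because
$|w+y|^2=|w|^2+y\cdot w+y\cdot\bar w+|y|^2$ for real $y$. -/
theorem invBargmann_fockShift (y : RSpace d) (F : FockSpace d p) :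
    invBargmann (fockShift y F) = translate y (invBargmann F) := by
  ext g
  change invBargmann (fockShift y F) g = invBargmann F (SchwartzMap.compSubConstCLM ℂ (-y) g)
  rw [invBargmann_apply, invBargmann_apply, ← integral_add_right_eq_self _ (toC y)]
  refine integral_congr_ae (Eventually.of_forall fun w => ?_)
  have h1 : fockShift y F (w + toC y) = Complex.exp (-(Real.pi * ‖y‖ ^ 2 / 2 : ℝ)) *
      Complex.exp (Real.pi * cdot (toC y) (w + toC y)) * F (w + toC y - toC y) := rfl
  have hn : (normSq (w + toC y) : ℂ) = normSq w + cdot (toC y) w + cdot (toC y) (star w) +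
      (‖y‖ : ℂ) ^ 2 := by
    have hr : (2 * (cdot (toC y) w).re : ℂ) = cdot (toC y) w + cdot (toC y) (star w) := by
      have : cdot (toC y) (star w) = conj (cdot (toC y) w) := by simp [cdot, toC]
      rw [this, Complex.add_conj]
      push_cast
      ring
    have hy : normSq (toC y) = ‖y‖ ^ 2 := by
      rw [EuclideanSpace.norm_sq_eq]
      simp [normSq, toC]
    have hs : (cdot (star w) (toC y)).re = (cdot (toC y) w).re := by
      rw [re_cdot_star, star_toC, cdot_comm]
    rw [normSq_add, hy, hs, Complex.ofReal_add, Complex.ofReal_add, Complex.ofReal_mul,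
      Complex.ofReal_ofNat, hr, Complex.ofReal_pow]
    ring
  simp only [bargmann_compSubConst, shiftFun, h1, toC_neg, sub_neg_eq_add, star_add, star_toC,
    add_sub_cancel_right, gaussWeight, norm_neg]
  have hexp : Complex.exp (Real.pi * cdot (toC y) (w + toC y)) *
      Complex.exp (-(Real.pi * normSq (w + toC y) : ℝ)) =
      Complex.exp (-(Real.pi * normSq w : ℝ)) *
      Complex.exp (Real.pi * cdot (-toC y) (star w)) := by
    rw [← Complex.exp_add, ← Complex.exp_add]
    congr 1
    push_cast
    rw [hn, cdot_add, neg_cdot, cdot_toC_self]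
    ring
  linear_combination (Complex.exp (-(Real.pi * ‖y‖ ^ 2 / 2 : ℝ)) * F w *
    bargmann (toTD g) (star w + toC y)) * hexp

/-- After conjugating the variable, the pairing is the reproducing formula for $Bg\in\mathcal F^1$
at $a$. It identifies the kernels with Schwartz functions, on which the hypothesis $Af=u*f$ can be
used. -/
theorem invBargmann_kernel (a : CSpace d) :
    invBargmann (FockSpace.kernel a : FockSpace d p) = toTD (atom a) := by
  ext g
  have h := bargmann_toTD_mem_one g
  have h1 : invBargmann (FockSpace.kernel a : FockSpace d p) g = bargmann (toTD g) a := by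
    rw [invBargmann_apply,
      ← reproducing h.1 (integrable_reproducing le_rfl h.1.continuous h.2 a),
      ← measurePreserving_star.integral_comp measurableEmbedding_star]
    refine integral_congr_ae (Eventually.of_forall fun w => ?_)
    simp only [FockSpace.kernel_apply, gaussWeight_star, star_star, kernel_comm a]
    ring
  rw [h1, bargmann_toTD]
  refine Eq.trans ?_ (toTemperedDistributionCLM_apply_apply volume (atom a) g).symm
  refine integral_congr_ae (Eventually.of_forall fun t => ?_)
  exact mul_comm _ _

end Inverse

/-- The Bargmann transform as a linear map of `M^p(ℝ^d)` to `F^p(ℂ^d)`. -/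
def bargmannMap (p : ℝ≥0∞) : Modulation d p →ₗ[ℂ] FockSpace d p where
  toFun f := FockSpace.mk (bargmann f) (mem_modulation_iff.1 f.2)
  map_add' _ _ := rfl
  map_smul' _ _ := rfl

/-- The inverse Bargmann transform as a linear map of `F^p(ℂ^d)` to `M^p(ℝ^d)`. -/
def invBargmannMap (p : ℝ≥0∞) [Fact (1 ≤ p)] : FockSpace d p →ₗ[ℂ] Modulation d p where
  toFun F := ⟨invBargmann F, invBargmann_mem F⟩
  map_add' F G := Subtype.ext (invBargmann_add F G)
  map_smul' c F := Subtype.ext (invBargmann_smul c F)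

/-- This one-sided relation is enough to transport operators both ways with their bounds;
$B^{-1}B=\mathrm{id}$ on all of $M^p$ is not needed. -/
theorem bargmannMap_invBargmannMap {p : ℝ≥0∞} [Fact (1 ≤ p)] (F : FockSpace d p) :
    bargmannMap p (invBargmannMap p F) = F :=
  FockSpace.ext fun z => congrFun (bargmann_invBargmann F) z

theorem modNorm_eq {p : ℝ≥0∞} [Fact (1 ≤ p)] (f : Modulation d p) :
    modNorm f = ‖bargmannMap p f‖ := by
  rw [modNorm, eLpNorm_stft, FockSpace.norm_def]
  rfl

theorem bargmannMap_modTranslate {p : ℝ≥0∞} (y : RSpace d) (f : Modulation d p) :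
    bargmannMap p (modTranslate y f) = fockShift y (bargmannMap p f) :=
  FockSpace.ext fun z => congrFun (bargmann_translate y f) z

theorem invBargmannMap_fockShift {p : ℝ≥0∞} [Fact (1 ≤ p)] (y : RSpace d) (F : FockSpace d p) :
    invBargmannMap p (fockShift y F) = modTranslate y (invBargmannMap p F) :=
  Subtype.ext (invBargmann_fockShift y F)

/-! ### Convolution of Gaussian atoms -/

/-- Convolution of complex-valued Schwartz functions. -/
abbrev schwartzConv (f g : 𝓢(RSpace d, ℂ)) : 𝓢(RSpace d, ℂ) :=
  SchwartzMap.convolution (ContinuousLinearMap.mul ℂ ℂ) f g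

theorem schwartzConv_apply (f g : 𝓢(RSpace d, ℂ)) (s : RSpace d) :
    schwartzConv f g s = ∫ t, f t * g (s - t) :=
  SchwartzMap.convolution_apply _ f g s

theorem conv_apply (u : 𝓢'(RSpace d, ℂ)) (f g : 𝓢(RSpace d, ℂ)) :
    conv u f g = u (schwartzConv (reflect f) g) := rfl

theorem reflect_apply (f : 𝓢(RSpace d, ℂ)) (t : RSpace d) : reflect f t = f (-t) := rfl

theorem reflect_atom (a : CSpace d) : reflect (atom a) = atom (-a) := by
  ext t
  rw [reflect_apply, atom_apply, atom_apply, toC_neg]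
  simp only [cdot_neg, neg_cdot, neg_neg]

/-- Convolution halves the exponent of the Gaussian, from $\pi$ to $\pi/2$; this is the origin of
$e^{-\pi|y|^2/2}$ in $\phi_u$. -/
theorem schwartzConv_atom (a b : CSpace d) :
    schwartzConv (atom a) (atom b) = kernel (-a) b •
      gaussSchwartz (Real.pi / 2) Real.pi_div_two_pos ((Real.pi : ℂ) • (a + b)) := by
  ext s
  have h : ∀ t, atom a t * atom b (s - t) = windowConst d * windowConst d *
      Complex.exp (-(Real.pi / 2 * (cdot a a + cdot b b)) - Real.pi * cdot (toC s) (toC s) +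
        2 * Real.pi * cdot b (toC s)) *
      gaussSchwartz (2 * Real.pi) (by positivity) ((2 * Real.pi : ℂ) • (a - b + toC s)) t := by
    intro t
    change _ = _ * Complex.exp (gaussExponent _ _ t)
    rw [gaussExponent_eq, atom_apply, atom_apply, mul_mul_mul_comm, ← Complex.exp_add,
      mul_assoc (windowConst d * windowConst d), ← Complex.exp_add, smul_cdot, toC_sub]
    simp only [cdot_sub, sub_cdot, add_cdot]
    rw [cdot_comm (toC t) (toC s)]
    congr 2
    push_cast
    ring
  rw [schwartzConv_apply, smul_apply, smul_eq_mul]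
  change _ = _ * Complex.exp (gaussExponent _ _ s)
  simp_rw [h]
  rw [integral_const_mul, integral_gaussSchwartz]
  have h1 : ((Real.pi : ℂ) / ((2 * Real.pi : ℝ) : ℂ)) = 1 / 2 := by
    have : (Real.pi : ℂ) ≠ 0 := by simp [Real.pi_ne_zero]
    push_cast
    field_simp
  have h2 : ∀ W E G H : ℂ, W * E * (G * H) = W * G * (E * H) := fun W E G H => by ring
  rw [h1, h2, windowConst_mul_self, one_mul, kernel, ← Complex.exp_add, ← Complex.exp_add,
    gaussExponent_eq]
  congr 1
  simp only [smul_cdot, cdot_smul, add_cdot, cdot_add, sub_cdot, cdot_sub, neg_cdot,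
    cdot_comm b a, cdot_comm (toC s) a, cdot_comm (toC s) b]
  have : (Real.pi : ℂ) ≠ 0 := by simp [Real.pi_ne_zero]
  push_cast
  field_simp
  ring

/-- With $a=\bar w$ the right-hand side is the integral kernel of $S_u$. -/
theorem bargmann_conv_atom (u : 𝓢'(RSpace d, ℂ)) (a z : CSpace d) :
    bargmann (conv u (atom a)) z = kernel a z * symbol u (a - z) := by
  have h : (fun j => -Real.pi * (a - z) j : CSpace d) = (Real.pi : ℂ) • (-a + z) := by
    funext j
    simp
    ring
  rw [bargmann, conv_apply, reflect_atom, schwartzConv_atom, map_smul, neg_neg, smul_eq_mul,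
    symbol, h]

/-! ### Operators given by their action on the kernels -/

section Operators

variable {p : ℝ≥0∞} [hp : Fact (1 ≤ p)]

/-- The functional $F\mapsto SF(z)$ passes through the superposition of kernels representing
$F\in\mathcal F^1$, which also yields absolute convergence. -/
theorem integral_of_apply_kernel {S : FockSpace d p →L[ℂ] FockSpace d p} {φ : CSpace d → ℂ}
    (h : ∀ a z, S (FockSpace.kernel a) z = kernel a z * φ (a - z)) {F : CSpace d → ℂ}
    (hF : F ∈ fockSubmodule d 1) (z : CSpace d) :
    Integrable (fockIntegrand φ F z) ∧
      S (FockSpace.mk F (fockSubmodule_one_le hp.out hF)) z = fockIntegral φ F z := by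
  obtain ⟨h1, h2⟩ := FockSpace.apply_eq_integral ((FockSpace.eval z).comp S) hF
  have he : (fun w => F w * gaussWeight w *
      ((FockSpace.eval z).comp S) (FockSpace.kernel (star w))) = fockIntegrand φ F z := by
    funext w
    rw [ContinuousLinearMap.comp_apply, FockSpace.eval_apply, h, fockIntegrand, kernel, gaussWeight]
    ring
  rw [he] at h1 h2
  exact ⟨h1, h2.symm⟩

theorem extends_of_apply_kernel {S : FockSpace d p →L[ℂ] FockSpace d p} {φ : CSpace d → ℂ}
    (h : ∀ a z, S (FockSpace.kernel a) z = kernel a z * φ (a - z)) : Extends S φ :=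
  fun _ hF => ⟨fockSubmodule_one_le hp.out hF, fun z => (integral_of_apply_kernel h hF z).2⟩

theorem eq_of_extends (hp' : p ≠ ∞) {S S' : FockSpace d p →L[ℂ] FockSpace d p}
    {φ : CSpace d → ℂ} (hS : Extends S φ) (hS' : Extends S' φ) : S' = S := by
  refine ContinuousLinearMap.coeFn_injective
    (S'.continuous.ext_on (dense_fockSubmodule_one hp') S.continuous fun F hF => ?_)
  obtain ⟨h1, h2⟩ := hS F hF
  obtain ⟨h3, h4⟩ := hS' F hF
  exact FockSpace.ext fun z => (h4 z).trans (h2 z).symm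

/-- The operator is $BAB^{-1}$; on $K_a=B(\mathrm{atom}_a)$ it is computed from
$A\,\mathrm{atom}_a=u*\mathrm{atom}_a$. -/
theorem exists_fock_operator_of_mem_convolutors {u : 𝓢'(RSpace d, ℂ)} (hu : u ∈ convolutors d p) :
    ∃ S : FockSpace d p →L[ℂ] FockSpace d p, TranslationInvariant S ∧
      ∀ a z, S (FockSpace.kernel a) z = kernel a z * symbol u (a - z) := by
  obtain ⟨A, ⟨C, hC⟩, hT, hu⟩ := hu
  refine ⟨(bargmannMap p ∘ₗ A ∘ₗ invBargmannMap p).mkContinuous C fun F => ?_, fun y F => ?_,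
    fun a z => ?_⟩
  · have h := hC (invBargmannMap p F)
    rwa [modNorm_eq, modNorm_eq, bargmannMap_invBargmannMap] at h
  · simp only [LinearMap.mkContinuous_apply, LinearMap.comp_apply, invBargmannMap_fockShift, hT,
      bargmannMap_modTranslate]
  · obtain ⟨hf, hA⟩ := hu (atom a)
    have h1 : invBargmannMap p (FockSpace.kernel a) = ⟨_, hf⟩ :=
      Subtype.ext (invBargmann_kernel a)
    rw [LinearMap.mkContinuous_apply, LinearMap.comp_apply, LinearMap.comp_apply, h1,
      ← bargmann_conv_atom, ← hA]
    rfl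

theorem convolutors_fock_operator (hp' : p ≠ ∞) {u : 𝓢'(RSpace d, ℂ)}
    (hu : u ∈ convolutors d p) :
    (∀ F ∈ fockSubmodule d 1, (∀ z, Integrable (fockIntegrand (symbol u) F z)) ∧
      fockIntegral (symbol u) F ∈ fockSubmodule d ∞) ∧
    ∃ S : FockSpace d p →L[ℂ] FockSpace d p, Extends S (symbol u) ∧ TranslationInvariant S ∧
      ∀ S' : FockSpace d p →L[ℂ] FockSpace d p, Extends S' (symbol u) → S' = S := by
  obtain ⟨S, hT, hS⟩ := exists_fock_operator_of_mem_convolutors hu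
  have hE := extends_of_apply_kernel hS
  refine ⟨fun F hF => ⟨fun z => (integral_of_apply_kernel hS hF z).1, ?_⟩, S, hE, hT,
    fun S' hS' => eq_of_extends hp' hE hS'⟩
  obtain ⟨h1, h2⟩ := hE F hF
  rw [← funext h2]
  exact fockSubmodule_le_top hp.out (S (FockSpace.mk F h1)).2

end Operators

/-! ### The inversion formula -/

open scoped FourierTransform in
-- At $z=-iw$ with $w$ real, an atom is a constant times the character $e^{-2\pi iw\cdot t}$ times
-- $\mathrm{atom}_0$. The hypothesis therefore kills the Fourier transform of $\mathrm{atom}_0\,k$,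
-- and $\mathrm{atom}_0$ has no zeros.
theorem eq_zero_of_integral_atom_mul {k : RSpace d → ℂ} (hk : Continuous k) {M : ℝ}
    (hM : ∀ s, ‖k s‖ ≤ M) (h : ∀ z, ∫ t, atom z t * k t = 0) : k = 0 := by
  set m : RSpace d → ℂ := fun t => atom 0 t * k t
  have hmc : Continuous m := (atom 0).continuous.mul hk
  have hmi : Integrable m :=
    ((atom 0).integrable (μ := volume)).mul_bdd (c := M) hk.aestronglyMeasurable
      (Eventually.of_forall hM)
  have hF : 𝓕 m = 0 := by
    funext w
    have hz := h (-Complex.I • toC w)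
    have he : ∀ t, atom (-Complex.I • toC w) t * k t =
        Complex.exp (-(Real.pi / 2 * cdot (-Complex.I • toC w) (-Complex.I • toC w))) *
          (Complex.exp (((-2 * Real.pi * inner ℝ t w : ℝ) : ℂ) * Complex.I) • m t) := by
      intro t
      have h1 : cdot (-Complex.I • toC w) (toC t) = -Complex.I * (inner ℝ t w : ℝ) := by
        rw [smul_cdot, cdot_toC_toC, real_inner_comm]
      have h2 : atom (-Complex.I • toC w) t =
          Complex.exp (-(Real.pi / 2 * cdot (-Complex.I • toC w) (-Complex.I • toC w))) *
            (Complex.exp (((-2 * Real.pi * inner ℝ t w : ℝ) : ℂ) * Complex.I) * atom 0 t) := by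
        rw [atom_apply, atom_apply, h1, mul_left_comm (Complex.exp _) (windowConst d),
          mul_left_comm (Complex.exp _) (windowConst d), ← Complex.exp_add, ← Complex.exp_add]
        congr 2
        simp only [zero_cdot]
        push_cast
        ring
      rw [h2, smul_eq_mul]
      simp only [m]
      ring
    simp_rw [he] at hz
    rw [integral_const_mul] at hz
    rw [Real.fourier_eq', Pi.zero_apply]
    exact (mul_eq_zero.1 hz).resolve_left (Complex.exp_ne_zero _)
  have hinv := hmc.fourierInv_fourier_eq hmi (by rw [hF]; exact integrable_zero _ _ _)
  have h0 : m = 0 := by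
    rw [← hinv, hF]
    funext w
    rw [Real.fourierInv_eq']
    simp
  funext t
  have ht : atom 0 t * k t = 0 := congrFun h0 t
  refine (mul_eq_zero.1 ht).resolve_left ?_
  rw [atom_apply]
  exact mul_ne_zero (windowConst_ne_zero d) (Complex.exp_ne_zero _)

theorem continuous_atom_apply :
    Continuous fun q : RSpace d × CSpace d => atom (star q.2) q.1 := by
  simp_rw [atom_apply]
  fun_prop

theorem integral_norm_atom (z : CSpace d) :
    ∫ s, ‖atom z s‖ = Real.exp (Real.pi / 2 * normSq z) * ∫ s : RSpace d, ‖atom 0 s‖ := by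
  rw [← integral_const_mul, ← integral_add_right_eq_self _ (reC z)]
  refine integral_congr_ae (Eventually.of_forall fun s => ?_)
  have h0 : reC (0 : CSpace d) = 0 := by
    ext j
    simp
  simp only [norm_atom_apply, add_sub_cancel_right, normSq_zero, mul_zero, Real.exp_zero, h0,
    sub_zero]
  ring

/-- The superposition `∫ F(w) e^{-π|w|²} atom(w̄) dw` of Gaussian atoms. -/
def synthesis (F : CSpace d → ℂ) (s : RSpace d) : ℂ :=
  ∫ w, F w * gaussWeight w * atom (star w) s

theorem norm_synthesis_integrand_le (F : CSpace d → ℂ) (s : RSpace d) (w : CSpace d) :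
    ‖F w * gaussWeight w * atom (star w) s‖ ≤ ‖windowConst d‖ * ‖weighted F w‖ := by
  have h := norm_atom_le (star w) s
  rw [norm_mul, norm_mul, norm_gaussWeight, norm_weighted]
  rw [normSq_star] at h
  calc ‖F w‖ * Real.exp (-Real.pi * normSq w) * ‖atom (star w) s‖
      ≤ ‖F w‖ * Real.exp (-Real.pi * normSq w) *
        (‖windowConst d‖ * Real.exp (Real.pi / 2 * normSq w)) := by gcongr
    _ = ‖windowConst d‖ * (‖F w‖ * (Real.exp (-Real.pi * normSq w) *
        Real.exp (Real.pi / 2 * normSq w))) := by ring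
    _ = _ := by
      rw [← Real.exp_add]
      ring_nf

theorem continuous_synthesis_integrand {F : CSpace d → ℂ} (hF : Continuous F) :
    Continuous fun q : RSpace d × CSpace d => F q.2 * gaussWeight q.2 * atom (star q.2) q.1 :=
  ((hF.comp continuous_snd).mul (continuous_gaussWeight.comp continuous_snd)).mul
    continuous_atom_apply

theorem continuous_synthesis {F : CSpace d → ℂ} (hF : F ∈ fockSubmodule d 1) :
    Continuous (synthesis F) := by
  have hc := continuous_synthesis_integrand hF.1.continuous
  refine continuous_of_dominated (bound := fun w => ‖windowConst d‖ * ‖weighted F w‖)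
    (fun s => (hc.comp (Continuous.prodMk_right s)).aestronglyMeasurable)
    (fun s => Eventually.of_forall (norm_synthesis_integrand_le F s))
    ((memLp_one_iff_integrable.1 hF.2).norm.const_mul _)
    (Eventually.of_forall fun w => hc.comp (Continuous.prodMk_left w))

theorem norm_synthesis_le {F : CSpace d → ℂ} (hF : F ∈ fockSubmodule d 1) (s : RSpace d) :
    ‖synthesis F s‖ ≤ ∫ w, ‖windowConst d‖ * ‖weighted F w‖ :=
  norm_integral_le_of_norm_le ((memLp_one_iff_integrable.1 hF.2).norm.const_mul _)
    (Eventually.of_forall (norm_synthesis_integrand_le F s))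

/-- Integrating first in $s$, the $L^1$ norm of the atom at $\bar w$ is a constant times
$e^{\pi|w|^2/2}$, which leaves the weighted $F\in L^1$. -/
theorem integrable_synthesis_integrand {F : CSpace d → ℂ} (hF : F ∈ fockSubmodule d 1)
    {k : RSpace d → ℂ} (hk : Continuous k) {M : ℝ} (hM : ∀ s, ‖k s‖ ≤ M) :
    Integrable (fun q : RSpace d × CSpace d =>
      k q.1 * (F q.2 * gaussWeight q.2 * atom (star q.2) q.1)) (volume.prod volume) := by
  have hc : Continuous fun q : RSpace d × CSpace d =>
      k q.1 * (F q.2 * gaussWeight q.2 * atom (star q.2) q.1) :=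
    (hk.comp continuous_fst).mul (continuous_synthesis_integrand hF.1.continuous)
  have hm := hc.aestronglyMeasurable (μ := volume.prod volume)
  have ha : ∀ w : CSpace d, Integrable fun s => ‖atom (star w) s‖ := fun w =>
    ((atom (star w)).integrable (μ := volume)).norm
  have hle : ∀ (w : CSpace d) (s : RSpace d),
      ‖k s * (F w * gaussWeight w * atom (star w) s)‖ ≤
        M * (‖F w‖ * Real.exp (-Real.pi * normSq w)) * ‖atom (star w) s‖ := by
    intro w s
    rw [norm_mul, norm_mul, norm_mul, norm_gaussWeight, mul_assoc M]
    gcongr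
    exact hM s
  have hi : ∀ w : CSpace d, Integrable fun s =>
      k s * (F w * gaussWeight w * atom (star w) s) := fun w =>
    ((ha w).const_mul _).mono' (hc.comp (Continuous.prodMk_left w)).aestronglyMeasurable
      (Eventually.of_forall (hle w))
  refine (integrable_prod_iff' hm).2 ⟨Eventually.of_forall hi, ?_⟩
  refine ((memLp_one_iff_integrable.1 hF.2).norm.const_mul
    (M * ∫ s : RSpace d, ‖atom 0 s‖)).mono' hm.norm.prod_swap.integral_prod_right'
    (Eventually.of_forall fun w => ?_)
  rw [Real.norm_of_nonneg (integral_nonneg fun s => norm_nonneg _)]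
  refine (integral_mono (hi w).norm ((ha w).const_mul _) (hle w)).trans_eq ?_
  rw [integral_const_mul, integral_norm_atom, normSq_star, norm_weighted]
  have : Real.exp (-(Real.pi / 2) * normSq w) =
      Real.exp (-Real.pi * normSq w) * Real.exp (Real.pi / 2 * normSq w) := by
    rw [← Real.exp_add]
    ring_nf
  rw [this]
  ring

theorem integral_mul_synthesis {F : CSpace d → ℂ} (hF : F ∈ fockSubmodule d 1)
    {k : RSpace d → ℂ} (hk : Continuous k) {M : ℝ} (hM : ∀ s, ‖k s‖ ≤ M) :
    ∫ s, k s * synthesis F s = ∫ w, F w * gaussWeight w * ∫ s, atom (star w) s * k s := by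
  have h := integral_integral_swap (f := fun (s : RSpace d) (w : CSpace d) =>
    k s * (F w * gaussWeight w * atom (star w) s)) (integrable_synthesis_integrand hF hk hM)
  simp_rw [integral_const_mul] at h
  refine h.trans (integral_congr_ae (Eventually.of_forall fun w => ?_))
  simp only
  rw [← integral_const_mul]
  refine integral_congr_ae (Eventually.of_forall fun s => ?_)
  ring

/-- A Schwartz function is the superposition of Gaussian atoms with its Bargmann transform. -/
theorem synthesis_bargmann (f : 𝓢(RSpace d, ℂ)) : synthesis (bargmann (toTD f)) = f := by
  have hF := bargmann_toTD_mem_one f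
  set F := bargmann (toTD f)
  have hi : ∀ (z : CSpace d), Integrable fun t => atom z t * synthesis F t := fun z =>
    ((atom z).integrable (μ := volume)).mul_bdd (c := ∫ w, ‖windowConst d‖ * ‖weighted F w‖)
      (continuous_synthesis hF).aestronglyMeasurable
      (Eventually.of_forall (norm_synthesis_le hF))
  -- The difference is bounded and continuous, and its integrals against all atoms vanish: against
  -- $\mathrm{atom}_z$ the synthesis gives the reproducing integral of $F=Bf$.
  have h : (fun s => synthesis F s - f s) = 0 := by
    refine eq_zero_of_integral_atom_mul ((continuous_synthesis hF).sub f.continuous)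
      (M := (∫ w, ‖windowConst d‖ * ‖weighted F w‖) + SchwartzMap.seminorm ℝ 0 0 f)
      (fun s => (norm_sub_le _ _).trans
        (add_le_add (norm_synthesis_le hF s) (norm_le_seminorm ℝ f s))) fun z => ?_
    simp_rw [mul_sub]
    rw [integral_sub (hi z) (integrable_atom_mul f z), integral_mul_synthesis hF
      (atom z).continuous (norm_atom_le z), ← bargmann_toTD, sub_eq_zero]
    refine Eq.trans ?_ (reproducing hF.1 (integrable_reproducing le_rfl hF.1.continuous hF.2 z))
    refine integral_congr_ae (Eventually.of_forall fun w => ?_)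
    have hk : ∫ s, atom (star w) s * atom z s = kernel (star w) z := by
      rw [← bargmann_toTD, bargmann_atom, kernel_comm]
    simp only [hk]
    ring
  funext s
  exact sub_eq_zero.1 (congrFun h s)

/-! ### Distributions that act on convolutions by integration -/

/-- The translate `g(· - s)` of a Schwartz function. -/
abbrev shift (s : RSpace d) (g : 𝓢(RSpace d, ℂ)) : 𝓢(RSpace d, ℂ) :=
  SchwartzMap.compSubConstCLM ℂ s g

/-- Tempered distributions `u` for which `s ↦ ⟨u, g(· - s)⟩` is bounded and continuous, and
`⟨u, f * g⟩ = ∫ f(s) ⟨u, g(· - s)⟩ ds`. -/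
structure ConvolvesByIntegral (u : 𝓢'(RSpace d, ℂ)) : Prop where
  continuous : ∀ g, Continuous fun s => u (shift s g)
  bounded : ∀ g, ∃ M : ℝ, ∀ s, ‖u (shift s g)‖ ≤ M
  apply_schwartzConv : ∀ f g, u (schwartzConv f g) = ∫ s, f s * u (shift s g)

theorem schwartzConv_comm (f g : 𝓢(RSpace d, ℂ)) : schwartzConv f g = schwartzConv g f := by
  have h : (ContinuousLinearMap.mul ℂ ℂ).flip = ContinuousLinearMap.mul ℂ ℂ := by
    ext
    simp
  rw [schwartzConv, ← SchwartzMap.convolution_flip, h]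

/-- Expanding $f$ into atoms under $\int f(s)\langle u,g(\cdot-s)\rangle\,ds$ is legitimate because
the second factor is bounded and continuous. -/
theorem ConvolvesByIntegral.apply_schwartzConv_eq {u : 𝓢'(RSpace d, ℂ)}
    (hu : ConvolvesByIntegral u) (f g : 𝓢(RSpace d, ℂ)) :
    u (schwartzConv f g) = ∫ w, bargmann (toTD f) w * gaussWeight w *
      u (schwartzConv (atom (star w)) g) := by
  obtain ⟨M, hM⟩ := hu.bounded g
  have h := integral_mul_synthesis (bargmann_toTD_mem_one f) (hu.continuous g) hM
  rw [synthesis_bargmann] at h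
  simp_rw [hu.apply_schwartzConv]
  rw [← h]
  exact integral_congr_ae (Eventually.of_forall fun s => mul_comm _ _)

theorem bargmann_reflect (f : 𝓢(RSpace d, ℂ)) (z : CSpace d) :
    bargmann (toTD (reflect f)) z = bargmann (toTD f) (-z) := by
  rw [bargmann_toTD, bargmann_toTD, ← reflect_atom, ← integral_neg_eq_self]
  refine integral_congr_ae (Eventually.of_forall fun t => ?_)
  simp only [reflect_apply, neg_neg]

/-- Both $f$ and $g$ are expanded into atoms, the second after commuting the convolution. Hence
$u*f$ is determined by the transforms of $u*\mathrm{atom}_a$. -/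
theorem ConvolvesByIntegral.conv_apply_eq {u : 𝓢'(RSpace d, ℂ)} (hu : ConvolvesByIntegral u)
    (f g : 𝓢(RSpace d, ℂ)) :
    conv u f g = ∫ w, bargmann (toTD f) w * gaussWeight w *
      ∫ z, bargmann (toTD g) (star z) * gaussWeight z * bargmann (conv u (atom (star w))) z := by
  have hg : ∀ z : CSpace d, gaussWeight (-z) = gaussWeight z := fun z => by
    rw [gaussWeight, normSq_neg, gaussWeight]
  rw [conv_apply, hu.apply_schwartzConv_eq, ← integral_neg_eq_self]
  refine integral_congr_ae (Eventually.of_forall fun w => ?_)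
  simp only [bargmann_reflect, neg_neg, hg, star_neg]
  rw [schwartzConv_comm, hu.apply_schwartzConv_eq,
    ← measurePreserving_star.integral_comp measurableEmbedding_star]
  congr 1
  refine integral_congr_ae (Eventually.of_forall fun z => ?_)
  simp only [gaussWeight_star, star_star]
  have hb : bargmann (conv u (atom (star w))) z = conv u (atom (star w)) (atom z) := rfl
  rw [schwartzConv_comm, hb, conv_apply, reflect_atom]

/-! ### Inverse Bargmann transforms act on convolutions by integration -/

section Regularity

variable {p : ℝ≥0∞} [hp : Fact (1 ≤ p)]

theorem invBargmann_shift (F : FockSpace d p) (s : RSpace d) (g : 𝓢(RSpace d, ℂ)) :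
    invBargmann F (shift s g) = invBargmann (fockShift (-s) F) g := by
  rw [invBargmann_fockShift, translate_apply, neg_neg]

theorem invBargmann_shift_apply (F : FockSpace d p) (s : RSpace d) (g : 𝓢(RSpace d, ℂ)) :
    invBargmann F (shift s g) =
      ∫ w, shiftFun (-s) F w * gaussWeight w * bargmann (toTD g) (star w) := by
  rw [invBargmann_shift, invBargmann_apply]
  rfl

theorem continuous_shiftFun {F : CSpace d → ℂ} (hF : Continuous F) :
    Continuous fun q : RSpace d × CSpace d => shiftFun q.1 F q.2 := by
  unfold shiftFun
  fun_prop

theorem norm_weighted_fockShift_le {F : CSpace d → ℂ} {M : ℝ} (hM : ∀ w, ‖weighted F w‖ ≤ M)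
    (y : RSpace d) (w : CSpace d) : ‖weighted (shiftFun y F) w‖ ≤ M := by
  rw [norm_weighted_shiftFun]
  exact hM _

theorem norm_shifted_pairing_le {F : CSpace d → ℂ} {M : ℝ} (hM : ∀ w, ‖weighted F w‖ ≤ M)
    (g : 𝓢(RSpace d, ℂ)) (s : RSpace d) (w : CSpace d) :
    ‖shiftFun (-s) F w * gaussWeight w * bargmann (toTD g) (star w)‖ ≤
      M * decayNorm g * decayWeight w :=
  norm_bargmann_pairing_le (norm_weighted_fockShift_le hM _) g w

theorem continuous_integral_shifted_pairing {F : CSpace d → ℂ} (hF : Continuous F) {M : ℝ}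
    (hM : ∀ w, ‖weighted F w‖ ≤ M) (g : 𝓢(RSpace d, ℂ)) : Continuous fun s : RSpace d =>
      ∫ w, shiftFun (-s) F w * gaussWeight w * bargmann (toTD g) (star w) := by
  have hb := (differentiable_bargmann (toTD g)).continuous
  have h1 : ∀ s : RSpace d, Continuous fun w : CSpace d =>
      shiftFun (-s) F w * gaussWeight w * bargmann (toTD g) (star w) := by
    intro s
    have h2 : Continuous fun w : CSpace d => bargmann (toTD g) (star w) := hb.comp continuous_star
    unfold shiftFun gaussWeight
    fun_prop
  have h3 : ∀ w : CSpace d, Continuous fun s : RSpace d =>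
      shiftFun (-s) F w * gaussWeight w * bargmann (toTD g) (star w) := by
    intro w
    unfold shiftFun
    fun_prop
  exact continuous_of_dominated (bound := fun w => M * decayNorm g * decayWeight w)
    (fun s => (h1 s).aestronglyMeasurable)
    (fun s => Eventually.of_forall (norm_shifted_pairing_le hM g s))
    (integrable_decayWeight.const_mul _) (Eventually.of_forall h3)

theorem continuous_invBargmann_shift (F : FockSpace d p) (g : 𝓢(RSpace d, ℂ)) :
    Continuous fun s => invBargmann F (shift s g) := by
  obtain ⟨M, -, hM⟩ := exists_weighted_bound hp.out F.2
  exact (continuous_integral_shifted_pairing F.2.1.continuous hM g).congr fun s =>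
    (invBargmann_shift_apply F s g).symm

theorem exists_norm_invBargmann_shift_le (F : FockSpace d p) (g : 𝓢(RSpace d, ℂ)) :
    ∃ M : ℝ, ∀ s, ‖invBargmann F (shift s g)‖ ≤ M := by
  obtain ⟨M, -, hM⟩ := exists_weighted_bound hp.out F.2
  refine ⟨∫ w : CSpace d, M * decayNorm g * decayWeight w, fun s => ?_⟩
  rw [invBargmann_shift_apply]
  exact norm_integral_le_of_norm_le (integrable_decayWeight.const_mul _)
    (Eventually.of_forall (norm_shifted_pairing_le hM g s))

theorem bargmann_schwartzConv (f g : 𝓢(RSpace d, ℂ)) (z : CSpace d) :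
    bargmann (toTD (schwartzConv f g)) z = ∫ s, f s * bargmann (toTD (shift s g)) z := by
  have hi := ((f.integrable (μ := volume)).convolution_integrand (ContinuousLinearMap.mul ℂ ℂ)
    (g.integrable (μ := volume)))
  have hi2 : Integrable (fun q : RSpace d × RSpace d =>
      atom z q.1 * (f q.2 * g (q.1 - q.2))) (volume.prod volume) :=
    hi.bdd_mul (c := ‖windowConst d‖ * Real.exp (Real.pi / 2 * normSq z))
      ((atom z).continuous.comp continuous_fst).aestronglyMeasurable
      (Eventually.of_forall fun q => norm_atom_le z q.1)
  have h := integral_integral_swap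
    (f := fun t s : RSpace d => atom z t * (f s * g (t - s))) hi2
  rw [bargmann_toTD]
  simp_rw [schwartzConv_apply, ← integral_const_mul]
  rw [h]
  refine integral_congr_ae (Eventually.of_forall fun s => ?_)
  simp only
  rw [bargmann_toTD, ← integral_const_mul]
  refine integral_congr_ae (Eventually.of_forall fun t => ?_)
  simp only [SchwartzMap.compSubConstCLM_apply]
  ring

/-- Fubini applies since $f$ is integrable, the weighted $F$ is bounded, and the weighted transform
of $g(\cdot-s)$ has an $L^1$ norm independent of $s$. -/
theorem invBargmann_schwartzConv (F : FockSpace d p) (f g : 𝓢(RSpace d, ℂ)) :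
    invBargmann F (schwartzConv f g) = ∫ s, f s * invBargmann F (shift s g) := by
  obtain ⟨M, hM0, hM⟩ := exists_weighted_bound hp.out F.2
  have hF : Continuous (F : CSpace d → ℂ) := F.2.1.continuous
  have hG := bargmann_toTD_mem_one g
  have hb := hG.1.continuous
  set G := bargmann (toTD g)
  set c : ℝ := ∫ w, ‖weighted G w‖
  have hshift : ∀ (s : RSpace d) (w : CSpace d),
      bargmann (toTD (shift s g)) w = shiftFun s G w := bargmann_compSubConst (g := g)
  have hc : Continuous fun q : RSpace d × CSpace d =>
      f q.1 * (F q.2 * gaussWeight q.2 * bargmann (toTD (shift q.1 g)) (star q.2)) := by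
    simp_rw [hshift]
    have h1 : Continuous fun q : RSpace d × CSpace d => shiftFun q.1 G (star q.2) :=
      (continuous_shiftFun hb).comp
        (continuous_fst.prodMk (continuous_star.comp continuous_snd))
    exact (f.continuous.comp continuous_fst).mul
      (((hF.comp continuous_snd).mul (continuous_gaussWeight.comp continuous_snd)).mul h1)
  have hm := hc.aestronglyMeasurable (μ := volume.prod volume)
  have hGs : ∀ s : RSpace d, Integrable (fun w => ‖weighted G (star w - toC s)‖) ∧
      ∫ w, ‖weighted G (star w - toC s)‖ = c := by
    intro s
    have hw := memLp_one_iff_integrable.1 hG.2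
    have h1 := (measurePreserving_sub_right (volume : Measure (CSpace d)) (toC s)).comp
      measurePreserving_star
    have he : MeasurableEmbedding ((fun x : CSpace d => x - toC s) ∘ star) :=
      (MeasurableEquiv.subRight (toC s)).measurableEmbedding.comp measurableEmbedding_star
    exact ⟨(h1.integrable_comp_emb he).2 hw.norm, h1.integral_comp he fun w => ‖weighted G w‖⟩
  have hle : ∀ (s : RSpace d) (w : CSpace d),
      ‖f s * (F w * gaussWeight w * bargmann (toTD (shift s g)) (star w))‖ ≤
        ‖f s‖ * M * ‖weighted G (star w - toC s)‖ := by
    intro s w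
    rw [norm_mul, norm_bargmann_pairing, funext (hshift s), norm_weighted_shiftFun, mul_assoc]
    gcongr
    exact hM w
  have hi : Integrable (fun q : RSpace d × CSpace d =>
      f q.1 * (F q.2 * gaussWeight q.2 * bargmann (toTD (shift q.1 g)) (star q.2)))
      (volume.prod volume) := by
    refine (integrable_prod_iff hm).2 ⟨Eventually.of_forall fun s =>
      (integrable_bargmann_pairing F (shift s g)).const_mul (f s), ?_⟩
    refine ((f.integrable (μ := volume)).norm.mul_const (M * c)).mono'
      hm.norm.integral_prod_right' (Eventually.of_forall fun s => ?_)
    rw [Real.norm_of_nonneg (integral_nonneg fun w => norm_nonneg _)]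
    refine (integral_mono ((integrable_bargmann_pairing F (shift s g)).const_mul (f s)).norm
      ((hGs s).1.const_mul _) (hle s)).trans_eq ?_
    rw [integral_const_mul, (hGs s).2, mul_assoc]
  have h := integral_integral_swap (f := fun (s : RSpace d) (w : CSpace d) =>
    f s * (F w * gaussWeight w * bargmann (toTD (shift s g)) (star w))) hi
  simp_rw [integral_const_mul] at h
  simp_rw [invBargmann_apply]
  rw [h]
  refine integral_congr_ae (Eventually.of_forall fun w => ?_)
  simp only
  rw [bargmann_schwartzConv, ← integral_const_mul]
  refine integral_congr_ae (Eventually.of_forall fun s => ?_)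
  simp only
  ring

theorem convolvesByIntegral_invBargmann (F : FockSpace d p) :
    ConvolvesByIntegral (invBargmann F) :=
  ⟨continuous_invBargmann_shift F, exists_norm_invBargmann_shift_le F,
    invBargmann_schwartzConv F⟩

end Regularity

/-! ### Dilations -/

/-- The dilation `g(√2 ·)` of a Schwartz function. -/
def dilation : 𝓢(RSpace d, ℂ) →L[ℂ] 𝓢(RSpace d, ℂ) :=
  SchwartzMap.compCLMOfContinuousLinearEquiv ℂ
    (ContinuousLinearEquiv.smulLeft (Units.mk0 (√2) (by positivity)))

theorem dilation_apply (g : 𝓢(RSpace d, ℂ)) (t : RSpace d) : dilation g t = g (√2 • t) := rfl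

/-- The distribution `g ↦ ⟨u, g(√2 ·)⟩`. -/
def dilationTD (u : 𝓢'(RSpace d, ℂ)) : 𝓢'(RSpace d, ℂ) :=
  PointwiseConvergenceCLM.precomp ℂ dilation u

theorem dilationTD_apply (u : 𝓢'(RSpace d, ℂ)) (g : 𝓢(RSpace d, ℂ)) :
    dilationTD u g = u (dilation g) := rfl

theorem dilation_shift (s : RSpace d) (g : 𝓢(RSpace d, ℂ)) :
    dilation (shift (√2 • s) g) = shift s (dilation g) := by
  ext t
  rw [dilation_apply, shift, shift, SchwartzMap.compSubConstCLM_apply,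
    SchwartzMap.compSubConstCLM_apply, dilation_apply, smul_sub]

theorem integral_dilation (f : RSpace d → ℂ) :
    ∫ s, f s = ((√2 ^ d : ℝ) : ℂ) * ∫ s, f (√2 • s) := by
  have h := Measure.integral_comp_smul_of_nonneg volume f (√2) (hR := by positivity)
  rw [h, finrank_euclideanSpace, Fintype.card_fin, Complex.real_smul, ← mul_assoc,
    ← Complex.ofReal_mul, mul_inv_cancel₀ (by positivity), Complex.ofReal_one, one_mul]

theorem dilation_schwartzConv (f g : 𝓢(RSpace d, ℂ)) :
    dilation (schwartzConv f g) =
      ((√2 ^ d : ℝ) : ℂ) • schwartzConv (dilation f) (dilation g) := by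
  ext t
  rw [dilation_apply, schwartzConv_apply, smul_apply, schwartzConv_apply, integral_dilation,
    smul_eq_mul]
  simp_rw [dilation_apply, smul_sub]

/-- The Jacobian $(\sqrt2)^d$ from dilating a convolution cancels the one from the substitution
$s\mapsto\sqrt2s$, which also matches the shifts. -/
theorem ConvolvesByIntegral.dilationTD {u : 𝓢'(RSpace d, ℂ)} (hu : ConvolvesByIntegral u) :
    ConvolvesByIntegral (dilationTD u) := by
  have hs : ∀ (s : RSpace d) g, SobolevFock.dilationTD u (shift (√2 • s) g) =
      u (shift s (dilation g)) := fun s g => by rw [dilationTD_apply, dilation_shift]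
  have h2 : (√2 : ℝ) ≠ 0 := by positivity
  have hs' : ∀ (s : RSpace d) g, SobolevFock.dilationTD u (shift s g) =
      u (shift ((√2)⁻¹ • s) (dilation g)) := fun s g => by
    rw [← hs, smul_inv_smul₀ h2]
  refine ⟨fun g => ?_, fun g => ?_, fun f g => ?_⟩
  · simp_rw [hs']
    exact (hu.continuous (dilation g)).comp (continuous_const_smul _)
  · obtain ⟨M, hM⟩ := hu.bounded (dilation g)
    refine ⟨M, fun s => ?_⟩
    rw [hs']
    exact hM _
  · rw [integral_dilation]
    simp_rw [hs]
    rw [dilationTD_apply, dilation_schwartzConv, map_smul, hu.apply_schwartzConv, smul_eq_mul]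
    simp_rw [dilation_apply]

/-! ### Translation invariant operators on the Fock space -/

section TranslationInvariance

variable {p : ℝ≥0∞} [hp : Fact (1 ≤ p)]

theorem fockShift_kernel_zero (y : RSpace d) :
    fockShift y (FockSpace.kernel 0 : FockSpace d p) =
      Complex.exp (-(Real.pi * ‖y‖ ^ 2 / 2 : ℝ)) • FockSpace.kernel (toC y) := by
  refine FockSpace.ext fun w => ?_
  rw [FockSpace.smul_apply, FockSpace.kernel_apply]
  change shiftFun y (kernel 0) w = _
  rw [shiftFun, kernel, zero_cdot, mul_zero, Complex.exp_zero, mul_one, kernel]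

/-- The kernel at a real point is a scalar multiple of a shift of $K_0=1$, so commutation with the
shifts reduces $SK_y$ to $SK_0$. -/
theorem TranslationInvariant.apply_kernel_toC {S : FockSpace d p →L[ℂ] FockSpace d p}
    (hS : TranslationInvariant S) (y : RSpace d) (z : CSpace d) :
    S (FockSpace.kernel (toC y)) z = kernel (toC y) z * S (FockSpace.kernel 0) (z - toC y) := by
  have h := congrArg (FockSpace.eval z) (hS y (FockSpace.kernel 0))
  rw [fockShift_kernel_zero, map_smul, FockSpace.eval_apply, FockSpace.smul_apply,
    FockSpace.eval_apply] at h
  have h2 : fockShift y (S (FockSpace.kernel 0)) z =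
      Complex.exp (-(Real.pi * ‖y‖ ^ 2 / 2 : ℝ)) * Complex.exp (Real.pi * cdot (toC y) z) *
        S (FockSpace.kernel 0) (z - toC y) := rfl
  rw [h2, mul_assoc] at h
  exact mul_left_cancel₀ (Complex.exp_ne_zero _) h

/-- An entire function on `ℂ^d` is determined by its values on `ℝ^d`. -/
theorem eq_of_eq_on_real {f g : CSpace d → ℂ} (hf : Differentiable ℂ f)
    (hg : Differentiable ℂ g) (h : ∀ y, f (toC y) = g (toC y)) : f = g := by
  funext a
  set x : RSpace d := reC a
  set y : RSpace d := WithLp.toLp 2 fun j => (a j).im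
  -- On the complex line $s\mapsto x+sy$ with $a=x+iy$, real $s$ gives points of $\mathbb R^d$ and
  -- $s=i$ gives $a$; the one-variable identity theorem applies.
  have hline : Differentiable ℂ fun s : ℂ => toC x + s • toC y := by fun_prop
  have hf1 : AnalyticOnNhd ℂ (fun s : ℂ => f (toC x + s • toC y)) Set.univ :=
    fun s _ => (hf.comp hline).analyticAt s
  have hg1 : AnalyticOnNhd ℂ (fun s : ℂ => g (toC x + s • toC y)) Set.univ :=
    fun s _ => (hg.comp hline).analyticAt s
  have hreal : ∀ r : ℝ, f (toC x + (r : ℂ) • toC y) = g (toC x + (r : ℂ) • toC y) := by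
    intro r
    rw [← toC_smul, ← toC_add]
    exact h _
  have hfreq : ∃ᶠ s in 𝓝[≠] (0 : ℂ), f (toC x + s • toC y) = g (toC x + s • toC y) := by
    have ht : Tendsto (fun r : ℝ => (r : ℂ)) (𝓝[≠] 0) (𝓝[≠] 0) := by
      refine tendsto_nhdsWithin_iff.2 ⟨?_, ?_⟩
      · exact (Complex.continuous_ofReal.tendsto' 0 0 Complex.ofReal_zero).mono_left
          nhdsWithin_le_nhds
      · filter_upwards [self_mem_nhdsWithin] with r hr
        simpa using hr
    exact ht.frequently (Eventually.of_forall hreal).frequently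
  have := congrFun (hf1.eq_of_frequently_eq hg1 hfreq) Complex.I
  have ha : toC x + Complex.I • toC y = a := by
    funext j
    refine Complex.ext ?_ ?_ <;> simp [toC, x, y]
  rwa [ha] at this

/-- Analytic continuation in $a$ from $\mathbb R^d$ to $\mathbb C^d$, using the holomorphy of
$a\mapsto K_a$ in $\mathcal F^p$. -/
theorem TranslationInvariant.apply_kernel {S : FockSpace d p →L[ℂ] FockSpace d p}
    (hS : TranslationInvariant S) (a z : CSpace d) :
    S (FockSpace.kernel a) z = kernel a z * S (FockSpace.kernel 0) (z - a) := by
  have h1 : Differentiable ℂ fun a => S (FockSpace.kernel a) z :=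
    ((FockSpace.eval z).comp S).differentiable.comp FockSpace.differentiable_kernel
  have h2 : Differentiable ℂ fun a => kernel a z * S (FockSpace.kernel 0) (z - a) := by
    have h3 : Differentiable ℂ fun a : CSpace d => S (FockSpace.kernel 0) (z - a) :=
      (S (FockSpace.kernel 0)).2.1.comp (differentiable_id.const_sub z)
    have h4 : Differentiable ℂ fun a : CSpace d => kernel a z := by fun_prop
    exact h4.mul h3
  exact congrFun (eq_of_eq_on_real h1 h2 fun y => hS.apply_kernel_toC y z) a

theorem TranslationInvariant.exists_bound {S : FockSpace d p →L[ℂ] FockSpace d p}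
    (hS : TranslationInvariant S) : ∃ C : ℝ, ∀ v : CSpace d,
      ‖S (FockSpace.kernel 0) v‖ ≤ C * Real.exp (Real.pi / 4 * (normSq v + (cdot v v).re)) := by
  obtain ⟨C, hC, hk⟩ := FockSpace.exists_norm_kernel_le d p
  obtain ⟨K, hK, he⟩ := exists_norm_weighted_le d hp.out
  refine ⟨K * (‖S‖ * C), fun v => ?_⟩
  -- At $a=-z$ the identity reads $SK_{-z}(z)=e^{-\pi z\cdot z}\Phi(v)$. The kernel norm and the
  -- point evaluation each contribute $e^{\pi|z|^2/2}=e^{\pi|v|^2/8}$.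
  set z : CSpace d := (1 / 2 : ℂ) • v
  have hn : normSq z = normSq v / 4 := by
    rw [normSq_smul]
    norm_num
    ring
  have hz : z - -z = v := by
    simp only [z, sub_neg_eq_add, ← add_smul]
    norm_num
  have h := hS.apply_kernel (-z) z
  rw [hz] at h
  have h1 : ‖S (FockSpace.kernel (-z)) z‖ ≤ K * (‖S‖ * C) *
      (Real.exp (Real.pi / 2 * normSq z) * Real.exp (Real.pi / 2 * normSq z)) := by
    have h2 := norm_le_of_weighted_le (he _ (S (FockSpace.kernel (-z))).2 z)
    rw [← FockSpace.norm_def] at h2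
    have h3 := hk (-z)
    rw [normSq_neg] at h3
    calc ‖S (FockSpace.kernel (-z)) z‖
        ≤ K * ‖S (FockSpace.kernel (-z))‖ * Real.exp (Real.pi / 2 * normSq z) := h2
      _ ≤ K * (‖S‖ * (C * Real.exp (Real.pi / 2 * normSq z))) *
          Real.exp (Real.pi / 2 * normSq z) := by
        gcongr
        exact (S.le_opNorm _).trans (by gcongr)
      _ = _ := by ring
  have h2 : ‖kernel (-z) z‖ = Real.exp (-(Real.pi / 4 * (cdot v v).re)) := by
    have hc : cdot (-z) z = ((-(1 / 4) : ℝ) : ℂ) * cdot v v := by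
      rw [neg_cdot, smul_cdot, cdot_smul]
      push_cast
      ring
    rw [norm_kernel, hc, Complex.re_ofReal_mul]
    congr 1
    ring
  rw [h, norm_mul, h2, ← Real.exp_add, hn] at h1
  calc ‖S (FockSpace.kernel 0) v‖
      = Real.exp (Real.pi / 4 * (cdot v v).re) *
        (Real.exp (-(Real.pi / 4 * (cdot v v).re)) * ‖S (FockSpace.kernel 0) v‖) := by
        rw [← mul_assoc, ← Real.exp_add, add_neg_cancel, Real.exp_zero, one_mul]
    _ ≤ Real.exp (Real.pi / 4 * (cdot v v).re) * (K * (‖S‖ * C) *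
        Real.exp (Real.pi / 2 * (normSq v / 4) + Real.pi / 2 * (normSq v / 4))) := by gcongr
    _ = K * (‖S‖ * C) * (Real.exp (Real.pi / 4 * (cdot v v).re) *
        Real.exp (Real.pi / 2 * (normSq v / 4) + Real.pi / 2 * (normSq v / 4))) := by ring
    _ = _ := by
      rw [← Real.exp_add]
      congr 2
      ring

/-- The Fock space function whose inverse Bargmann transform is a dilation of the convolution
kernel of a translation invariant operator. -/
def kernelSymbol (Φ : CSpace d → ℂ) (z : CSpace d) : ℂ :=
  windowConst d * Complex.exp (-(Real.pi / 2 * cdot z z)) * Φ ((√2 : ℂ) • z)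

/-- At $v=\sqrt2z$ the bound is $Ce^{\frac{\pi}{2}(|z|^2+\mathrm{Re}\,z\cdot z)}$: the weight
cancels the first term and the factor $e^{-\pi z\cdot z/2}$ the second, with nothing left over.
Hence $\mathcal F^\infty$, whatever $p$. -/
theorem kernelSymbol_mem {Φ : CSpace d → ℂ} (hΦ : Differentiable ℂ Φ) {C : ℝ}
    (hC : ∀ v, ‖Φ v‖ ≤ C * Real.exp (Real.pi / 4 * (normSq v + (cdot v v).re))) :
    kernelSymbol Φ ∈ fockSubmodule d ∞ := by
  have hd : Differentiable ℂ (kernelSymbol Φ) := by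
    have h1 : Differentiable ℂ fun z : CSpace d => Φ ((√2 : ℂ) • z) :=
      hΦ.comp (differentiable_id.const_smul (√2 : ℂ))
    have h2 : Differentiable ℂ fun z : CSpace d =>
      windowConst d * Complex.exp (-(Real.pi / 2 * cdot z z)) := by fun_prop
    exact h2.mul h1
  refine ⟨hd, memLp_top_of_bound (continuous_weighted hd.continuous).aestronglyMeasurable
    (‖windowConst d‖ * C) (Eventually.of_forall fun z => ?_)⟩
  have h := hC ((√2 : ℂ) • z)
  have h2 : ((√2 : ℝ) : ℂ) * ((√2 : ℝ) : ℂ) = 2 := by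
    rw [← Complex.ofReal_mul, Real.mul_self_sqrt (by norm_num)]
    norm_num
  have h3 : (cdot ((√2 : ℂ) • z) ((√2 : ℂ) • z)).re = 2 * (cdot z z).re := by
    rw [smul_cdot, cdot_smul, ← mul_assoc, h2]
    simp
  have h4 : normSq ((√2 : ℂ) • z) = 2 * normSq z := by
    rw [normSq_smul, Complex.norm_real, Real.norm_eq_abs, sq_abs, Real.sq_sqrt (by norm_num)]
  have h5 : (-((Real.pi : ℂ) / 2 * cdot z z)).re = -(Real.pi / 2 * (cdot z z).re) := by
    rw [Complex.neg_re, ← Complex.ofReal_ofNat, ← Complex.ofReal_div, Complex.re_ofReal_mul]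
  rw [h3, h4] at h
  rw [norm_weighted, kernelSymbol, norm_mul, norm_mul, Complex.norm_exp, h5]
  calc ‖windowConst d‖ * Real.exp (-(Real.pi / 2 * (cdot z z).re)) * ‖Φ ((√2 : ℂ) • z)‖ *
        Real.exp (-(Real.pi / 2) * normSq z)
      ≤ ‖windowConst d‖ * Real.exp (-(Real.pi / 2 * (cdot z z).re)) *
        (C * Real.exp (Real.pi / 4 * (2 * normSq z + 2 * (cdot z z).re))) *
        Real.exp (-(Real.pi / 2) * normSq z) := by gcongr
    _ = ‖windowConst d‖ * C * (Real.exp (-(Real.pi / 2 * (cdot z z).re)) *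
        Real.exp (Real.pi / 4 * (2 * normSq z + 2 * (cdot z z).re)) *
        Real.exp (-(Real.pi / 2) * normSq z)) := by ring
    _ = ‖windowConst d‖ * C := by
      rw [← Real.exp_add, ← Real.exp_add]
      ring_nf
      simp

theorem dilation_gaussSchwartz (b : CSpace d) :
    dilation (gaussSchwartz (Real.pi / 2) Real.pi_div_two_pos b) =
      gaussSchwartz Real.pi Real.pi_pos ((√2 : ℂ) • b) := by
  ext t
  rw [dilation_apply]
  change Complex.exp (gaussExponent _ _ _) = Complex.exp (gaussExponent _ _ _)
  have h2 : ((√2 : ℝ) : ℂ) * ((√2 : ℝ) : ℂ) = 2 := by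
    rw [← Complex.ofReal_mul, Real.mul_self_sqrt (by norm_num)]
    norm_num
  rw [gaussExponent_eq, gaussExponent_eq, toC_smul, cdot_smul, cdot_smul, smul_cdot, smul_cdot]
  congr 1
  push_cast
  linear_combination (-(Real.pi / 2 * cdot (toC t) (toC t)) : ℂ) * h2

theorem symbol_dilationTD {Φ : CSpace d → ℂ} (hΦ : kernelSymbol Φ ∈ fockSubmodule d ∞)
    (z : CSpace d) :
    symbol (dilationTD (invBargmann (FockSpace.mk (kernelSymbol Φ) hΦ))) z = Φ (-z) := by
  have h2 : ((√2 : ℝ) : ℂ) * ((√2 : ℝ) : ℂ) = 2 := by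
    rw [← Complex.ofReal_mul, Real.mul_self_sqrt (by norm_num)]
    norm_num
  -- Dilation turns the Gaussian in $\phi_u(z)$ into one with exponent $\pi$ and linear term
  -- $-\sqrt2\pi z=2\pi\zeta$, so a Bargmann transform at $\zeta$ appears, with $\sqrt2\zeta=-z$.
  set ζ : CSpace d := (-(√2 : ℂ) / 2) • z
  have h3 : (√2 : ℂ) • (fun j => -Real.pi * z j : CSpace d) = (2 * Real.pi : ℂ) • ζ := by
    funext j
    simp only [ζ, Pi.smul_apply, smul_eq_mul]
    ring
  have h4 : (√2 : ℂ) • ζ = -z := by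
    simp only [ζ, smul_smul]
    have : (√2 : ℂ) * (-(√2 : ℂ) / 2) = -1 := by linear_combination (-(1 / 2) : ℂ) * h2
    rw [this, neg_one_smul]
  have h := congrFun (bargmann_invBargmann (FockSpace.mk (kernelSymbol Φ) hΦ)) ζ
  rw [FockSpace.mk_apply, kernelSymbol, bargmann_eq, h4] at h
  rw [symbol, dilationTD_apply, dilation_gaussSchwartz, h3]
  exact mul_left_cancel₀ (mul_ne_zero (windowConst_ne_zero d) (Complex.exp_ne_zero _)) h

/-- `F ↦ ⟨B⁻¹F, g⟩` as a bounded functional on the Fock space. -/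
def invBargmannEval (g : 𝓢(RSpace d, ℂ)) : FockSpace d p →L[ℂ] ℂ :=
  LinearMap.mkContinuousOfExistsBound
    { toFun := fun F => invBargmann F g
      map_add' := fun F G => by
        rw [invBargmann_add]
        rfl
      map_smul' := fun c F => by
        rw [invBargmann_smul]
        rfl } (by
      obtain ⟨C, hC, h⟩ := exists_norm_weighted_le d hp.out
      refine ⟨C * decayNorm g * ∫ w : CSpace d, decayWeight w, fun F => ?_⟩
      have h1 := h F F.2
      rw [← FockSpace.norm_def] at h1
      have h2 : ‖invBargmann F g‖ ≤ ∫ w : CSpace d, C * ‖F‖ * decayNorm g * decayWeight w :=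
        norm_integral_le_of_norm_le (integrable_decayWeight.const_mul _)
          (Eventually.of_forall (norm_bargmann_pairing_le h1 g))
      rw [integral_const_mul] at h2
      exact h2.trans_eq (by ring))

theorem invBargmannEval_apply (g : 𝓢(RSpace d, ℂ)) (F : FockSpace d p) :
    invBargmannEval g F = invBargmann F g := rfl

theorem TranslationInvariant.exists_convolutor {S : FockSpace d p →L[ℂ] FockSpace d p}
    (hS : TranslationInvariant S) : ∃ u ∈ convolutors d p, Extends S (symbol u) := by
  set Φ : CSpace d → ℂ := (S (FockSpace.kernel 0)).1
  obtain ⟨C, hC⟩ := hS.exists_bound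
  have hG := kernelSymbol_mem (S (FockSpace.kernel 0)).2.1 hC
  set u := dilationTD (invBargmann (FockSpace.mk (kernelSymbol Φ) hG))
  have hu : ConvolvesByIntegral u := (convolvesByIntegral_invBargmann _).dilationTD
  have hsym : ∀ a z, S (FockSpace.kernel a) z = kernel a z * symbol u (a - z) := by
    intro a z
    rw [symbol_dilationTD hG, neg_sub]
    exact hS.apply_kernel a z
  refine ⟨u, ⟨invBargmannMap p ∘ₗ S.toLinearMap ∘ₗ bargmannMap p, ⟨‖S‖, fun f => ?_⟩,
    fun y f => ?_, fun f => ?_⟩, extends_of_apply_kernel hsym⟩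
  · rw [modNorm_eq, modNorm_eq, LinearMap.comp_apply, bargmannMap_invBargmannMap]
    exact S.le_opNorm _
  · simp only [LinearMap.comp_apply, ContinuousLinearMap.coe_coe, bargmannMap_modTranslate, hS y,
      invBargmannMap_fockShift]
  · have hf1 := bargmann_toTD_mem_one f
    have hf : toTD f ∈ Modulation d p := mem_modulation_iff.2 (fockSubmodule_one_le hp.out hf1)
    refine ⟨hf, ?_⟩
    ext g
    -- The functional $F\mapsto\langle B^{-1}SF,g\rangle$ at $Bf\in\mathcal F^1$ expands over the
    -- kernels; `conv_apply_eq` expands $\langle u*f,g\rangle$ likewise, and the integrands agree by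
    -- `hsym`.
    have h := (FockSpace.apply_eq_integral ((invBargmannEval g).comp S) hf1).2
    rw [hu.conv_apply_eq]
    refine Eq.trans h.symm (integral_congr_ae (Eventually.of_forall fun w => ?_))
    simp only [ContinuousLinearMap.comp_apply, invBargmannEval_apply, invBargmann_apply]
    congr 1
    refine integral_congr_ae (Eventually.of_forall fun z => ?_)
    simp only
    rw [bargmann_conv_atom, ← hsym]
    ring

end TranslationInvariance

end SobolevFock

end

theorem mainTheorem1 (d : ℕ) (p : ℝ≥0∞) [Fact (1 ≤ p)] (hp : p ≠ ∞) :
    (∀ u ∈ SobolevFock.convolutors d p,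
      (∀ F ∈ SobolevFock.fockSubmodule d 1,
        (∀ z, Integrable (SobolevFock.fockIntegrand (SobolevFock.symbol u) F z)) ∧
        SobolevFock.fockIntegral (SobolevFock.symbol u) F ∈ SobolevFock.fockSubmodule d ∞) ∧
      ∃ S : SobolevFock.FockSpace d p →L[ℂ] SobolevFock.FockSpace d p,
        SobolevFock.Extends S (SobolevFock.symbol u) ∧
        SobolevFock.TranslationInvariant S ∧
        ∀ S' : SobolevFock.FockSpace d p →L[ℂ] SobolevFock.FockSpace d p,
          SobolevFock.Extends S' (SobolevFock.symbol u) → S' = S) ∧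
    (∀ S : SobolevFock.FockSpace d p →L[ℂ] SobolevFock.FockSpace d p,
      SobolevFock.TranslationInvariant S →
      ∃ u ∈ SobolevFock.convolutors d p, SobolevFock.Extends S (SobolevFock.symbol u)) := by
  exact ⟨fun u hu => SobolevFock.convolutors_fock_operator hp hu,
    fun S hS => hS.exists_convolutor⟩
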